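/- Graphs have vertex set $[n+1]=\{1,\dots,n+1\}$, $n\ge 1$, and edges are written $(i,j)$ with $i<j$. A graph is noncrossing if it has no edges $(i,k),(j,l)$ with $i<j<k<l$, and alternating if it has no edges $(i,j),(j,k)$ with $i<j<k$. The transitive closure $\overline T$ has the edge $(i,j)$ whenever $T$ has edges $(i,i_1),(i_1,i_2),\dots,(i_m,j)$ ($m\ge 0$) with $i<i_1<\dots<i_m<j$. An edge-labeled graph with $k$ edges has its edges labeled bijectively by $1,\dots,k$; $(i,j)_a$ is the edge $(i,j)$ with label $a$. A good tree $T$ is an edge-labeled noncrossing tree on $[n+1]$ such that: if $(i,j)_a,(j,k)_b$ are edges with $i<j<k$, then $a<b$; if $(i,j)_a,(i,k)_b$ are edges with $j<k$, then $a>b$; if $(i,j)_a,(k,j)_b$ are edges with $i<k$, then $a>b$. Reduction (2) replaces $(i,j)_a,(k,l)_{a+1}$ by $(k,l)_a,(i,j)_{a+1}$ when $i,j,k,l$ are distinct. Reduction (1) applies to edges $(i,j)_a,(j,k)_{a+1}$ with $i<j<k$ and gives three graphs, in which these two edges are replaced by, respectively, $(i,k)_a,(i,j)_{a+1}$; $(j,k)_a,(i,k)_{a+1}$;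 and $(i,k)_a$ alone (in the last case all labels greater than $a$ are lowered by $1$). A $\mathcal B$-reduction tree is a finite rooted tree whose nodes are labeled by edge-labeled graphs, in which each non-leaf has as children the three graphs obtained by a reduction (1); at any node (leaves included) reductions (2) may be applied to the label, and a leaf is a node to which reduction (1) cannot be applied even after reductions (2). An $\mathcal S$-reduction tree is the analogue without edge labels: a reduction is performed at any two edges $(i,j),(j,k)$, $i<j<k$, of $G_0$, the three children are obtained from $G_0$ by replacing these two edges by $\{(i,k),(i,j)\}$, by $\{(j,k),(i,k)\}$ and by $\{(i,k)\}$, and the leaves are the nodes labeled by alternating graphs. For a noncrossing tree $T$ with at least one edge, whose vertices are integers, let $P$ be the simple path in $T$ from its minimal to its maximal vertex, and write $T\setminus P$ as an edge-disjoint union of trees $T_1,\dots,T_k$ such that each vertex of $P$ lying in $T_l$ is the minimal or maximal vertex of $T_l$, with $k$ as small as possible. The set of pseudo-components of $T$ is $ps(T)=\{P\}\cup ps(T_1)\cup\dots\cup ps(T_k)$. A pseudo-component is on $[i,j]$, $i<j$, if its endpoints are $i$ and $j$; it is a left pseudo-component of $T$ if $T$ has no edge $(s,i)$ with $s<i$,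 and a right pseudo-component of $T$ if $T$ has no edge $(j,s)$ with $j<s$. Let $\mathcal F(T)$ be the set of noncrossing alternating spanning forests $F$ of $\overline T$ on $[n+1]$ that contain the edge $(1,n+1)$, at least one edge $(i_1,j)$ with $i_1\le i$ for each right pseudo-component of $T$ on $[i,j]$, and at least one edge $(i,j_1)$ with $j\le j_1$ for each left pseudo-component of $T$ on $[i,j]$. Each $F\in\mathcal F(T)$ is given its lexicographic edge labels: $(i_1,j_1)$ gets a smaller label than $(i_2,j_2)$ if $j_1>j_2$, or $j_1=j_2$ and $i_1>i_2$. **Theorem.** Let $T$ be a good tree on $[n+1]$, $n\ge1$. (a) For every $\mathcal B$-reduction tree with root $T$, the set of leaves is, up to applications of reduction (2), the set of all $F\in\mathcal F(T)$ with lexicographic edge labels: every leaf can be transformed by reductions (2) into such an $F$, and each such $F$ is obtained in this way from exactly one leaf. (b) There is a $\mathcal B$-reduction tree with root $T$ whose set of leaves is exactly the set of all $F\in\mathcal F(T)$ with lexicographic edge labels. (c) $\mathcal S$-reduction trees with root $T$ (edge labels forgotten) exist, and for every such tree and every $k$, the number $f_{T,k}$ of its leaves labeled by graphs with $k$ edges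 is equal to the number of $F\in\mathcal F(T)$ with exactly $k$ edges. -/

import Mathlib

namespace RootPoly

/-- The vertex set `[n+1] = {1, …, n+1}`; the vertex `v` is the element `v - 1` of `Fin (n + 1)`,
so the vertex `1` is `0` and the vertex `n+1` is `Fin.last n`. -/
abbrev Vertex (n : ℕ) : Type := Fin (n + 1)

/-- A graph on `[n+1]` whose edges are labeled `1, 2, …, k`, written as the list of its edges in
the order of their labels. Equivalently: a noncommutative monomial in the variables `x_{ij}`. -/
abbrev EdgeWord (n : ℕ) : Type := List (Vertex n × Vertex n)

/-- A graph on `[n+1]` without edge labels, possibly with repeated edges, written as the multiset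
of its edges. Equivalently: a commutative monomial in the variables `x_{ij}`. -/
abbrev EdgeMultiset (n : ℕ) : Type := Multiset (Vertex n × Vertex n)

/-- The simple graph on `[n+1]` underlying an edge-labeled graph. -/
def toGraph {n : ℕ} (w : EdgeWord n) : SimpleGraph (Vertex n) :=
  SimpleGraph.fromRel (fun a b => (a, b) ∈ w)

/-- Edges are written `(i, j)` with `i < j`, and no edge is repeated. -/
def IsLabeledGraph {n : ℕ} (w : EdgeWord n) : Prop :=
  w.Nodup ∧ ∀ e ∈ w, e.1 < e.2

/-! ### Noncrossing, alternating, transitive closure -/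

/-- No vertices `i < j < k < l` with edges `(i, k)` and `(j, l)`. -/
def Noncrossing {n : ℕ} (G : SimpleGraph (Vertex n)) : Prop :=
  ∀ i j k l : Vertex n, i < j → j < k → k < l → ¬ (G.Adj i k ∧ G.Adj j l)

/-- No vertices `i < j < k` with edges `(i, j)` and `(j, k)`. -/
def Alternating {n : ℕ} (G : SimpleGraph (Vertex n)) : Prop :=
  ∀ i j k : Vertex n, i < j → j < k → ¬ (G.Adj i j ∧ G.Adj j k)

/-- The transitive closure: `(i, j)`, `i < j`, is an edge when there are edges
`(i, i₁), (i₁, i₂), …, (iₘ, j)` of `G` with `i < i₁ < ⋯ < iₘ < j`. -/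
def transClosure {n : ℕ} (G : SimpleGraph (Vertex n)) : SimpleGraph (Vertex n) :=
  SimpleGraph.fromRel (Relation.TransGen (fun a b => a < b ∧ G.Adj a b))

/-! ### Good forests -/

/-- A good forest: an edge-labeled noncrossing forest whose labels satisfy three conditions
at each vertex. -/
structure IsGoodForest {n : ℕ} (w : EdgeWord n) : Prop where
  labeled : IsLabeledGraph w
  acyclic : (toGraph w).IsAcyclic
  /-- If `(i, j)_a` and `(j, k)_b` are edges, `i < j < k`, then `a < b`. -/
  cond_i : ∀ (a b : ℕ) (i j k : Vertex n), i < j → j < k →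
    w[a]? = some (i, j) → w[b]? = some (j, k) → a < b
  /-- If `(i, j)_a` and `(i, k)_b` are edges, `j < k`, then `a > b`. -/
  cond_ii : ∀ (a b : ℕ) (i j k : Vertex n), j < k →
    w[a]? = some (i, j) → w[b]? = some (i, k) → a > b
  /-- If `(i, j)_a` and `(k, j)_b` are edges, `i < k`, then `a > b`. -/
  cond_iii : ∀ (a b : ℕ) (i j k : Vertex n), i < k →
    w[a]? = some (i, j) → w[b]? = some (k, j) → a > b
  noncrossing : Noncrossing (toGraph w)

/-- A good tree: a good forest that is a tree on the vertex set `[n+1]`. -/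
def IsGoodTree {n : ℕ} (w : EdgeWord n) : Prop :=
  IsGoodForest w ∧ (toGraph w).IsTree

/-! ### Reductions in the noncommutative case -/

/-- Reduction (2): exchange `(i, j)_a`, `(k, l)_{a+1}` for `(k, l)_a`, `(i, j)_{a+1}`,
where `i, j, k, l` are distinct. -/
def CommStep {n : ℕ} (w w' : EdgeWord n) : Prop :=
  ∃ (p s : EdgeWord n) (i j k l : Vertex n), [i, j, k, l].Nodup ∧
    w = p ++ (i, j) :: (k, l) :: s ∧ w' = p ++ (k, l) :: (i, j) :: s

/-- `w'` is obtained from `w` by finitely many applications of reduction (2). -/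
def CommEquiv {n : ℕ} (w w' : EdgeWord n) : Prop :=
  Relation.ReflTransGen CommStep w w'

/-- The reduction rule `x_{ij} x_{jk} → x_{ik} x_{ij} + x_{jk} x_{ik} + β x_{ik}` can be applied
to `w` directly: there are edges `(i, j)_a`, `(j, k)_{a+1}` with `i < j < k`. -/
def BReducible {n : ℕ} (w : EdgeWord n) : Prop :=
  ∃ (p s : EdgeWord n) (i j k : Vertex n), i < j ∧ j < k ∧ w = p ++ (i, j) :: (j, k) :: s

/-- A `𝓑`-reduction tree with root labeled `w`. Between reductions the label of a node may be
changed by reduction (2). The label of a leaf admits no reduction, even after applications of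
reduction (2). -/
inductive BReductionTree {n : ℕ} : EdgeWord n → Type
  | leaf (w : EdgeWord n) (h : ∀ w', CommEquiv w w' → ¬ BReducible w') : BReductionTree w
  | commute (w w' : EdgeWord n) (h : CommStep w w') (t : BReductionTree w') : BReductionTree w
  | reduce (w p s : EdgeWord n) (i j k : Vertex n) (hij : i < j) (hjk : j < k)
      (h : w = p ++ (i, j) :: (j, k) :: s)
      (t₁ : BReductionTree (p ++ (i, k) :: (i, j) :: s))
      (t₂ : BReductionTree (p ++ (j, k) :: (i, k) :: s))
      (t₃ : BReductionTree (p ++ (i, k) :: s)) : BReductionTree w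

/-- The labels of the leaves of a `𝓑`-reduction tree, one entry for each leaf. -/
def BReductionTree.leaves {n : ℕ} : {w : EdgeWord n} → BReductionTree w → List (EdgeWord n)
  | _, .leaf w _ => [w]
  | _, .commute _ _ _ t => t.leaves
  | _, .reduce _ _ _ _ _ _ _ _ _ t₁ t₂ t₃ => t₁.leaves ++ t₂.leaves ++ t₃.leaves

/-! ### Reductions in the commutative case -/

/-- An `𝓢`-reduction tree with root labeled `m`: a leaf is labeled by a graph without edges
`(i, j), (j, k)`, `i < j < k`; any other node has three children, obtained by a reduction at a
pair of such edges. -/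
inductive SReductionTree {n : ℕ} : EdgeMultiset n → Type
  | leaf (m : EdgeMultiset n)
      (h : ∀ i j k : Vertex n, i < j → j < k → ¬ ((i, j) ∈ m ∧ (j, k) ∈ m)) : SReductionTree m
  | reduce (m : EdgeMultiset n) (i j k : Vertex n) (hij : i < j) (hjk : j < k)
      (h₁ : (i, j) ∈ m) (h₂ : (j, k) ∈ m)
      (t₁ : SReductionTree ((i, k) ::ₘ m.erase (j, k)))
      (t₂ : SReductionTree ((i, k) ::ₘ m.erase (i, j)))
      (t₃ : SReductionTree ((i, k) ::ₘ (m.erase (i, j)).erase (j, k))) : SReductionTree m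

/-- The labels of the leaves of an `𝓢`-reduction tree, one entry for each leaf. -/
def SReductionTree.leaves {n : ℕ} :
    {m : EdgeMultiset n} → SReductionTree m → List (EdgeMultiset n)
  | _, .leaf m _ => [m]
  | _, .reduce _ _ _ _ _ _ _ _ t₁ t₂ t₃ => t₁.leaves ++ t₂.leaves ++ t₃.leaves

/-! ### Pseudo-components

A tree on a subset of `[n+1]` with at least one edge is represented by the simple graph on `[n+1]`
with the same edges; its vertex set is then the support of that graph. -/

/-- The graph `H`, restricted to its non-isolated vertices, is a tree. -/
def IsTreeOnSupport {n : ℕ} (H : SimpleGraph (Vertex n)) : Prop :=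
  (H.induce H.support).IsTree

/-- The graph `P` consists of the edges of a simple path with endpoints `i` and `j`. -/
def IsPathOn {n : ℕ} (P : SimpleGraph (Vertex n)) (i j : Vertex n) : Prop :=
  ∃ p : P.Walk i j, p.IsPath ∧ p.toSubgraph.spanningCoe = P

/-- `P` is the simple path in `T` from the minimal vertex `i` of `T` to its maximal vertex `j`. -/
def IsMainPath {n : ℕ} (T P : SimpleGraph (Vertex n)) (i j : Vertex n) : Prop :=
  IsLeast T.support i ∧ IsGreatest T.support j ∧ P ≤ T ∧ IsPathOn P i j

/-- `T \ P` is the edge-disjoint union of the trees in `D`, and each vertex of `P` that lies in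
some tree of `D` is the minimal or the maximal vertex of that tree. -/
structure IsDecomposition {n : ℕ} (T P : SimpleGraph (Vertex n))
    (D : Finset (SimpleGraph (Vertex n))) : Prop where
  isTree : ∀ H ∈ D, IsTreeOnSupport H
  edgeDisjoint : ∀ H ∈ D, ∀ H' ∈ D, H ≠ H' → Disjoint H.edgeSet H'.edgeSet
  union : sSup (D : Set (SimpleGraph (Vertex n))) = T \ P
  extremal : ∀ H ∈ D, ∀ v ∈ P.support, v ∈ H.support →
    IsLeast H.support v ∨ IsGreatest H.support v

/-- A decomposition with the least possible number of trees. -/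
def IsMinDecomposition {n : ℕ} (T P : SimpleGraph (Vertex n))
    (D : Finset (SimpleGraph (Vertex n))) : Prop :=
  IsDecomposition T P D ∧ ∀ D', IsDecomposition T P D' → D.card ≤ D'.card

/-- `IsPseudoComponent T Q i j`: the path `Q` on `[i, j]` belongs to `ps(T)`, where
`ps(T) = {P} ∪ ps(T₁) ∪ ⋯ ∪ ps(Tₖ)`, `P` is the path from the minimal to the maximal vertex of
`T`, and `T₁, …, Tₖ` are the trees of the minimal decomposition of `T \ P`. -/
inductive IsPseudoComponent {n : ℕ} :
    SimpleGraph (Vertex n) → SimpleGraph (Vertex n) → Vertex n → Vertex n → Prop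
  | main (T P : SimpleGraph (Vertex n)) (i j : Vertex n) (h : IsMainPath T P i j) :
      IsPseudoComponent T P i j
  | sub (T P : SimpleGraph (Vertex n)) (a b : Vertex n) (hP : IsMainPath T P a b)
      (D : Finset (SimpleGraph (Vertex n))) (hD : IsMinDecomposition T P D)
      (H : SimpleGraph (Vertex n)) (hH : H ∈ D)
      (Q : SimpleGraph (Vertex n)) (i j : Vertex n) (hQ : IsPseudoComponent H Q i j) :
      IsPseudoComponent T Q i j

/-- A left pseudo-component of `T`: there are no edges `(s, i)` of `T` with `s < i`. -/
def IsLeftPseudoComponent {n : ℕ} (T Q : SimpleGraph (Vertex n)) (i j : Vertex n) : Prop :=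
  IsPseudoComponent T Q i j ∧ ∀ s, s < i → ¬ T.Adj s i

/-- A right pseudo-component of `T`: there are no edges `(j, s)` of `T` with `j < s`. -/
def IsRightPseudoComponent {n : ℕ} (T Q : SimpleGraph (Vertex n)) (i j : Vertex n) : Prop :=
  IsPseudoComponent T Q i j ∧ ∀ s, j < s → ¬ T.Adj j s

/-! ### The forests that label the leaves -/

/-- `F` is a noncrossing alternating spanning forest of the transitive closure of `T` which
contains the edge `(1, n+1)`, at least one edge `(i₁, j)` with `i₁ ≤ i` for each right
pseudo-component of `T` on `[i, j]`, and at least one edge `(i, j₁)` with `j ≤ j₁` for each left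
pseudo-component of `T` on `[i, j]`. -/
structure IsLeafForest {n : ℕ} (T F : SimpleGraph (Vertex n)) : Prop where
  noncrossing : Noncrossing F
  alternating : Alternating F
  acyclic : F.IsAcyclic
  le_transClosure : F ≤ transClosure T
  long_edge : F.Adj 0 (Fin.last n)
  right_edge : ∀ (Q : SimpleGraph (Vertex n)) (i j : Vertex n),
    IsRightPseudoComponent T Q i j → ∃ i₁, i₁ ≤ i ∧ F.Adj i₁ j
  left_edge : ∀ (Q : SimpleGraph (Vertex n)) (i j : Vertex n),
    IsLeftPseudoComponent T Q i j → ∃ j₁, j ≤ j₁ ∧ F.Adj i j₁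

/-- The order on edges: `(i₁, j₁)` is less than `(i₂, j₂)` if `j₁ > j₂`, or `j₁ = j₂` and
`i₁ > i₂`. -/
def LexLess {n : ℕ} (e₁ e₂ : Vertex n × Vertex n) : Prop :=
  e₁.2 > e₂.2 ∨ (e₁.2 = e₂.2 ∧ e₁.1 > e₂.1)

/-- Lexicographic edge-labels: a lesser edge has a lesser label. -/
def HasLexLabels {n : ℕ} (w : EdgeWord n) : Prop :=
  ∀ (a b : ℕ) (e₁ e₂ : Vertex n × Vertex n),
    w[a]? = some e₁ → w[b]? = some e₂ → LexLess e₁ e₂ → a < b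

/-- The forests of `IsLeafForest T`, with lexicographic edge-labels. -/
def lexLeafForests {n : ℕ} (T : SimpleGraph (Vertex n)) : Set (EdgeWord n) :=
  {w | IsLabeledGraph w ∧ HasLexLabels w ∧ IsLeafForest T (toGraph w)}

end RootPoly

/-! Assign to an edge (i, j) the vector e_i - e_j, and to a graph its open cone: all combinations of
its edge vectors with positive integer coefficients. For a forest the edge vectors are independent,
so each vector of the open cone has unique coefficients. The identity x(e_i - e_j) + y(e_j - e_k) =
min(x, y)(e_i - e_k) + (remainder on one short edge) shows that reduction (1) cuts the open cone
into three disjoint pieces, according to whether x > y, x < y or x = y, and that these are the open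
cones of the three children (`openCone_reduce`). Hence the open cones of the leaves of any reduction
tree partition that of the root.

In the noncommutative case goodness survives every reduction, and an irreducible good forest is
alternating (`GoodWord.exists_reducible`), so all leaves are noncrossing alternating forests. Such a
graph is determined by a single vector of its open cone (`NoncrossingAlternating.eq`). The labels
carry no further information: two good labelings of one forest differ by reductions (2)
(`commEquiv_of_perm`).

It remains to see which noncrossing alternating forests F in the transitive closure have open cone
inside that of T. Writing each edge of F as an increasing path in T shows that this holds exactly
when these paths cover all edges of T, and that one common vector already forces it.
`isLeafForest_iff_covers` identifies this covering condition with the conditions on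
pseudo-components. Thus a vector in the open cone of some F in F(T) lies in the open cone of exactly
one leaf, which is F up to commutation.

In the commutative case leaves may cross, so they are compared with F(T) by counting only. For an
alternating forest with k edges, the number of vectors of height m in the open cone depends only on
k and m, vanishes for m < k, and is 1 for m = k. Both families partition the same open cone, and
inverting this unitriangular system gives equal numbers of forests with k edges (`countP_card_eq`).
-/

namespace RootPoly

variable {n : ℕ}

/-! ### Flows and open cones -/


/-- The divergence of an integral weighting of the edges: the weighting `c` stands for the vector
`∑ c_{ij} (e_i - e_j)`. -/
def flow : (Vertex n × Vertex n → ℤ) →ₗ[ℤ] (Vertex n → ℤ) where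
  toFun c x := ∑ y, c (x, y) - ∑ y, c (y, x)
  map_add' c d := by
    funext x
    simp only [Pi.add_apply, Finset.sum_add_distrib]
    ring
  map_smul' a c := by
    funext x
    simp only [Pi.smul_apply, smul_eq_mul, ← Finset.mul_sum, RingHom.id_apply]
    ring

theorem flow_apply (c : Vertex n × Vertex n → ℤ) (x : Vertex n) :
    flow c x = ∑ y, c (x, y) - ∑ y, c (y, x) := rfl

theorem flow_single (i j : Vertex n) :
    flow (Pi.single (i, j) (1 : ℤ)) = Pi.single i 1 - Pi.single j 1 := by
  funext x
  simp only [flow_apply, Pi.single_apply, Prod.mk.injEq, Pi.sub_apply]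
  congr 1
  · by_cases h : x = i <;> simp [h]
  · by_cases h : x = j <;> simp [h]

/-- The edge vectors of the graph with edge set `E` are linearly independent. -/
def EdgeIndependent (E : Finset (Vertex n × Vertex n)) : Prop :=
  ∀ c : Vertex n × Vertex n → ℤ, (∀ e ∉ E, c e = 0) → flow c = 0 → c = 0

/-- `c` is a weighting of the edge set `E` by positive integers. -/
def PositiveOn (E : Finset (Vertex n × Vertex n)) (c : Vertex n × Vertex n → ℤ) : Prop :=
  (∀ e ∈ E, 0 < c e) ∧ ∀ e ∉ E, c e = 0

/-- The vectors that are positive integral combinations of all edge vectors of `E`. -/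
def openCone (E : Finset (Vertex n × Vertex n)) : Set (Vertex n → ℤ) :=
  {v | ∃ c, PositiveOn E c ∧ flow c = v}

theorem EdgeIndependent.eq {E : Finset (Vertex n × Vertex n)} (hE : EdgeIndependent E)
    {c d : Vertex n × Vertex n → ℤ} (hc : ∀ e ∉ E, c e = 0) (hd : ∀ e ∉ E, d e = 0)
    (h : flow c = flow d) : c = d := by
  have := hE (c - d) (fun e he => by simp [hc e he, hd e he]) (by simp [h])
  exact sub_eq_zero.mp this

theorem EdgeIndependent.mono {E E' : Finset (Vertex n × Vertex n)} (hE : EdgeIndependent E)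
    (h : E' ⊆ E) : EdgeIndependent E' :=
  fun c hc => hE c fun e he => hc e fun h' => he (h h')

/-- The relation between the edge vectors of a triangle. -/
def triangle (i j k : Vertex n) : Vertex n × Vertex n → ℤ :=
  Pi.single (i, j) 1 + Pi.single (j, k) 1 - Pi.single (i, k) 1

theorem flow_triangle (i j k : Vertex n) : flow (triangle i j k) = 0 := by
  simp only [triangle, map_sub, map_add, flow_single]
  abel

theorem flow_add_smul_triangle (c : Vertex n × Vertex n → ℤ) (t : ℤ) (i j k : Vertex n) :
    flow (c + t • triangle i j k) = flow c := by
  rw [map_add, map_smul, flow_triangle, smul_zero, add_zero]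

/-! ### Cutting an open cone along a triangle relation -/

section Triangle

variable {i j k : Vertex n} (hij : i < j) (hjk : j < k)
include hij hjk

theorem triangle_left : triangle i j k (i, j) = 1 := by
  simp [triangle, hjk.ne, hij.ne]

theorem triangle_right : triangle i j k (j, k) = 1 := by
  simp [triangle, hjk.ne', hij.ne']

theorem triangle_long : triangle i j k (i, k) = -1 := by
  simp [triangle, hjk.ne', hij.ne]

omit hij hjk in
theorem triangle_other {e : Vertex n × Vertex n} (h₁ : e ≠ (i, j)) (h₂ : e ≠ (j, k))
    (h₃ : e ≠ (i, k)) : triangle i j k e = 0 := by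
  simp [triangle, h₁, h₂, h₃]

variable {R : Finset (Vertex n × Vertex n)}

theorem EdgeIndependent.long_notMem {E : Finset (Vertex n × Vertex n)} (hE : EdgeIndependent E)
    (h₁ : (i, j) ∈ E) (h₂ : (j, k) ∈ E) : (i, k) ∉ E := by
  intro h₃
  have := hE (triangle i j k) (fun e he => triangle_other (fun h => he (h ▸ h₁))
    (fun h => he (h ▸ h₂)) (fun h => he (h ▸ h₃))) (flow_triangle i j k)
  have h := congrFun this (i, j)
  rw [triangle_left hij hjk] at h
  simp at h

/-- Adding the multiple `c (i, k)` of the triangle relation trades the long edge for the two short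
ones without changing the flow. This carries weightings of the reduced graphs back to the original
edge set. -/
theorem supported_add_triangle {E : Finset (Vertex n × Vertex n)}
    {c : Vertex n × Vertex n → ℤ} (hE : E ⊆ insert (i, k) (insert (i, j) (insert (j, k) R)))
    (hc : ∀ e ∉ E, c e = 0) :
    ∀ e ∉ insert (i, j) (insert (j, k) R), (c + c (i, k) • triangle i j k) e = 0 := by
  intro e he
  simp only [Finset.mem_insert, not_or] at he
  by_cases h : e = (i, k)
  · subst h
    simp [triangle_long hij hjk]
  · have : c e = 0 := hc e fun h' => by
      have := hE h'
      simp only [Finset.mem_insert] at this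
      tauto
    simp [this, triangle_other he.1 he.2.1 h]

/-- A relation on the new edges is carried back to the old ones, where it vanishes. Since `c` is
zero at `(j, k)`, the transported value there is `c (i, k)`, so nothing was moved and `c` itself is
zero. -/
theorem EdgeIndependent.reduce_left (h₂ : (j, k) ∉ R)
    (hE : EdgeIndependent (insert (i, j) (insert (j, k) R))) :
    EdgeIndependent (insert (i, k) (insert (i, j) R)) := by
  intro c hc h0
  have hcjk : c (j, k) = 0 := hc _ (by simp [h₂, hij.ne', hjk.ne'])
  have key := hE _ (supported_add_triangle hij hjk
    (Finset.insert_subset_insert _ (Finset.insert_subset_insert _ (Finset.subset_insert _ _))) hc)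
    (by rw [flow_add_smul_triangle, h0])
  have h := congrFun key (j, k)
  simp only [Pi.add_apply, Pi.smul_apply, triangle_right hij hjk, hcjk, Pi.zero_apply,
    smul_eq_mul, mul_one, zero_add] at h
  simpa [h] using key

theorem EdgeIndependent.reduce_right (h₁ : (i, j) ∉ R)
    (hE : EdgeIndependent (insert (i, j) (insert (j, k) R))) :
    EdgeIndependent (insert (j, k) (insert (i, k) R)) := by
  intro c hc h0
  have hcij : c (i, j) = 0 := hc _ (by simp [h₁, hij.ne, hjk.ne])
  have key := hE _ (supported_add_triangle hij hjk (by
    rw [Finset.insert_comm]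
    exact Finset.insert_subset_insert _ (Finset.subset_insert _ _)) hc)
    (by rw [flow_add_smul_triangle, h0])
  have h := congrFun key (i, j)
  simp only [Pi.add_apply, Pi.smul_apply, triangle_left hij hjk, hcij, Pi.zero_apply,
    smul_eq_mul, mul_one, zero_add] at h
  simpa [h] using key

theorem EdgeIndependent.reduce_both (h₂ : (j, k) ∉ R)
    (hE : EdgeIndependent (insert (i, j) (insert (j, k) R))) :
    EdgeIndependent (insert (i, k) R) :=
  (hE.reduce_left hij hjk h₂).mono
    (Finset.insert_subset_insert _ (Finset.subset_insert _ _))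

/-- A multiple of the triangle changes only three coefficients. Each hypothesis pairs membership
with the matching sign, so the same lemma serves whether an edge appears, disappears or stays. -/
theorem positiveOn_shift {c : Vertex n × Vertex n → ℤ} {t : ℤ}
    {E : Finset (Vertex n × Vertex n)}
    (h1 : (i, j) ∈ E ∧ 0 < c (i, j) + t ∨ (i, j) ∉ E ∧ c (i, j) + t = 0)
    (h2 : (j, k) ∈ E ∧ 0 < c (j, k) + t ∨ (j, k) ∉ E ∧ c (j, k) + t = 0)
    (h3 : (i, k) ∈ E ∧ 0 < c (i, k) - t ∨ (i, k) ∉ E ∧ c (i, k) - t = 0)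
    (h4 : ∀ e, e ≠ (i, j) → e ≠ (j, k) → e ≠ (i, k) → (e ∈ E ∧ 0 < c e ∨ e ∉ E ∧ c e = 0)) :
    PositiveOn E (c + t • triangle i j k) := by
  have key : ∀ e, e ∈ E ∧ 0 < (c + t • triangle i j k) e ∨
      e ∉ E ∧ (c + t • triangle i j k) e = 0 := by
    intro e
    simp only [Pi.add_apply, Pi.smul_apply, smul_eq_mul]
    by_cases e1 : e = (i, j)
    · subst e1
      simpa [triangle_left hij hjk] using h1
    by_cases e2 : e = (j, k)
    · subst e2
      simpa [triangle_right hij hjk] using h2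
    by_cases e3 : e = (i, k)
    · subst e3
      simpa [triangle_long hij hjk, sub_eq_add_neg] using h3
    · simpa [triangle_other e1 e2 e3] using h4 e e1 e2 e3
  refine ⟨fun e he => ?_, fun e he => ?_⟩
  · rcases key e with h | h
    · exact h.2
    · exact absurd he h.1
  · rcases key e with h | h
    · exact absurd h.1 he
    · exact h.2

omit hij hjk in
theorem PositiveOn.dichotomy {E : Finset (Vertex n × Vertex n)} {c : Vertex n × Vertex n → ℤ}
    (hc : PositiveOn E c) (e : Vertex n × Vertex n) : e ∈ E ∧ 0 < c e ∨ e ∉ E ∧ c e = 0 := by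
  by_cases he : e ∈ E
  · exact .inl ⟨he, hc.1 e he⟩
  · exact .inr ⟨he, hc.2 e he⟩

variable (h₁ : (i, j) ∉ R) (h₂ : (j, k) ∉ R) (h₃ : (i, k) ∉ R)
include h₁ h₂ h₃

omit h₁ in
-- With x > y one has x(e_i - e_j) + y(e_j - e_k) = y(e_i - e_k) + (x - y)(e_i - e_j): the smaller
-- coefficient moves to the long edge.
theorem mem_openCone_reduce_left {v : Vertex n → ℤ} :
    v ∈ openCone (insert (i, k) (insert (i, j) R)) ↔
      ∃ c, PositiveOn (insert (i, j) (insert (j, k) R)) c ∧ flow c = v ∧ c (j, k) < c (i, j) := by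
  have n1 := hij.ne
  have n2 := hjk.ne
  constructor
  · rintro ⟨c, hc, rfl⟩
    have a1 := hc.1 (i, j) (by simp)
    have a2 := hc.1 (i, k) (by simp)
    have a3 := hc.2 (j, k) (by simp [h₂, n1.symm, n2.symm])
    refine ⟨c + c (i, k) • triangle i j k, positiveOn_shift hij hjk ?_ ?_ ?_ ?_,
      flow_add_smul_triangle .., ?_⟩
    · exact .inl ⟨by simp, by omega⟩
    · exact .inl ⟨by simp, by omega⟩
    · exact .inr ⟨by simp [h₃, n1, n2.symm], by omega⟩
    · intro e e1 e2 e3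
      simpa [e1, e2, e3] using hc.dichotomy e
    · simp [triangle_left hij hjk, triangle_right hij hjk]
      omega
  · rintro ⟨c, hc, rfl, hlt⟩
    have a1 := hc.1 (i, j) (by simp)
    have a2 := hc.1 (j, k) (by simp)
    have a3 := hc.2 (i, k) (by simp [h₃, n1, n2.symm])
    refine ⟨c + (-c (j, k)) • triangle i j k, positiveOn_shift hij hjk ?_ ?_ ?_ ?_,
      flow_add_smul_triangle ..⟩
    · exact .inl ⟨by simp, by omega⟩
    · exact .inr ⟨by simp [h₂, n1.symm, n2.symm], by omega⟩
    · exact .inl ⟨by simp, by omega⟩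
    · intro e e1 e2 e3
      simpa [e1, e2, e3] using hc.dichotomy e

omit h₂ in
theorem mem_openCone_reduce_right {v : Vertex n → ℤ} :
    v ∈ openCone (insert (j, k) (insert (i, k) R)) ↔
      ∃ c, PositiveOn (insert (i, j) (insert (j, k) R)) c ∧ flow c = v ∧ c (i, j) < c (j, k) := by
  have n1 := hij.ne
  have n2 := hjk.ne
  constructor
  · rintro ⟨c, hc, rfl⟩
    have a1 := hc.1 (j, k) (by simp)
    have a2 := hc.1 (i, k) (by simp)
    have a3 := hc.2 (i, j) (by simp [h₁, n1, n2])
    refine ⟨c + c (i, k) • triangle i j k, positiveOn_shift hij hjk ?_ ?_ ?_ ?_,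
      flow_add_smul_triangle .., ?_⟩
    · exact .inl ⟨by simp, by omega⟩
    · exact .inl ⟨by simp, by omega⟩
    · exact .inr ⟨by simp [h₃, n1, n2.symm], by omega⟩
    · intro e e1 e2 e3
      simpa [e1, e2, e3] using hc.dichotomy e
    · simp [triangle_left hij hjk, triangle_right hij hjk]
      omega
  · rintro ⟨c, hc, rfl, hlt⟩
    have a1 := hc.1 (i, j) (by simp)
    have a2 := hc.1 (j, k) (by simp)
    have a3 := hc.2 (i, k) (by simp [h₃, n1, n2.symm])
    refine ⟨c + (-c (i, j)) • triangle i j k, positiveOn_shift hij hjk ?_ ?_ ?_ ?_,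
      flow_add_smul_triangle ..⟩
    · exact .inr ⟨by simp [h₁, n1, n2], by omega⟩
    · exact .inl ⟨by simp, by omega⟩
    · exact .inl ⟨by simp, by omega⟩
    · intro e e1 e2 e3
      simpa [e1, e2, e3] using hc.dichotomy e

theorem mem_openCone_reduce_both {v : Vertex n → ℤ} :
    v ∈ openCone (insert (i, k) R) ↔
      ∃ c, PositiveOn (insert (i, j) (insert (j, k) R)) c ∧ flow c = v ∧ c (i, j) = c (j, k) := by
  have n1 := hij.ne
  have n2 := hjk.ne
  constructor
  · rintro ⟨c, hc, rfl⟩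
    have a0 := hc.2 (j, k) (by simp [h₂, n1.symm])
    have a2 := hc.1 (i, k) (by simp)
    have a3 := hc.2 (i, j) (by simp [h₁, n2])
    refine ⟨c + c (i, k) • triangle i j k, positiveOn_shift hij hjk ?_ ?_ ?_ ?_,
      flow_add_smul_triangle .., ?_⟩
    · exact .inl ⟨by simp, by omega⟩
    · exact .inl ⟨by simp, by omega⟩
    · exact .inr ⟨by simp [h₃, n1, n2.symm], by omega⟩
    · intro e e1 e2 e3
      simpa [e1, e2, e3] using hc.dichotomy e
    · simp [triangle_left hij hjk, triangle_right hij hjk]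
      omega
  · rintro ⟨c, hc, rfl, hlt⟩
    have a1 := hc.1 (i, j) (by simp)
    have a2 := hc.1 (j, k) (by simp)
    have a3 := hc.2 (i, k) (by simp [h₃, n1, n2.symm])
    refine ⟨c + (-c (i, j)) • triangle i j k, positiveOn_shift hij hjk ?_ ?_ ?_ ?_,
      flow_add_smul_triangle ..⟩
    · exact .inr ⟨by simp [h₁, n2], by omega⟩
    · exact .inr ⟨by simp [h₂, n1.symm], by omega⟩
    · exact .inl ⟨by simp, by omega⟩
    · intro e e1 e2 e3
      simpa [e1, e2, e3] using hc.dichotomy e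

open Classical in
/-- A reduction splits the open cone into the open cones of the three resulting graphs. -/
theorem openCone_reduce (hE : EdgeIndependent (insert (i, j) (insert (j, k) R)))
    (v : Vertex n → ℤ) :
    (if v ∈ openCone (insert (i, k) (insert (i, j) R)) then 1 else 0) +
      (if v ∈ openCone (insert (j, k) (insert (i, k) R)) then 1 else 0) +
      (if v ∈ openCone (insert (i, k) R) then 1 else 0) =
    if v ∈ openCone (insert (i, j) (insert (j, k) R)) then 1 else 0 := by
  rw [mem_openCone_reduce_left hij hjk h₂ h₃, mem_openCone_reduce_right hij hjk h₁ h₃,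
    mem_openCone_reduce_both hij hjk h₁ h₂ h₃]
  by_cases hv : v ∈ openCone (insert (i, j) (insert (j, k) R))
  · obtain ⟨c, hc, rfl⟩ := hv
    -- By independence `c` is the only admissible weighting of its flow, so the three existential
    -- statements become the three cases of trichotomy for `c (i, j)` and `c (j, k)`.
    have uniq : ∀ (p : (Vertex n × Vertex n → ℤ) → Prop),
        (∃ d, PositiveOn (insert (i, j) (insert (j, k) R)) d ∧ flow d = flow c ∧ p d) ↔ p c := by
      intro p
      constructor
      · rintro ⟨d, hd, hf, hp⟩
        rwa [hE.eq hc.2 hd.2 hf.symm]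
      · exact fun hp => ⟨c, hc, rfl, hp⟩
    have hmem : flow c ∈ openCone (insert (i, j) (insert (j, k) R)) := ⟨c, hc, rfl⟩
    rw [uniq (fun d => d (j, k) < d (i, j)), uniq (fun d => d (i, j) < d (j, k)),
      uniq (fun d => d (i, j) = d (j, k)), if_pos hmem]
    rcases lt_trichotomy (c (i, j)) (c (j, k)) with h | h | h
    · simp [h, h.ne, h.le]
    · simp [h]
    · simp [h, h.ne', h.le]
  · rw [if_neg hv, if_neg, if_neg, if_neg]
    all_goals
      rintro ⟨c, hc, hf, -⟩
      exact hv ⟨c, hc, hf⟩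

end Triangle

/-! ### Good words -/

/-- In a good forest the edge `e` has a smaller label than the edge `f`. -/
def MustPrecede (e f : Vertex n × Vertex n) : Prop :=
  e.2 = f.1 ∨ (e.1 = f.1 ∧ f.2 < e.2) ∨ (e.2 = f.2 ∧ f.1 < e.1)

/-- The edges `e` and `f` have no common vertex. -/
def Apart (e f : Vertex n × Vertex n) : Prop :=
  e.1 ≠ f.1 ∧ e.1 ≠ f.2 ∧ e.2 ≠ f.1 ∧ e.2 ≠ f.2

/-- The conditions of a good forest in terms of words. -/
structure GoodWord (w : EdgeWord n) : Prop where
  lt : ∀ e ∈ w, e.1 < e.2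
  nodup : w.Nodup
  pairwise : w.Pairwise fun e f => ¬ MustPrecede f e
  noncrossing : ∀ i j k l : Vertex n, i < j → j < k → k < l → (i, k) ∈ w → (j, l) ∉ w
  independent : EdgeIndependent w.toFinset

/-- Distinct edges sharing a vertex always have a forced order; only disjoint edges are free to be
exchanged. -/
theorem apart_or_mustPrecede {e f : Vertex n × Vertex n} (hef : e ≠ f) :
    Apart e f ∨ MustPrecede e f ∨ MustPrecede f e := by
  obtain ⟨a, b⟩ := e
  obtain ⟨c, d⟩ := f
  simp only [Apart, MustPrecede, ne_eq, Prod.mk.injEq, Fin.ext_iff, Fin.lt_def] at *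
  omega

theorem Apart.nodup {e f : Vertex n × Vertex n} (h : Apart e f) (he : e.1 < e.2)
    (hf : f.1 < f.2) : [e.1, e.2, f.1, f.2].Nodup := by
  obtain ⟨h1, h2, h3, h4⟩ := h
  simp [he.ne, hf.ne, h1, h2, h3, h4]

theorem toFinset_middle (p s : EdgeWord n) (e f : Vertex n × Vertex n) :
    (p ++ e :: f :: s).toFinset = insert e (insert f (p ++ s).toFinset) := by
  ext x
  simp only [List.mem_toFinset, List.mem_append, List.mem_cons, Finset.mem_insert]
  tauto

theorem toFinset_middle_one (p s : EdgeWord n) (e : Vertex n × Vertex n) :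
    (p ++ e :: s).toFinset = insert e (p ++ s).toFinset := by
  ext x
  simp only [List.mem_toFinset, List.mem_append, List.mem_cons, Finset.mem_insert]
  tauto

/-! ### Commutations -/

theorem CommStep.symm {w w' : EdgeWord n} (h : CommStep w w') : CommStep w' w := by
  obtain ⟨p, s, i, j, k, l, hd, h₁, h₂⟩ := h
  refine ⟨p, s, k, l, i, j, ?_, h₂, h₁⟩
  have : [k, l, i, j].Perm [i, j, k, l] := List.perm_append_comm (l₁ := [k, l]) (l₂ := [i, j])
  exact this.nodup_iff.mpr hd

theorem CommStep.perm {w w' : EdgeWord n} (h : CommStep w w') : w.Perm w' := by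
  obtain ⟨p, s, i, j, k, l, -, rfl, rfl⟩ := h
  exact List.Perm.append_left p (List.Perm.swap ..)

theorem CommStep.cons {w w' : EdgeWord n} (x : Vertex n × Vertex n) (h : CommStep w w') :
    CommStep (x :: w) (x :: w') := by
  obtain ⟨p, s, i, j, k, l, hd, rfl, rfl⟩ := h
  exact ⟨x :: p, s, i, j, k, l, hd, rfl, rfl⟩

theorem CommEquiv.symm {w w' : EdgeWord n} (h : CommEquiv w w') : CommEquiv w' w := by
  induction h with
  | refl => exact .refl
  | tail _ h ih => exact .head h.symm ih

theorem CommEquiv.trans {w w' w'' : EdgeWord n} (h : CommEquiv w w') (h' : CommEquiv w' w'') :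
    CommEquiv w w'' :=
  Relation.ReflTransGen.trans h h'

theorem CommEquiv.perm {w w' : EdgeWord n} (h : CommEquiv w w') : w.Perm w' := by
  induction h with
  | refl => exact .refl _
  | tail _ h ih => exact ih.trans h.perm

theorem CommEquiv.cons {w w' : EdgeWord n} (x : Vertex n × Vertex n) (h : CommEquiv w w') :
    CommEquiv (x :: w) (x :: w') := by
  induction h with
  | refl => exact .refl
  | tail _ h ih => exact ih.tail (h.cons x)

theorem commStep_of_apart (p s : EdgeWord n) {e f : Vertex n × Vertex n} (h : Apart e f)
    (he : e.1 < e.2) (hf : f.1 < f.2) : CommStep (p ++ e :: f :: s) (p ++ f :: e :: s) :=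
  ⟨p, s, e.1, e.2, f.1, f.2, h.nodup he hf, rfl, rfl⟩

theorem commEquiv_move_left (p M s : EdgeWord n) {x : Vertex n × Vertex n} (hx : x.1 < x.2)
    (hlt : ∀ g ∈ M, g.1 < g.2) (h : ∀ g ∈ M, Apart g x) :
    CommEquiv (p ++ (M ++ x :: s)) (p ++ x :: (M ++ s)) := by
  induction M generalizing p with
  | nil => exact .refl
  | cons g M ih =>
    have h1 := ih (p ++ [g]) (fun a ha => hlt a (.tail _ ha)) (fun a ha => h a (.tail _ ha))
    have h2 := commStep_of_apart p (M ++ s) (h g (.head _)) (hlt g (.head _)) hx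
    simp only [List.append_assoc, List.singleton_append] at h1
    exact h1.tail h2

theorem GoodWord.commStep {w w' : EdgeWord n} (hw : GoodWord w) (h : CommStep w w') :
    GoodWord w' := by
  have hp := h.perm
  refine ⟨fun e he => hw.lt e (hp.mem_iff.mpr he), hp.nodup_iff.mp hw.nodup, ?_,
    fun i j k l hij hjk hkl h1 h2 => hw.noncrossing i j k l hij hjk hkl (hp.mem_iff.mpr h1)
      (hp.mem_iff.mpr h2), ?_⟩
  · obtain ⟨p, s, i, j, k, l, hd, rfl, rfl⟩ := h
    have := hw.pairwise
    simp only [List.pairwise_append, List.pairwise_cons, List.mem_cons] at this ⊢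
    obtain ⟨h1, ⟨h2, h3, h4⟩, h5⟩ := this
    refine ⟨h1, ⟨?_, fun a ha => h2 a (.inr ha), h4⟩, ?_⟩
    · rintro a (rfl | ha)
      · simp only [List.nodup_cons, List.mem_cons, not_or] at hd
        simp only [MustPrecede]
        tauto
      · exact h3 a ha
    · rintro a ha b (rfl | rfl | hb)
      · exact h5 a ha _ (.inr (.inl rfl))
      · exact h5 a ha _ (.inl rfl)
      · exact h5 a ha b (.inr (.inr hb))
  · rw [← List.toFinset_eq_of_perm _ _ hp]
    exact hw.independent

theorem GoodWord.commEquiv {w w' : EdgeWord n} (hw : GoodWord w) (h : CommEquiv w w') :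
    GoodWord w' := by
  induction h with
  | refl => exact hw
  | tail _ h ih => exact ih.commStep h

/-- The labels of a good forest are determined by the forest up to commutations. -/
theorem commEquiv_of_perm {w w' : EdgeWord n} (hlt : ∀ e ∈ w, e.1 < e.2) (hn : w.Nodup)
    (hw : w.Pairwise fun e f => ¬ MustPrecede f e)
    (hw' : w'.Pairwise fun e f => ¬ MustPrecede f e) (hp : w.Perm w') : CommEquiv w w' := by
  induction w generalizing w' with
  | nil =>
    rw [List.nil_perm.mp hp]
    exact .refl
  | cons x t ih =>
    obtain ⟨A, B, rfl⟩ := List.append_of_mem (hp.mem_iff.mp List.mem_cons_self)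
    have hp' : t.Perm (A ++ B) := (List.perm_cons x).mp (hp.trans List.perm_middle)
    rw [List.pairwise_cons] at hw
    rw [List.nodup_cons] at hn
    have hlt' : ∀ e ∈ A ++ x :: B, e.1 < e.2 := fun e he => hlt e (hp.mem_iff.mpr he)
    have hAB : (A ++ B).Pairwise fun e f => ¬ MustPrecede f e :=
      hw'.sublist (List.Sublist.append_left (List.sublist_cons_self ..) A)
    have h1 := ih (fun e he => hlt e (.tail _ he)) hn.2 hw.2 hAB hp'
    -- An edge of `A` comes after `x` in one word and before it in the other, so neither order is
    -- forced and the two edges are disjoint.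
    have h2 := commEquiv_move_left [] A B (x := x) (hlt x (.head _))
      (fun g hg => hlt' g (by simp [hg])) (fun g hg => by
        have hgt : g ∈ t := hp'.mem_iff.mpr (by simp [hg])
        rcases apart_or_mustPrecede (e := g) (f := x) (fun h => hn.1 (h ▸ hgt)) with h | h | h
        · exact h
        · exact absurd h (hw.1 g hgt)
        · exact absurd h ((List.pairwise_append.mp hw').2.2 g hg x (.head _)))
    exact (h1.cons x).trans h2.symm

/-! ### Reductions of good words -/

section Reduce

variable {p s : EdgeWord n} {i j k : Vertex n}

/-- The only danger is an earlier edge (i, y) with y < k. Its place before (i, j) forces j < y, and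
then it crosses (j, k). -/
theorem GoodWord.before_long (hij : i < j)
    (hw : GoodWord (p ++ (i, j) :: (j, k) :: s)) {e : Vertex n × Vertex n} (he : e ∈ p) :
    ¬ MustPrecede (i, k) e := by
  obtain ⟨x, y⟩ := e
  have hpw := (List.pairwise_append.mp hw.pairwise).2.2 _ he
  have h1 := hpw (i, j) (by simp)
  have h2 := hpw (j, k) (by simp)
  have hnd := (List.nodup_append.mp hw.nodup).2.2 _ he
  have h3 := hnd (i, j) (by simp)
  have hc := hw.noncrossing i j y k hij
  simp only [MustPrecede, not_or, not_and, ne_eq, Prod.mk.injEq, not_lt] at h1 h2 h3 ⊢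
  refine ⟨h2.1, fun hx => not_lt.mp fun hyk => ?_, fun hy => (h2.2.2 hy).trans' hij.le⟩
  subst hx
  have hjy : j < y := lt_of_le_of_ne (h1.2.1 rfl) fun h => h3 rfl h.symm
  exact hc hjy hyk (by simp [he]) (by simp)

/-- Mirror image of `GoodWord.before_long`: a later edge (x, k) with i < x has x < j and so crosses
(i, j). -/
theorem GoodWord.after_long (hjk : j < k)
    (hw : GoodWord (p ++ (i, j) :: (j, k) :: s)) {e : Vertex n × Vertex n} (he : e ∈ s) :
    ¬ MustPrecede e (i, k) := by
  obtain ⟨x, y⟩ := e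
  have hpw := hw.pairwise
  simp only [List.pairwise_append, List.pairwise_cons] at hpw
  have h1 := hpw.2.1.1 (x, y) (by simp [he])
  have h2 := hpw.2.1.2.1 (x, y) he
  have hnd := hw.nodup
  simp only [List.nodup_append, List.nodup_cons] at hnd
  have h3 : (x, y) ≠ (j, k) := fun h => hnd.2.1.2.1 (h ▸ he)
  have hc := hw.noncrossing i x j k
  simp only [MustPrecede, not_or, not_and, ne_eq, Prod.mk.injEq, not_lt] at h1 h2 h3 ⊢
  refine ⟨h1.1, fun hx => (h1.2.1 hx).trans hjk.le, fun hy => not_lt.mp fun hix => ?_⟩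
  subst hy
  have hxj : x < j := lt_of_le_of_ne (h2.2.2 rfl) fun h => h3 h rfl
  exact hc hix hxj hjk (by simp) (by simp [he])

/-- An edge crossing (i, k) either crosses one of the two short edges or has an end at j. In the
latter case the order conditions require its label to lie strictly between those of (i, j) and (j,
k), which are consecutive. -/
theorem GoodWord.noncrossing_long (hij : i < j) (hjk : j < k)
    (hw : GoodWord (p ++ (i, j) :: (j, k) :: s)) {x y : Vertex n}
    (he : (x, y) ∈ p ++ (i, j) :: (j, k) :: s) :
    ¬ (x < i ∧ i < y ∧ y < k) ∧ ¬ (i < x ∧ x < k ∧ k < y) := by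
  have m1 : (i, j) ∈ p ++ (i, j) :: (j, k) :: s := by simp
  have m2 : (j, k) ∈ p ++ (i, j) :: (j, k) :: s := by simp
  have hpw := hw.pairwise
  simp only [List.pairwise_append, List.pairwise_cons] at hpw
  obtain ⟨-, ⟨h1, h2, -⟩, h3⟩ := hpw
  have he' : (x, y) ∈ p ∨ (x, y) = (i, j) ∨ (x, y) = (j, k) ∨ (x, y) ∈ s := by simpa using he
  constructor
  · rintro ⟨hxi, hiy, hyk⟩
    rcases lt_trichotomy y j with hy | rfl | hy
    · exact hw.noncrossing x i y j hxi hiy hy he m1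
    · rcases he' with he' | he' | he' | he'
      · exact h3 _ he' (i, y) (by simp) (.inr (.inr ⟨rfl, hxi⟩))
      · simp only [Prod.mk.injEq] at he'
        exact hxi.ne he'.1
      · simp only [Prod.mk.injEq] at he'
        exact hyk.ne he'.2
      · exact h2 _ he' (.inl rfl)
    · exact hw.noncrossing x j y k (hxi.trans hij) hy hyk he m2
  · rintro ⟨hix, hxk, hky⟩
    rcases lt_trichotomy x j with hx | rfl | hx
    · exact hw.noncrossing i x j y hix hx (hjk.trans hky) m1 he
    · rcases he' with he' | he' | he' | he'
      · exact h3 _ he' (i, x) (by simp) (.inl rfl)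
      · simp only [Prod.mk.injEq] at he'
        exact hix.ne' he'.1
      · simp only [Prod.mk.injEq] at he'
        exact hky.ne' he'.2
      · exact h2 _ he' (.inr (.inl ⟨rfl, hky⟩))
    · exact hw.noncrossing j x k y hx hxk hky m2 he

theorem GoodWord.noncrossing_of_subset (hij : i < j) (hjk : j < k)
    (hw : GoodWord (p ++ (i, j) :: (j, k) :: s)) {w' : EdgeWord n}
    (h : ∀ e ∈ w', e = (i, k) ∨ e ∈ p ++ (i, j) :: (j, k) :: s) (a b c d : Vertex n)
    (hab : a < b) (hbc : b < c) (hcd : c < d) (h₁ : (a, c) ∈ w') : (b, d) ∉ w' := by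
  intro h₂
  rcases h _ h₁ with h₁ | h₁ <;> rcases h _ h₂ with h₂ | h₂
  · simp only [Prod.mk.injEq] at h₁ h₂
    exact hab.ne (h₁.1.trans h₂.1.symm)
  · simp only [Prod.mk.injEq] at h₁
    obtain ⟨rfl, rfl⟩ := h₁
    exact (hw.noncrossing_long hij hjk h₂).2 ⟨hab, hbc, hcd⟩
  · simp only [Prod.mk.injEq] at h₂
    obtain ⟨rfl, rfl⟩ := h₂
    exact (hw.noncrossing_long hij hjk h₁).1 ⟨hab, hbc, hcd⟩
  · exact hw.noncrossing a b c d hab hbc hcd h₁ h₂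

theorem GoodWord.notMem (hw : GoodWord (p ++ (i, j) :: (j, k) :: s)) (hij : i < j) (hjk : j < k) :
    (i, j) ∉ p ++ s ∧ (j, k) ∉ p ++ s ∧ (i, k) ∉ p ++ s := by
  have hn := hw.nodup
  have hl := hw.independent.long_notMem hij hjk (by simp) (by simp)
  simp only [List.nodup_append, List.nodup_cons, List.mem_cons] at hn
  simp only [List.mem_toFinset, List.mem_append, List.mem_cons, not_or] at hl
  simp only [List.mem_append, not_or]
  obtain ⟨-, ⟨h1, h2, -⟩, h3⟩ := hn
  exact ⟨⟨fun h => h3 _ h _ (.inl rfl) rfl, fun h => h1 (.inr h)⟩,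
    ⟨fun h => h3 _ h _ (.inr (.inl rfl)) rfl, h2⟩, hl.1, hl.2.2.2⟩

theorem GoodWord.independent_insert (hw : GoodWord (p ++ (i, j) :: (j, k) :: s)) :
    EdgeIndependent (insert (i, j) (insert (j, k) (p ++ s).toFinset)) := by
  rw [← toFinset_middle]
  exact hw.independent

theorem GoodWord.reduce_left (hij : i < j) (hjk : j < k)
    (hw : GoodWord (p ++ (i, j) :: (j, k) :: s)) : GoodWord (p ++ (i, k) :: (i, j) :: s) := by
  obtain ⟨n1, n2, n3⟩ := hw.notMem hij hjk
  have hpw := hw.pairwise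
  have hnd := hw.nodup
  have hlt := hw.lt
  simp only [List.mem_append, not_or] at n1 n2 n3
  refine ⟨?_, ?_, ?_, hw.noncrossing_of_subset hij hjk ?_, ?_⟩
  · intro e he
    simp only [List.mem_append, List.mem_cons] at he
    rcases he with he | rfl | rfl | he
    · exact hlt e (by simp [he])
    · exact hij.trans hjk
    · exact hij
    · exact hlt e (by simp [he])
  · simp only [List.nodup_append, List.nodup_cons, List.mem_cons, not_or] at hnd ⊢
    refine ⟨hnd.1, ⟨⟨by simp [hjk.ne'], n3.2⟩, n1.2, hnd.2.1.2.2⟩, ?_⟩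
    rintro a ha b (rfl | rfl | hb) rfl
    · exact n3.1 ha
    · exact n1.1 ha
    · exact hnd.2.2 a ha a (.inr (.inr hb)) rfl
  · simp only [List.pairwise_append, List.pairwise_cons, List.mem_cons] at hpw ⊢
    refine ⟨hpw.1, ⟨?_, fun e he => hpw.2.1.1 e (.inr he), hpw.2.1.2.2⟩, ?_⟩
    · rintro e (rfl | he)
      · simp [MustPrecede, hij.ne', hjk.ne, hjk.le]
      · exact hw.after_long hjk he
    · rintro e he f (rfl | rfl | hf)
      · exact hw.before_long hij he
      · exact hpw.2.2 e he _ (.inl rfl)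
      · exact hpw.2.2 e he _ (.inr (.inr hf))
  · intro e he
    simp only [List.mem_append, List.mem_cons] at he ⊢
    tauto
  · rw [toFinset_middle]
    exact hw.independent_insert.reduce_left hij hjk (by simp [n2])

theorem GoodWord.reduce_right (hij : i < j) (hjk : j < k)
    (hw : GoodWord (p ++ (i, j) :: (j, k) :: s)) : GoodWord (p ++ (j, k) :: (i, k) :: s) := by
  obtain ⟨n1, n2, n3⟩ := hw.notMem hij hjk
  have hpw := hw.pairwise
  have hnd := hw.nodup
  have hlt := hw.lt
  simp only [List.mem_append, not_or] at n1 n2 n3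
  refine ⟨?_, ?_, ?_, hw.noncrossing_of_subset hij hjk ?_, ?_⟩
  · intro e he
    simp only [List.mem_append, List.mem_cons] at he
    rcases he with he | rfl | rfl | he
    · exact hlt e (by simp [he])
    · exact hjk
    · exact hij.trans hjk
    · exact hlt e (by simp [he])
  · simp only [List.nodup_append, List.nodup_cons, List.mem_cons, not_or] at hnd ⊢
    refine ⟨hnd.1, ⟨⟨by simp [hij.ne'], n2.2⟩, n3.2, hnd.2.1.2.2⟩, ?_⟩
    rintro a ha b (rfl | rfl | hb) rfl
    · exact n2.1 ha
    · exact n3.1 ha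
    · exact hnd.2.2 a ha a (.inr (.inr hb)) rfl
  · simp only [List.pairwise_append, List.pairwise_cons, List.mem_cons] at hpw ⊢
    refine ⟨hpw.1, ⟨?_, fun e he => hw.after_long hjk he, hpw.2.1.2.2⟩, ?_⟩
    · rintro e (rfl | he)
      · simp [MustPrecede, hij.ne, hjk.ne', hij.le]
      · exact hpw.2.1.2.1 e he
    · rintro e he f (rfl | rfl | hf)
      · exact hpw.2.2 e he _ (.inr (.inl rfl))
      · exact hw.before_long hij he
      · exact hpw.2.2 e he _ (.inr (.inr hf))
  · intro e he
    simp only [List.mem_append, List.mem_cons] at he ⊢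
    tauto
  · rw [toFinset_middle]
    exact hw.independent_insert.reduce_right hij hjk (by simp [n1])

theorem GoodWord.sublist {w w' : EdgeWord n} (hw : GoodWord w) (h : w'.Sublist w) :
    GoodWord w' where
  lt e he := hw.lt e (h.subset he)
  nodup := hw.nodup.sublist h
  pairwise := hw.pairwise.sublist h
  noncrossing i j k l hij hjk hkl h1 h2 :=
    hw.noncrossing i j k l hij hjk hkl (h.subset h1) (h.subset h2)
  independent := hw.independent.mono fun e he => by
    simp only [List.mem_toFinset] at he ⊢
    exact h.subset he

theorem GoodWord.reduce_both (hij : i < j) (hjk : j < k)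
    (hw : GoodWord (p ++ (i, j) :: (j, k) :: s)) : GoodWord (p ++ (i, k) :: s) :=
  (hw.reduce_left hij hjk).sublist
    (List.Sublist.append_left (List.Sublist.cons_cons _ (List.sublist_cons_self ..)) p)

end Reduce

/-! ### Irreducible good words are alternating -/

theorem exists_first_not {α : Type*} (P : α → Prop) (M : List α) (h : ∃ g ∈ M, ¬ P g) :
    ∃ M₁ g M₂, M = M₁ ++ g :: M₂ ∧ (∀ a ∈ M₁, P a) ∧ ¬ P g := by
  induction M with
  | nil => simp at h
  | cons a M ih =>
    by_cases ha : P a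
    · obtain ⟨g, hg, hP⟩ := h
      rcases List.mem_cons.mp hg with rfl | hg
      · exact absurd ha hP
      obtain ⟨M₁, g, M₂, rfl, h1, h2⟩ := ih ⟨g, hg, hP⟩
      exact ⟨a :: M₁, g, M₂, rfl, by simpa [ha] using h1, h2⟩
    · exact ⟨[], a, M, rfl, by simp, ha⟩

/-- An edge outside `[i, j)` that may follow `(i, j)` and edges inside `[i, j)` in a good word is
apart from them. -/
theorem apart_of_not_inside {i j : Vertex n} {a g : Vertex n × Vertex n}
    (ha : i ≤ a.1 ∧ a.2 < j) (hlt : a.1 < a.2) (hg : g.1 < g.2) (h₁ : g.1 ≠ i) (h₂ : g.2 ≠ i)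
    (hout : ¬ (i ≤ g.1 ∧ g.2 < j)) (hj : g.2 ≠ j)
    (hc : ¬ (i < g.1 ∧ g.1 < j ∧ j < g.2)) (hc' : ¬ (g.1 < i ∧ i < g.2 ∧ g.2 < j)) :
    Apart a g := by
  simp only [Apart, Fin.lt_def, Fin.le_def, ne_eq, Fin.ext_iff] at *
  omega

/-- Induction on the number of edges between (i, j) and (j, k). An intermediate edge starting or
ending at j replaces one of the two and shortens the gap. Otherwise intermediate edges inside [i, j)
are disjoint from (j, k); if all are of this kind, (j, k) moves left up to (i, j). If not, the first
edge that is not inside is disjoint from everything between it and (i, j), and from (i, j) itself,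
so it moves out to the left. -/
theorem GoodWord.exists_reducible (m : ℕ) (p M s : EdgeWord n) (i j k : Vertex n)
    (hm : M.length = m) (hw : GoodWord (p ++ (i, j) :: (M ++ (j, k) :: s))) :
    ∃ w', CommEquiv (p ++ (i, j) :: (M ++ (j, k) :: s)) w' ∧ BReducible w' := by
  induction m using Nat.strong_induction_on generalizing p M s i j k with
  | _ m ih =>
  have hij : i < j := hw.lt (i, j) (by simp)
  have hjk : j < k := hw.lt (j, k) (by simp)
  by_cases c1 : ∃ g ∈ M, g.1 = j
  · obtain ⟨⟨x, y⟩, hg, rfl⟩ := c1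
    obtain ⟨M₁, M₂, rfl⟩ := List.append_of_mem hg
    have := ih M₁.length (by simp at hm; omega) p M₁ (M₂ ++ (x, k) :: s) i x y rfl
      (by simpa using hw)
    simpa using this
  by_cases c2 : ∃ g ∈ M, g.2 = j
  · obtain ⟨⟨x, y⟩, hg, rfl⟩ := c2
    obtain ⟨M₁, M₂, rfl⟩ := List.append_of_mem hg
    have := ih M₂.length (by simp at hm; omega) (p ++ (i, y) :: M₁) M₂ s x y k rfl
      (by simpa using hw)
    simpa using this
  push Not at c1 c2
  have hltM : ∀ g ∈ M, g.1 < g.2 := fun g hg => hw.lt g (by simp [hg])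
  by_cases c3 : ∀ g ∈ M, i ≤ g.1 ∧ g.2 < j
  · have h := commEquiv_move_left (p ++ [(i, j)]) M s (x := (j, k)) hjk hltM (fun g hg => by
      have h1 := c3 g hg
      have h2 := hltM g hg
      simp only [Apart, Fin.lt_def, Fin.le_def, ne_eq, Fin.ext_iff] at *
      omega)
    simp only [List.append_assoc, List.singleton_append] at h
    exact ⟨_, h, p, M ++ s, i, j, k, hij, hjk, rfl⟩
  · push Not at c3
    obtain ⟨M₁, g, M₂, rfl, hin, hout⟩ := exists_first_not (fun g => i ≤ g.1 ∧ g.2 < j) M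
      (by simpa using c3)
    have hg : g.1 < g.2 := hltM g (by simp)
    have hgj1 : g.1 ≠ j := c1 g (by simp)
    have hgj2 : g.2 ≠ j := c2 g (by simp)
    have hgm : g ∈ p ++ (i, j) :: ((M₁ ++ g :: M₂) ++ (j, k) :: s) := by simp
    have hpw := hw.pairwise
    simp only [List.pairwise_append, List.pairwise_cons] at hpw
    have hnm := hpw.2.1.1 g (by simp)
    have hc : ¬ (i < g.1 ∧ g.1 < j ∧ j < g.2) := fun h =>
      hw.noncrossing i g.1 j g.2 h.1 h.2.1 h.2.2 (by simp) hgm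
    have hc' : ¬ (g.1 < i ∧ i < g.2 ∧ g.2 < j) := fun h =>
      hw.noncrossing g.1 i g.2 j h.1 h.2.1 h.2.2 hgm (by simp)
    simp only [MustPrecede, not_or, not_and, not_lt] at hnm
    have hg2 : g.2 ≠ i := hnm.1
    have hg1 : g.1 ≠ i := fun h =>
      hout ⟨h.ge, lt_of_le_of_ne (hnm.2.1 h) hgj2⟩
    have h := commEquiv_move_left p ((i, j) :: M₁) (M₂ ++ (j, k) :: s) hg
      (List.forall_mem_cons.mpr ⟨hij, fun a ha => hltM a (by simp [ha])⟩) (fun a ha => by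
        rcases List.mem_cons.mp ha with rfl | ha
        · exact ⟨hg1.symm, hg2.symm, hgj1.symm, hgj2.symm⟩
        · exact apart_of_not_inside (hin a ha) (hltM a (by simp [ha])) hg hg1 hg2 hout hgj2
            hc hc')
    have h' : CommEquiv (p ++ (i, j) :: ((M₁ ++ g :: M₂) ++ (j, k) :: s))
        ((p ++ [g]) ++ (i, j) :: ((M₁ ++ M₂) ++ (j, k) :: s)) := by simpa using h
    obtain ⟨w', hw', hr⟩ := ih (M₁ ++ M₂).length (by simp at hm ⊢; omega) (p ++ [g]) (M₁ ++ M₂) s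
      i j k rfl (hw.commEquiv h')
    exact ⟨w', h'.trans hw', hr⟩

theorem GoodWord.alternating_of_irreducible {w : EdgeWord n} (hw : GoodWord w)
    (h : ∀ w', CommEquiv w w' → ¬ BReducible w') (i j k : Vertex n) (h₁ : (i, j) ∈ w) :
    (j, k) ∉ w := by
  intro h₂
  have hij := hw.lt _ h₁
  obtain ⟨p, t, rfl⟩ := List.append_of_mem h₁
  have h₃ : (j, k) ∈ t := by
    simp only [List.mem_append, List.mem_cons, Prod.mk.injEq] at h₂
    rcases h₂ with h₂ | ⟨rfl, -⟩ | h₂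
    · exact absurd (.inl rfl)
        ((List.pairwise_append.mp hw.pairwise).2.2 _ h₂ (i, j) (by simp))
    · exact absurd hij (lt_irrefl _)
    · exact h₂
  obtain ⟨M, s, rfl⟩ := List.append_of_mem h₃
  obtain ⟨w', h1, h2⟩ := hw.exists_reducible _ p M s i j k rfl
  exact h w' h1 h2

/-! ### Noncrossing alternating graphs are determined by a vector of their open cone -/

/-- The edge set of a noncrossing alternating graph, with edges written `(i, j)`, `i < j`. -/
structure NoncrossingAlternating (E : Finset (Vertex n × Vertex n)) : Prop where
  lt : ∀ e ∈ E, e.1 < e.2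
  noncrossing : ∀ i j k l : Vertex n, i < j → j < k → k < l → (i, k) ∈ E → (j, l) ∉ E
  alternating : ∀ i j k : Vertex n, (i, j) ∈ E → (j, k) ∉ E

theorem PositiveOn.nonneg {E : Finset (Vertex n × Vertex n)} {c : Vertex n × Vertex n → ℤ}
    (hc : PositiveOn E c) (e : Vertex n × Vertex n) : 0 ≤ c e := by
  rcases hc.dichotomy e with h | h
  · exact h.2.le
  · exact h.2.ge

theorem PositiveOn.mem_iff {E : Finset (Vertex n × Vertex n)} {c : Vertex n × Vertex n → ℤ}
    (hc : PositiveOn E c) (e : Vertex n × Vertex n) : e ∈ E ↔ 0 < c e := by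
  rcases hc.dichotomy e with h | h
  · simp [h]
  · simp [h]

/-- In an alternating graph no vertex has both incoming and outgoing edges, so the outflow at a
source is read off from the vector alone. -/
theorem sum_out_eq {E E' : Finset (Vertex n × Vertex n)}
    (ha : ∀ i j k : Vertex n, (i, j) ∈ E → (j, k) ∉ E)
    (ha' : ∀ i j k : Vertex n, (i, j) ∈ E' → (j, k) ∉ E')
    {c c' : Vertex n × Vertex n → ℤ} (hc : PositiveOn E c) (hc' : PositiveOn E' c')
    (hf : flow c = flow c') {i j : Vertex n} (h : (i, j) ∈ E) :
    ∑ y, c (i, y) = ∑ y, c' (i, y) := by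
  have h1 := congrFun hf i
  rw [flow_apply, flow_apply] at h1
  have h2 : ∑ y, c (y, i) = 0 := Finset.sum_eq_zero fun y _ => hc.2 _ fun hy => ha y i j hy h
  have h3 : 0 < ∑ y, c (i, y) :=
    Finset.sum_pos' (fun y _ => hc.nonneg _) ⟨j, Finset.mem_univ _, hc.1 _ h⟩
  have h4 : ∑ y, c' (y, i) = 0 := by
    by_contra hne
    obtain ⟨y, -, hy⟩ := Finset.exists_ne_zero_of_sum_ne_zero hne
    have hy' : (y, i) ∈ E' := by
      by_contra h
      exact hy (hc'.2 _ h)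
    have h5 : ∑ y, c' (i, y) = 0 :=
      Finset.sum_eq_zero fun z _ => hc'.2 _ fun hz => ha' y i z hy' hz
    have h6 : 0 ≤ ∑ y, c' (y, i) := Finset.sum_nonneg fun y _ => hc'.nonneg _
    omega
  omega

theorem sum_in_eq {E E' : Finset (Vertex n × Vertex n)}
    (ha : ∀ i j k : Vertex n, (i, j) ∈ E → (j, k) ∉ E)
    (ha' : ∀ i j k : Vertex n, (i, j) ∈ E' → (j, k) ∉ E')
    {c c' : Vertex n × Vertex n → ℤ} (hc : PositiveOn E c) (hc' : PositiveOn E' c')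
    (hf : flow c = flow c') {i j : Vertex n} (h : (i, j) ∈ E) :
    ∑ y, c (y, j) = ∑ y, c' (y, j) := by
  have h1 := congrFun hf j
  rw [flow_apply, flow_apply] at h1
  have h2 : ∑ y, c (j, y) = 0 := Finset.sum_eq_zero fun y _ => hc.2 _ fun hy => ha i j y h hy
  have h3 : 0 < ∑ y, c (y, j) :=
    Finset.sum_pos' (fun y _ => hc.nonneg _) ⟨i, Finset.mem_univ _, hc.1 _ h⟩
  have h4 : ∑ y, c' (j, y) = 0 := by
    by_contra hne
    obtain ⟨y, -, hy⟩ := Finset.exists_ne_zero_of_sum_ne_zero hne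
    have hy' : (j, y) ∈ E' := by
      by_contra h
      exact hy (hc'.2 _ h)
    have h5 : ∑ y, c' (y, j) = 0 :=
      Finset.sum_eq_zero fun z _ => hc'.2 _ fun hz => ha' z j y hz hy'
    have h6 : 0 ≤ ∑ y, c' (j, y) := Finset.sum_nonneg fun y _ => hc'.nonneg _
    omega
  omega

theorem exists_lt_of_sum_eq {c c' : Vertex n → ℤ} (h : ∑ y, c y = ∑ y, c' y) {j : Vertex n}
    (hj : c' j < c j) : ∃ k, c k < c' k := by
  by_contra! hle
  exact (Finset.sum_lt_sum (fun y _ => hle y) ⟨j, Finset.mem_univ _, hj⟩).ne h.symm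

/-- If `c` exceeds `c'` at (i, j), equal outflow at i and equal inflow at j give edges (i, k) and
(l, j) of `E'` on which `c'` exceeds `c`. Agreement on shorter edges forces l < i and j < k, and
these two edges cross. -/
theorem NoncrossingAlternating.le_of_shorter {E E' : Finset (Vertex n × Vertex n)}
    (hE : NoncrossingAlternating E) (hE' : NoncrossingAlternating E')
    {c c' : Vertex n × Vertex n → ℤ} (hc : PositiveOn E c) (hc' : PositiveOn E' c')
    (hf : flow c = flow c') (i j : Vertex n)
    (hshort : ∀ x y, i ≤ x → y ≤ j → (x, y) ≠ (i, j) → c (x, y) = c' (x, y)) :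
    c (i, j) ≤ c' (i, j) := by
  by_contra! hlt
  have hmem : (i, j) ∈ E := (hc.mem_iff _).mpr ((hc'.nonneg _).trans_lt hlt)
  obtain ⟨k, hk⟩ := exists_lt_of_sum_eq
    (sum_out_eq hE.alternating hE'.alternating hc hc' hf hmem) hlt
  obtain ⟨l, hl⟩ := exists_lt_of_sum_eq
    (sum_in_eq hE.alternating hE'.alternating hc hc' hf hmem) hlt
  have hk' : (i, k) ∈ E' := (hc'.mem_iff _).mpr ((hc.nonneg _).trans_lt hk)
  have hl' : (l, j) ∈ E' := (hc'.mem_iff _).mpr ((hc.nonneg _).trans_lt hl)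
  have hjk : j < k := by
    by_contra! h
    refine hk.ne (hshort i k le_rfl h fun h' => ?_)
    rw [h'] at hk
    exact hk.not_gt hlt
  have hli : l < i := by
    by_contra! h
    refine hl.ne (hshort l j h le_rfl fun h' => ?_)
    rw [h'] at hl
    exact hl.not_gt hlt
  exact hE'.noncrossing l i j k hli (hE.lt _ hmem) hjk hl' hk'

theorem NoncrossingAlternating.eq {E E' : Finset (Vertex n × Vertex n)}
    (hE : NoncrossingAlternating E) (hE' : NoncrossingAlternating E') {v : Vertex n → ℤ}
    (hv : v ∈ openCone E) (hv' : v ∈ openCone E') : E = E' := by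
  obtain ⟨c, hc, rfl⟩ := hv
  obtain ⟨c', hc', hf⟩ := hv'
  -- Induction on the length; the subtraction is truncated, but pairs without `i < j` have weight
  -- zero on both sides.
  have key : ∀ (m : ℕ) (i j : Vertex n), (j : ℕ) - i = m → c (i, j) = c' (i, j) := by
    intro m
    induction m using Nat.strong_induction_on with
    | _ m ih =>
    intro i j hm
    by_cases hij : i < j
    · have hshort : ∀ x y, i ≤ x → y ≤ j → (x, y) ≠ (i, j) → c (x, y) = c' (x, y) := by
        intro x y hx hy hne
        refine ih ((y : ℕ) - x) ?_ x y rfl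
        simp only [ne_eq, Prod.mk.injEq, Fin.ext_iff, Fin.le_def, Fin.lt_def] at *
        omega
      exact le_antisymm (hE.le_of_shorter hE' hc hc' hf.symm i j hshort)
        (hE'.le_of_shorter hE hc' hc hf i j fun x y hx hy hne => (hshort x y hx hy hne).symm)
    · rw [hc.2 _ fun h => hij (hE.lt _ h), hc'.2 _ fun h => hij (hE'.lt _ h)]
  have hcc : c = c' := funext fun e => key _ e.1 e.2 rfl
  subst hcc
  ext e
  rw [hc.mem_iff, hc'.mem_iff]

/-! ### Counting the vectors of an open cone by height -/

/-- The sum of the positive coordinates of `v`. -/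
def height (v : Vertex n → ℤ) : ℤ := ∑ x, max (v x) 0

/-- Sources contribute their outflow and all other vertices contribute nothing, so every edge is
counted once, at its left end. -/
theorem height_flow {E : Finset (Vertex n × Vertex n)}
    (ha : ∀ i j k : Vertex n, (i, j) ∈ E → (j, k) ∉ E) {c : Vertex n × Vertex n → ℤ}
    (hc : PositiveOn E c) : height (flow c) = ∑ e, c e := by
  rw [height, Fintype.sum_prod_type]
  refine Finset.sum_congr rfl fun x _ => ?_
  rw [flow_apply]
  by_cases h : ∃ y, (x, y) ∈ E
  · obtain ⟨y, hy⟩ := h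
    have h2 : ∑ y, c (y, x) = 0 := Finset.sum_eq_zero fun z _ => hc.2 _ fun hz => ha z x y hz hy
    have h3 : 0 ≤ ∑ y, c (x, y) := Finset.sum_nonneg fun z _ => hc.nonneg _
    rw [h2, sub_zero, max_eq_left h3]
  · push Not at h
    have h2 : ∑ y, c (x, y) = 0 := Finset.sum_eq_zero fun z _ => hc.2 _ (h z)
    have h3 : 0 ≤ ∑ y, c (y, x) := Finset.sum_nonneg fun z _ => hc.nonneg _
    rw [h2, max_eq_right]
    omega

theorem PositiveOn.abs_flow_le {E : Finset (Vertex n × Vertex n)} {c : Vertex n × Vertex n → ℤ}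
    (hc : PositiveOn E c) (x : Vertex n) : |flow c x| ≤ ∑ e, c e := by
  have h1 : 0 ≤ ∑ y, c (x, y) := Finset.sum_nonneg fun z _ => hc.nonneg _
  have h2 : 0 ≤ ∑ y, c (y, x) := Finset.sum_nonneg fun z _ => hc.nonneg _
  have h3 : ∑ y, c (x, y) ≤ ∑ e, c e := by
    rw [Fintype.sum_prod_type]
    exact Finset.single_le_sum (f := fun x => ∑ y, c (x, y))
      (fun i _ => Finset.sum_nonneg fun z _ => hc.nonneg _) (Finset.mem_univ x)
  have h4 : ∑ y, c (y, x) ≤ ∑ e, c e := by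
    rw [Fintype.sum_prod_type_right]
    exact Finset.single_le_sum (f := fun x => ∑ y, c (y, x))
      (fun i _ => Finset.sum_nonneg fun z _ => hc.nonneg _) (Finset.mem_univ x)
  rw [flow_apply, abs_le]
  constructor <;> omega

/-- A finite set that contains all vectors of height `m` in open cones of alternating graphs. -/
noncomputable def heightBox (n m : ℕ) : Finset (Vertex n → ℤ) :=
  (Fintype.piFinset fun _ => Finset.Icc (-(m : ℤ)) m).filter fun v => height v = m

theorem flow_mem_heightBox {E : Finset (Vertex n × Vertex n)}
    (ha : ∀ i j k : Vertex n, (i, j) ∈ E → (j, k) ∉ E) {c : Vertex n × Vertex n → ℤ}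
    (hc : PositiveOn E c) (m : ℕ) : flow c ∈ heightBox n m ↔ ∑ e, c e = m := by
  rw [heightBox, Finset.mem_filter, height_flow ha hc, Fintype.mem_piFinset]
  refine ⟨fun h => h.2, fun h => ⟨fun x => ?_, h⟩⟩
  rw [Finset.mem_Icc, ← abs_le, ← h]
  exact hc.abs_flow_le x

/-- The weightings of `E` by positive integers with sum `#E + m` are the weightings by natural
numbers with sum `m`, shifted by one. -/
theorem positiveOn_sum_eq_iff (E : Finset (Vertex n × Vertex n)) (m : ℕ) (c : Vertex n × Vertex n → ℤ) :
    (PositiveOn E c ∧ ∑ e, c e = (E.card + m : ℕ)) ↔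
      ∃ d ∈ Finset.piAntidiag E m, c = fun e => (d e : ℤ) + if e ∈ E then 1 else 0 := by
  have hsum : ∀ d : Vertex n × Vertex n → ℕ, (∀ e, d e ≠ 0 → e ∈ E) →
      ∑ e, ((d e : ℤ) + if e ∈ E then 1 else 0) = E.card + ((∑ e ∈ E, d e : ℕ) : ℤ) := by
    intro d hd
    rw [Finset.sum_add_distrib, ← Finset.sum_subset (Finset.subset_univ E) (f := fun e => (d e : ℤ))
      (fun e _ he => by
        by_contra h
        exact he (hd e (by exact_mod_cast h)))]
    simp [add_comm]
  constructor
  · rintro ⟨hc, hs⟩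
    have hd : ∀ e, (((c e).toNat - 1 : ℕ) : ℤ) + (if e ∈ E then 1 else 0) = c e := by
      intro e
      rcases hc.dichotomy e with h | h
      · simp only [h.1, if_true]
        omega
      · simp [h]
    have hsupp : ∀ e, (c e).toNat - 1 ≠ 0 → e ∈ E := fun e he => by
      by_contra h
      simp [hc.2 e h] at he
    refine ⟨fun e => (c e).toNat - 1, ?_, funext fun e => (hd e).symm⟩
    rw [Finset.mem_piAntidiag]
    refine ⟨?_, hsupp⟩
    have := hsum _ hsupp
    simp only [hd, hs] at this
    push_cast at this ⊢
    zify
    omega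
  · rintro ⟨d, hd, rfl⟩
    rw [Finset.mem_piAntidiag] at hd
    refine ⟨⟨fun e he => ?_, fun e he => ?_⟩, ?_⟩
    · simp only [he, if_true]
      positivity
    · have : d e = 0 := by
        by_contra h
        exact he (hd.2 e h)
      simp [he, this]
    · rw [hsum d hd.2, hd.1]
      push_cast
      rfl

open Classical in
-- Independence makes `flow` injective on weightings of `E`, and height is total weight. Subtracting
-- 1 from each positive coefficient leaves natural numbers with sum `m`.
theorem card_openCone_heightBox {E : Finset (Vertex n × Vertex n)} (hE : EdgeIndependent E)
    (ha : ∀ i j k : Vertex n, (i, j) ∈ E → (j, k) ∉ E) (m : ℕ) :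
    ((heightBox n (E.card + m)).filter fun v => v ∈ openCone E).card =
      (Finset.piAntidiag E m).card := by
  symm
  refine Finset.card_bij
    (fun d _ => flow fun e => (d e : ℤ) + if e ∈ E then 1 else 0) ?_ ?_ ?_
  · intro d hd
    obtain ⟨h1, h2⟩ := (positiveOn_sum_eq_iff E m _).mpr ⟨d, hd, rfl⟩
    rw [Finset.mem_filter, flow_mem_heightBox ha h1]
    exact ⟨h2, _, h1, rfl⟩
  · intro d hd d' hd' h
    obtain ⟨h1, h2⟩ := (positiveOn_sum_eq_iff E m _).mpr ⟨d, hd, rfl⟩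
    obtain ⟨h1', h2'⟩ := (positiveOn_sum_eq_iff E m _).mpr ⟨d', hd', rfl⟩
    have := hE.eq h1.2 h1'.2 h
    funext e
    have := congrFun this e
    omega
  · intro v hv
    rw [Finset.mem_filter] at hv
    obtain ⟨hv, c, hc, rfl⟩ := hv
    rw [flow_mem_heightBox ha hc] at hv
    obtain ⟨d, hd, rfl⟩ := (positiveOn_sum_eq_iff E m _).mp ⟨hc, hv⟩
    exact ⟨d, hd, rfl⟩

open Classical in
theorem card_openCone_heightBox_of_lt {E : Finset (Vertex n × Vertex n)}
    (ha : ∀ i j k : Vertex n, (i, j) ∈ E → (j, k) ∉ E) {m : ℕ} (hm : m < E.card) :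
    ((heightBox n m).filter fun v => v ∈ openCone E).card = 0 := by
  rw [Finset.card_eq_zero, Finset.filter_eq_empty_iff]
  rintro v hv ⟨c, hc, rfl⟩
  rw [flow_mem_heightBox ha hc] at hv
  have h1 : ∑ e ∈ E, (1 : ℤ) ≤ ∑ e ∈ E, c e := Finset.sum_le_sum fun e he => hc.1 e he
  rw [Finset.sum_subset (Finset.subset_univ E) fun e _ he => hc.2 e he, hv] at h1
  simp at h1
  omega

theorem card_piAntidiag_eq {ι : Type*} [DecidableEq ι] (s : Finset ι) (m : ℕ) :
    (Finset.piAntidiag s m).card = (Finset.finAntidiagonal s.card m).card := by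
  rw [Finset.piAntidiag]
  induction Fintype.truncEquivFinOfCardEq (Fintype.card_coe s) using Trunc.ind with | _ e
  simp only [Trunc.lift_mk, Finset.card_map]

/-- The number of vectors of height `m` in the open cone of an alternating forest
with `k` edges. -/
noncomputable def coneCount (k m : ℕ) : ℕ :=
  if m < k then 0 else (Finset.piAntidiag (Finset.range k) (m - k)).card

theorem coneCount_self (k : ℕ) : coneCount k k = 1 := by
  simp [coneCount]

open Classical in
theorem card_eq_coneCount {E : Finset (Vertex n × Vertex n)} (hE : EdgeIndependent E)
    (ha : ∀ i j k : Vertex n, (i, j) ∈ E → (j, k) ∉ E) (m : ℕ) :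
    ((heightBox n m).filter fun v => v ∈ openCone E).card = coneCount E.card m := by
  rw [coneCount]
  split_ifs with h
  · exact card_openCone_heightBox_of_lt ha h
  · obtain ⟨m, rfl⟩ := Nat.exists_eq_add_of_le (not_lt.mp h)
    rw [card_openCone_heightBox hE ha, Nat.add_sub_cancel_left]
    rw [card_piAntidiag_eq, card_piAntidiag_eq, Finset.card_range]

/-! ### Comparing two subdivisions of an open cone -/

open Classical in
theorem sum_countP_openCone (s : Finset (Vertex n → ℤ))
    (l : List (Finset (Vertex n × Vertex n))) :
    ∑ v ∈ s, l.countP (fun E => v ∈ openCone E) =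
      (l.map fun E => (s.filter fun v => v ∈ openCone E).card).sum := by
  induction l with
  | nil => simp
  | cons E l ih =>
    simp only [List.countP_cons, List.map_cons, List.sum_cons, Finset.sum_add_distrib, ih,
      Finset.card_filter, decide_eq_true_eq]
    exact add_comm _ _

theorem sum_map_coneCount {α : Type*} (f : α → ℕ) (m : ℕ) (l : List α) :
    (l.map fun a => coneCount (f a) m).sum =
      ∑ k ∈ Finset.range (m + 1), l.countP (fun a => f a = k) * coneCount k m := by
  induction l with
  | nil => simp
  | cons a l ih =>
    simp only [List.countP_cons, List.map_cons, List.sum_cons, add_mul, Finset.sum_add_distrib, ih,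
      decide_eq_true_eq, ite_mul, one_mul, zero_mul]
    rw [add_comm, Finset.sum_ite_eq (Finset.range (m + 1)) (f a) fun k => coneCount k m]
    congr 1
    split_ifs with h
    · rfl
    · rw [coneCount, if_pos]
      simpa using h

/-- Inversion of a unitriangular system: in the sum for height `k` only edge numbers up to `k`
occur, and edge number `k` has coefficient 1. -/
theorem countP_eq_of_coneCount {α β : Type*} (f : α → ℕ) (g : β → ℕ) (l : List α) (l' : List β)
    (h : ∀ m, (l.map fun a => coneCount (f a) m).sum = (l'.map fun b => coneCount (g b) m).sum)
    (k : ℕ) : l.countP (fun a => f a = k) = l'.countP (fun b => g b = k) := by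
  induction k using Nat.strong_induction_on with
  | _ k ih =>
  have := h k
  rw [sum_map_coneCount, sum_map_coneCount, Finset.sum_range_succ, Finset.sum_range_succ,
    Finset.sum_congr rfl fun j hj => by rw [ih j (Finset.mem_range.mp hj)]] at this
  simpa [coneCount_self] using this

open Classical in
/-- If two lists of alternating forests subdivide the same open cone, then they contain the same
number of forests with `k` edges. -/
theorem countP_card_eq (l l' : List (Finset (Vertex n × Vertex n)))
    (hl : ∀ E ∈ l, EdgeIndependent E ∧ ∀ i j k : Vertex n, (i, j) ∈ E → (j, k) ∉ E)
    (hl' : ∀ E ∈ l', EdgeIndependent E ∧ ∀ i j k : Vertex n, (i, j) ∈ E → (j, k) ∉ E)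
    (h : ∀ v, l.countP (fun E => v ∈ openCone E) = l'.countP (fun E => v ∈ openCone E)) (k : ℕ) :
    l.countP (fun E => E.card = k) = l'.countP (fun E => E.card = k) := by
  refine countP_eq_of_coneCount Finset.card Finset.card l l' (fun m => ?_) k
  rw [← List.map_congr_left fun E hE => card_eq_coneCount (hl E hE).1 (hl E hE).2 m,
    ← List.map_congr_left fun E hE => card_eq_coneCount (hl' E hE).1 (hl' E hE).2 m,
    ← sum_countP_openCone, ← sum_countP_openCone]
  exact Finset.sum_congr rfl fun v _ => h v

/-! ### Reduction trees in the noncommutative case -/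

/-- A measure that drops in every reduction. -/
def deficit (w : EdgeWord n) : ℕ := (w.map fun e => n + 1 - ((e.2 : ℕ) - e.1)).sum

theorem CommEquiv.deficit_eq {w w' : EdgeWord n} (h : CommEquiv w w') :
    deficit w = deficit w' :=
  (h.perm.map _).sum_eq

theorem exists_tree_of_commEquiv {w w' : EdgeWord n} (h : CommEquiv w w')
    (t' : BReductionTree w') : ∃ t : BReductionTree w, t.leaves = t'.leaves := by
  induction h using Relation.ReflTransGen.head_induction_on with
  | refl => exact ⟨t', rfl⟩
  | head h _ ih =>
    obtain ⟨t, ht⟩ := ih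
    exact ⟨.commute _ _ h t, ht⟩

/-- Reductions terminate: every edge contributes at least 1 to `deficit`, two of the children have
one edge replaced by a longer one, and the third has two edges merged into one longer edge. -/
theorem nonempty_bReductionTree (w : EdgeWord n) : Nonempty (BReductionTree w) := by
  induction hm : deficit w using Nat.strong_induction_on generalizing w with
  | _ m ih =>
  by_cases h : ∀ w', CommEquiv w w' → ¬ BReducible w'
  · exact ⟨.leaf w h⟩
  push Not at h
  obtain ⟨w', hw', p, s, i, j, k, hij, hjk, rfl⟩ := h
  have hd := hm.symm.trans hw'.deficit_eq
  simp only [deficit, List.map_append, List.map_cons, List.sum_append, List.sum_cons] at hd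
  have hij' := Fin.lt_def.mp hij
  have hjk' := Fin.lt_def.mp hjk
  have hi := i.isLt
  have hk := k.isLt
  obtain ⟨t₁⟩ := ih _ (by
    simp only [deficit, List.map_append, List.map_cons, List.sum_append, List.sum_cons]
    omega) (p ++ (i, k) :: (i, j) :: s) rfl
  obtain ⟨t₂⟩ := ih _ (by
    simp only [deficit, List.map_append, List.map_cons, List.sum_append, List.sum_cons]
    omega) (p ++ (j, k) :: (i, k) :: s) rfl
  obtain ⟨t₃⟩ := ih _ (by
    simp only [deficit, List.map_append, List.map_cons, List.sum_append, List.sum_cons]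
    omega) (p ++ (i, k) :: s) rfl
  obtain ⟨t, -⟩ := exists_tree_of_commEquiv hw' (.reduce _ p s i j k hij hjk rfl t₁ t₂ t₃)
  exact ⟨t⟩

/-- Irreducibility of a leaf is invariant under commutation, so the label of each leaf may be
normalized separately. This turns the statement up to commutation into the exact one of part (b). -/
theorem exists_tree_map_leaves {w : EdgeWord n} (t : BReductionTree w)
    (φ : EdgeWord n → EdgeWord n) (h : ∀ L ∈ t.leaves, CommEquiv L (φ L)) :
    ∃ t' : BReductionTree w, t'.leaves = t.leaves.map φ := by
  induction t with
  | leaf w hw =>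
    have hφ : CommEquiv w (φ w) := h w (by simp [BReductionTree.leaves])
    exact exists_tree_of_commEquiv hφ (.leaf (φ w) fun w' hw' => hw w' (hφ.trans hw'))
  | commute w w' hc t ih =>
    obtain ⟨t', ht'⟩ := ih h
    exact ⟨.commute w w' hc t', ht'⟩
  | reduce w p s i j k hij hjk hw t₁ t₂ t₃ ih₁ ih₂ ih₃ =>
    simp only [BReductionTree.leaves, List.mem_append] at h
    obtain ⟨t₁', h₁⟩ := ih₁ fun L hL => h L (.inl (.inl hL))
    obtain ⟨t₂', h₂⟩ := ih₂ fun L hL => h L (.inl (.inr hL))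
    obtain ⟨t₃', h₃⟩ := ih₃ fun L hL => h L (.inr hL)
    exact ⟨.reduce w p s i j k hij hjk hw t₁' t₂' t₃', by
      simp [BReductionTree.leaves, h₁, h₂, h₃]⟩

/-- A property of edge-labeled graphs that is preserved under reductions. -/
structure ReductionInvariant (Q : EdgeWord n → Prop) : Prop where
  commStep : ∀ w w', CommStep w w' → Q w → Q w'
  left : ∀ (p s : EdgeWord n) (i j k : Vertex n), i < j → j < k →
    Q (p ++ (i, j) :: (j, k) :: s) → Q (p ++ (i, k) :: (i, j) :: s)
  right : ∀ (p s : EdgeWord n) (i j k : Vertex n), i < j → j < k →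
    Q (p ++ (i, j) :: (j, k) :: s) → Q (p ++ (j, k) :: (i, k) :: s)
  both : ∀ (p s : EdgeWord n) (i j k : Vertex n), i < j → j < k →
    Q (p ++ (i, j) :: (j, k) :: s) → Q (p ++ (i, k) :: s)

theorem ReductionInvariant.leaves {Q : EdgeWord n → Prop} (hQ : ReductionInvariant Q)
    {w : EdgeWord n} (t : BReductionTree w) (hw : Q w) :
    ∀ L ∈ t.leaves, Q L ∧ ∀ w', CommEquiv L w' → ¬ BReducible w' := by
  induction t with
  | leaf w h =>
    intro L hL
    rw [BReductionTree.leaves, List.mem_singleton] at hL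
    subst hL
    exact ⟨hw, h⟩
  | commute w w' hc t ih => exact ih (hQ.commStep _ _ hc hw)
  | reduce w p s i j k hij hjk h t₁ t₂ t₃ ih₁ ih₂ ih₃ =>
    subst h
    intro L hL
    simp only [BReductionTree.leaves, List.mem_append] at hL
    rcases hL with (hL | hL) | hL
    · exact ih₁ (hQ.left p s i j k hij hjk hw) L hL
    · exact ih₂ (hQ.right p s i j k hij hjk hw) L hL
    · exact ih₃ (hQ.both p s i j k hij hjk hw) L hL

theorem goodWord_reductionInvariant : ReductionInvariant (GoodWord (n := n)) where
  commStep _ _ h hw := hw.commStep h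
  left _ _ _ _ _ hij hjk hw := hw.reduce_left hij hjk
  right _ _ _ _ _ hij hjk hw := hw.reduce_right hij hjk
  both _ _ _ _ _ hij hjk hw := hw.reduce_both hij hjk

/-- The new edge (i, k) is the composite of (i, j) and (j, k). With `r` the increasing steps of the
root, this keeps all leaves in the transitive closure. -/
theorem transGen_reductionInvariant (r : Vertex n → Vertex n → Prop) :
    ReductionInvariant fun w => ∀ e ∈ w, Relation.TransGen r e.1 e.2 where
  commStep _ _ h hw e he := hw e (h.perm.mem_iff.mpr he)
  left p s i j k _ _ hw := by
    simp only [List.forall_mem_append, List.forall_mem_cons] at hw ⊢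
    exact ⟨hw.1, hw.2.1.trans hw.2.2.1, hw.2.1, hw.2.2.2⟩
  right p s i j k _ _ hw := by
    simp only [List.forall_mem_append, List.forall_mem_cons] at hw ⊢
    exact ⟨hw.1, hw.2.2.1, hw.2.1.trans hw.2.2.1, hw.2.2.2⟩
  both p s i j k _ _ hw := by
    simp only [List.forall_mem_append, List.forall_mem_cons] at hw ⊢
    exact ⟨hw.1, hw.2.1.trans hw.2.2.1, hw.2.2.2⟩

open Classical in
/-- The open cones of the leaves subdivide the open cone of the root. -/
theorem countP_openCone_leaves {w : EdgeWord n} (t : BReductionTree w) (hw : GoodWord w)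
    (v : Vertex n → ℤ) :
    t.leaves.countP (fun L => v ∈ openCone L.toFinset) =
      if v ∈ openCone w.toFinset then 1 else 0 := by
  induction t with
  | leaf w h => simp [BReductionTree.leaves, List.countP_cons]
  | commute w w' hc t ih =>
    rw [BReductionTree.leaves, ih (hw.commStep hc), List.toFinset_eq_of_perm _ _ hc.perm]
  | reduce w p s i j k hij hjk h t₁ t₂ t₃ ih₁ ih₂ ih₃ =>
    subst h
    obtain ⟨n1, n2, n3⟩ := hw.notMem hij hjk
    rw [BReductionTree.leaves, List.countP_append, List.countP_append,
      ih₁ (hw.reduce_left hij hjk), ih₂ (hw.reduce_right hij hjk), ih₃ (hw.reduce_both hij hjk),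
      toFinset_middle, toFinset_middle, toFinset_middle, toFinset_middle_one]
    exact openCone_reduce hij hjk (by simpa using n1) (by simpa using n2) (by simpa using n3)
      hw.independent_insert v

/-! ### Reduction trees in the commutative case -/

/-- The conditions on the edges of a forest that are preserved by commutative reductions. -/
structure ForestMultiset (m : EdgeMultiset n) : Prop where
  lt : ∀ e ∈ m, e.1 < e.2
  nodup : m.Nodup
  independent : EdgeIndependent m.toFinset

section CommutativeReduce

variable {r : EdgeMultiset n} {i j k : Vertex n}

theorem ForestMultiset.notMem (hij : i < j) (hjk : j < k)
    (h : ForestMultiset ((i, j) ::ₘ (j, k) ::ₘ r)) : (i, j) ∉ r ∧ (j, k) ∉ r ∧ (i, k) ∉ r := by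
  have hn := h.nodup
  have hl := h.independent.long_notMem hij hjk (by simp) (by simp)
  simp only [Multiset.nodup_cons, Multiset.mem_cons, not_or] at hn
  simp only [Multiset.mem_toFinset, Multiset.mem_cons, not_or] at hl
  exact ⟨hn.1.2, hn.2.1, hl.2.2⟩

theorem ForestMultiset.independent_insert (h : ForestMultiset ((i, j) ::ₘ (j, k) ::ₘ r)) :
    EdgeIndependent (insert (i, j) (insert (j, k) r.toFinset)) := by
  simpa using h.independent

theorem ForestMultiset.reduce_left (hij : i < j) (hjk : j < k)
    (h : ForestMultiset ((i, j) ::ₘ (j, k) ::ₘ r)) : ForestMultiset ((i, k) ::ₘ (i, j) ::ₘ r) := by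
  obtain ⟨n1, n2, n3⟩ := h.notMem hij hjk
  have hn := h.nodup
  have hl := h.lt
  simp only [Multiset.nodup_cons, Multiset.mem_cons, forall_eq_or_imp] at hn hl
  refine ⟨?_, ?_, ?_⟩
  · simp only [Multiset.mem_cons, forall_eq_or_imp]
    exact ⟨hij.trans hjk, hij, hl.2.2⟩
  · simp [n1, n3, hn.2.2, hjk.ne']
  · simpa using h.independent_insert.reduce_left hij hjk (by simpa using n2)

theorem ForestMultiset.reduce_right (hij : i < j) (hjk : j < k)
    (h : ForestMultiset ((i, j) ::ₘ (j, k) ::ₘ r)) : ForestMultiset ((i, k) ::ₘ (j, k) ::ₘ r) := by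
  obtain ⟨n1, n2, n3⟩ := h.notMem hij hjk
  have hn := h.nodup
  have hl := h.lt
  simp only [Multiset.nodup_cons, Multiset.mem_cons, forall_eq_or_imp] at hn hl
  refine ⟨?_, ?_, ?_⟩
  · simp only [Multiset.mem_cons, forall_eq_or_imp]
    exact ⟨hij.trans hjk, hjk, hl.2.2⟩
  · simp [n2, n3, hn.2.2, hij.ne]
  · simpa [Finset.insert_comm] using
      h.independent_insert.reduce_right hij hjk (by simpa using n1)

theorem ForestMultiset.reduce_both (hij : i < j) (hjk : j < k)
    (h : ForestMultiset ((i, j) ::ₘ (j, k) ::ₘ r)) : ForestMultiset ((i, k) ::ₘ r) := by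
  obtain ⟨n1, n2, n3⟩ := h.notMem hij hjk
  have hn := h.nodup
  have hl := h.lt
  simp only [Multiset.nodup_cons, Multiset.mem_cons, forall_eq_or_imp] at hn hl
  refine ⟨?_, ?_, ?_⟩
  · simp only [Multiset.mem_cons, forall_eq_or_imp]
    exact ⟨hij.trans hjk, hl.2.2⟩
  · simp [n3, hn.2.2]
  · simpa using h.independent_insert.reduce_both hij hjk (by simpa using n2)

theorem exists_eq_cons_cons {m : EdgeMultiset n} (hij : i < j) (h₁ : (i, j) ∈ m)
    (h₂ : (j, k) ∈ m) : ∃ r, m = (i, j) ::ₘ (j, k) ::ₘ r := by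
  obtain ⟨r, rfl⟩ := Multiset.exists_cons_of_mem h₁
  have h₃ : (j, k) ∈ r := (Multiset.mem_cons.mp h₂).resolve_left fun h =>
    hij.ne (Prod.mk.inj h).1.symm
  obtain ⟨r, rfl⟩ := Multiset.exists_cons_of_mem h₃
  exact ⟨r, rfl⟩

theorem erase_right_cons_cons :
    ((i, j) ::ₘ (j, k) ::ₘ r).erase (j, k) = (i, j) ::ₘ r := by
  rw [Multiset.erase_cons_tail_of_mem, Multiset.erase_cons_head]
  exact Multiset.mem_cons_self _ _

end CommutativeReduce

theorem nonempty_sReductionTree (m : EdgeMultiset n) : Nonempty (SReductionTree m) := by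
  induction hd : (m.map fun e => n + 1 - ((e.2 : ℕ) - e.1)).sum using Nat.strong_induction_on
    generalizing m with
  | _ d ih =>
  by_cases h : ∀ i j k : Vertex n, i < j → j < k → ¬ ((i, j) ∈ m ∧ (j, k) ∈ m)
  · exact ⟨.leaf m h⟩
  push Not at h
  obtain ⟨i, j, k, hij, hjk, h₁, h₂⟩ := h
  obtain ⟨r, rfl⟩ := exists_eq_cons_cons hij h₁ h₂
  simp only [Multiset.map_cons, Multiset.sum_cons] at hd
  have hi := i.isLt
  have hk := k.isLt
  have hij' := Fin.lt_def.mp hij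
  have hjk' := Fin.lt_def.mp hjk
  obtain ⟨t₁⟩ := ih _ (by
    rw [erase_right_cons_cons]
    simp only [Multiset.map_cons, Multiset.sum_cons]
    omega) ((i, k) ::ₘ ((i, j) ::ₘ (j, k) ::ₘ r).erase (j, k)) rfl
  obtain ⟨t₂⟩ := ih _ (by
    rw [Multiset.erase_cons_head]
    simp only [Multiset.map_cons, Multiset.sum_cons]
    omega) ((i, k) ::ₘ ((i, j) ::ₘ (j, k) ::ₘ r).erase (i, j)) rfl
  obtain ⟨t₃⟩ := ih _ (by
    rw [Multiset.erase_cons_head, Multiset.erase_cons_head]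
    simp only [Multiset.map_cons, Multiset.sum_cons]
    omega) ((i, k) ::ₘ (((i, j) ::ₘ (j, k) ::ₘ r).erase (i, j)).erase (j, k)) rfl
  exact ⟨.reduce _ i j k hij hjk h₁ h₂ t₁ t₂ t₃⟩

theorem ForestMultiset.leaves {m : EdgeMultiset n} (t : SReductionTree m)
    (hm : ForestMultiset m) : ∀ L ∈ t.leaves, ForestMultiset L ∧
      ∀ i j k : Vertex n, (i, j) ∈ L → (j, k) ∉ L := by
  induction t with
  | leaf m h =>
    intro L hL
    rw [SReductionTree.leaves, List.mem_singleton] at hL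
    subst hL
    exact ⟨hm, fun i j k h₁ h₂ => h i j k (hm.lt _ h₁) (hm.lt _ h₂) ⟨h₁, h₂⟩⟩
  | reduce m i j k hij hjk h₁ h₂ t₁ t₂ t₃ ih₁ ih₂ ih₃ =>
    obtain ⟨r, rfl⟩ := exists_eq_cons_cons hij h₁ h₂
    intro L hL
    simp only [SReductionTree.leaves, List.mem_append] at hL
    rcases hL with (hL | hL) | hL
    · refine ih₁ ?_ L hL
      rw [erase_right_cons_cons]
      exact hm.reduce_left hij hjk
    · refine ih₂ ?_ L hL
      rw [Multiset.erase_cons_head]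
      exact hm.reduce_right hij hjk
    · refine ih₃ ?_ L hL
      rw [Multiset.erase_cons_head, Multiset.erase_cons_head]
      exact hm.reduce_both hij hjk

open Classical in
theorem ForestMultiset.countP_openCone_leaves {m : EdgeMultiset n} (t : SReductionTree m)
    (hm : ForestMultiset m) (v : Vertex n → ℤ) :
    t.leaves.countP (fun L => v ∈ openCone L.toFinset) =
      if v ∈ openCone m.toFinset then 1 else 0 := by
  induction t with
  | leaf m h => simp [SReductionTree.leaves, List.countP_cons]
  | reduce m i j k hij hjk h₁ h₂ t₁ t₂ t₃ ih₁ ih₂ ih₃ =>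
    obtain ⟨r, rfl⟩ := exists_eq_cons_cons hij h₁ h₂
    obtain ⟨n1, n2, n3⟩ := hm.notMem hij hjk
    have e₁ : (i, k) ::ₘ ((i, j) ::ₘ (j, k) ::ₘ r).erase (j, k) = (i, k) ::ₘ (i, j) ::ₘ r := by
      rw [erase_right_cons_cons]
    have e₂ : (i, k) ::ₘ ((i, j) ::ₘ (j, k) ::ₘ r).erase (i, j) = (i, k) ::ₘ (j, k) ::ₘ r := by
      rw [Multiset.erase_cons_head]
    have e₃ : (i, k) ::ₘ (((i, j) ::ₘ (j, k) ::ₘ r).erase (i, j)).erase (j, k) =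
        (i, k) ::ₘ r := by
      rw [Multiset.erase_cons_head, Multiset.erase_cons_head]
    rw [SReductionTree.leaves, List.countP_append, List.countP_append,
      ih₁ (e₁ ▸ hm.reduce_left hij hjk), ih₂ (e₂ ▸ hm.reduce_right hij hjk),
      ih₃ (e₃ ▸ hm.reduce_both hij hjk), congrArg Multiset.toFinset e₁,
      congrArg Multiset.toFinset e₂, congrArg Multiset.toFinset e₃]
    simp only [Multiset.toFinset_cons]
    rw [Finset.insert_comm (i, k) (j, k)]
    exact openCone_reduce hij hjk (by simpa using n1) (by simpa using n2) (by simpa using n3)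
      hm.independent_insert v

/-! ### Edge words and simple graphs -/

theorem toGraph_adj {w : EdgeWord n} (hlt : ∀ e ∈ w, e.1 < e.2) {a b : Vertex n} :
    (toGraph w).Adj a b ↔ (a, b) ∈ w ∨ (b, a) ∈ w := by
  rw [toGraph, SimpleGraph.fromRel_adj]
  refine ⟨fun h => h.2, fun h => ⟨?_, h⟩⟩
  rcases h with h | h
  · exact (hlt _ h).ne
  · exact (hlt _ h).ne'

theorem toGraph_adj_of_lt {w : EdgeWord n} (hlt : ∀ e ∈ w, e.1 < e.2) {a b : Vertex n}
    (hab : a < b) : (toGraph w).Adj a b ↔ (a, b) ∈ w := by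
  rw [toGraph_adj hlt]
  exact ⟨fun h => h.resolve_right fun h => (hlt _ h).not_gt hab, .inl⟩

/-- The steps of increasing paths in `G`. -/
abbrev Up (G : SimpleGraph (Vertex n)) (a b : Vertex n) : Prop := a < b ∧ G.Adj a b

theorem lt_of_transGen_up {G : SimpleGraph (Vertex n)} {a b : Vertex n}
    (h : Relation.TransGen (Up G) a b) : a < b := by
  induction h with
  | single h => exact h.1
  | tail _ h ih => exact ih.trans h.1

theorem le_of_reflTransGen_up {G : SimpleGraph (Vertex n)} {a b : Vertex n}
    (h : Relation.ReflTransGen (Up G) a b) : a ≤ b := by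
  induction h with
  | refl => exact le_rfl
  | tail _ h ih => exact ih.trans h.1.le

theorem transClosure_adj_of_lt {G : SimpleGraph (Vertex n)} {a b : Vertex n} (hab : a < b) :
    (transClosure G).Adj a b ↔ Relation.TransGen (Up G) a b := by
  rw [transClosure, SimpleGraph.fromRel_adj]
  exact ⟨fun h => h.2.resolve_right fun h => (lt_of_transGen_up h).not_gt hab,
    fun h => ⟨hab.ne, .inl h⟩⟩

theorem le_transClosure_iff {F G : SimpleGraph (Vertex n)} :
    F ≤ transClosure G ↔ ∀ a b, a < b → F.Adj a b → Relation.TransGen (Up G) a b := by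
  constructor
  · exact fun h a b hab hF => (transClosure_adj_of_lt hab).mp (h hF)
  · intro h a b hF
    rcases hF.ne.lt_or_gt with hab | hab
    · exact (transClosure_adj_of_lt hab).mpr (h a b hab hF)
    · exact ((transClosure_adj_of_lt hab).mpr (h b a hab hF.symm)).symm

/-! ### Acyclic graphs and independence of edge vectors -/

/-- Summation by parts: a flow is tested against a potential `s`, and each edge sees only the
difference of `s` at its ends. -/
theorem sum_mul_flow (s : Vertex n → ℤ) (c : Vertex n × Vertex n → ℤ) :
    ∑ x, s x * flow c x = ∑ e, c e * (s e.1 - s e.2) := by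
  simp only [flow_apply, mul_sub, Finset.sum_sub_distrib, Finset.mul_sum]
  congr 1
  · rw [Fintype.sum_prod_type]
    exact Finset.sum_congr rfl fun x _ => Finset.sum_congr rfl fun y _ => mul_comm _ _
  · rw [Fintype.sum_prod_type_right]
    exact Finset.sum_congr rfl fun x _ => Finset.sum_congr rfl fun y _ => mul_comm _ _

theorem edgeIndependent_of_isAcyclic {G : SimpleGraph (Vertex n)} (hG : G.IsAcyclic)
    {E : Finset (Vertex n × Vertex n)} (hE : ∀ e ∈ E, Up G e.1 e.2) : EdgeIndependent E := by
  classical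
  intro c hc h0
  funext e
  by_cases he : e ∈ E
  swap
  · exact hc e he
  have hb := SimpleGraph.isAcyclic_iff_forall_adj_isBridge.mp hG (hE e he).2
  rw [SimpleGraph.isBridge_iff] at hb
  -- The potential is the indicator of the component of `e.1` after deleting `e`. It is constant
  -- along every other edge and drops by 1 along the bridge `e`, so the test isolates `c e`.
  have key := sum_mul_flow
    (fun x => if (G.deleteEdges {s(e.1, e.2)}).Reachable e.1 x then 1 else 0) c
  rw [h0, Finset.sum_eq_single e] at key
  · simpa [hb] using key.symm
  · intro f _ hfe
    by_cases hf : f ∈ E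
    · have hadj : (G.deleteEdges {s(e.1, e.2)}).Adj f.1 f.2 := by
        rw [SimpleGraph.deleteEdges_adj]
        refine ⟨(hE f hf).2, fun h => ?_⟩
        rw [Set.mem_singleton_iff, Sym2.eq_iff] at h
        rcases h with h | h
        · exact hfe (Prod.ext h.1 h.2)
        · have h1 := (hE f hf).1
          rw [h.1, h.2] at h1
          exact h1.not_gt (hE e he).1
      have hiff : (G.deleteEdges {s(e.1, e.2)}).Reachable e.1 f.1 ↔
          (G.deleteEdges {s(e.1, e.2)}).Reachable e.1 f.2 :=
        ⟨fun h => h.trans hadj.reachable, fun h => h.trans hadj.symm.reachable⟩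
      simp [hiff]
    · simp [hc f hf]
  · simp

theorem exists_flow_of_reachable {G : SimpleGraph (Vertex n)} {a b : Vertex n}
    (h : G.Reachable a b) : ∃ c : Vertex n × Vertex n → ℤ,
      flow c = Pi.single a 1 - Pi.single b 1 ∧ ∀ e, c e ≠ 0 → Up G e.1 e.2 := by
  obtain ⟨p⟩ := h
  induction p with
  | nil => exact ⟨0, by simp, by simp⟩
  | @cons u v w h p ih =>
    obtain ⟨c, hc, hs⟩ := ih
    rcases h.ne.lt_or_gt with huv | huv
    · refine ⟨Pi.single (u, v) 1 + c, by rw [map_add, flow_single, hc]; abel, fun e he => ?_⟩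
      by_cases heq : e = (u, v)
      · subst heq
        exact ⟨huv, h⟩
      · exact hs e (by simpa [Pi.single_eq_of_ne heq] using he)
    · refine ⟨c - Pi.single (v, u) 1, by rw [map_sub, flow_single, hc]; abel, fun e he => ?_⟩
      by_cases heq : e = (v, u)
      · subst heq
        exact ⟨huv, h.symm⟩
      · exact hs e (by simpa [Pi.single_eq_of_ne heq] using he)

/-- If an edge is not a bridge, the flow along a detour between its ends minus the edge itself is a
nontrivial relation. -/
theorem isAcyclic_of_edgeIndependent {G : SimpleGraph (Vertex n)}
    {E : Finset (Vertex n × Vertex n)} (hE : EdgeIndependent E)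
    (hG : ∀ a b, a < b → G.Adj a b → (a, b) ∈ E) : G.IsAcyclic := by
  have key : ∀ a b, a < b → G.Adj a b → G.IsBridge s(a, b) := by
    intro a b hab h
    rw [SimpleGraph.isBridge_iff]
    intro hr
    obtain ⟨c, hc, hs⟩ := exists_flow_of_reachable hr
    have hab0 : c (a, b) = 0 := by
      by_contra hne
      have := (hs _ hne).2
      simp [SimpleGraph.deleteEdges_adj] at this
    have h0 := hE (c - Pi.single (a, b) 1) (fun e he => by
      have hne : e ≠ (a, b) := fun h' => he (h' ▸ hG a b hab h)
      have hce : c e = 0 := by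
        by_contra hne'
        have h1 := hs e hne'
        exact he (hG e.1 e.2 h1.1 ((SimpleGraph.deleteEdges_adj.mp h1.2).1))
      simp [hce, Pi.single_eq_of_ne hne]) (by rw [map_sub, hc, flow_single, sub_self])
    have := congrFun h0 (a, b)
    simp [hab0] at this
  rw [SimpleGraph.isAcyclic_iff_forall_adj_isBridge]
  intro a b h
  rcases h.ne.lt_or_gt with hab | hab
  · exact key a b hab h
  · rw [Sym2.eq_swap]
    exact key b a hab h.symm

/-! ### Good trees and good words -/

theorem pairwise_of_getElem? {α : Type*} {R : α → α → Prop} {w : List α}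
    (h : ∀ (a b : ℕ) (x y : α), a < b → w[a]? = some x → w[b]? = some y → R x y) :
    w.Pairwise R := by
  rw [List.pairwise_iff_getElem]
  exact fun a b ha hb hab => h a b _ _ hab (List.getElem?_eq_getElem ha)
    (List.getElem?_eq_getElem hb)

theorem IsGoodForest.goodWord {w : EdgeWord n} (hw : IsGoodForest w) : GoodWord w where
  lt := hw.labeled.2
  nodup := hw.labeled.1
  pairwise := by
    refine pairwise_of_getElem? ?_
    rintro a b ⟨x, y⟩ ⟨x', y'⟩ hab hx hy (h | h | h)
    · simp only at h
      subst h
      exact (hw.cond_i b a x' y' y (hw.labeled.2 _ (List.mem_of_getElem? hy))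
        (hw.labeled.2 _ (List.mem_of_getElem? hx)) hy hx).not_gt hab
    · simp only at h
      obtain ⟨rfl, h⟩ := h
      exact (hw.cond_ii a b x' y y' h hx hy).not_gt hab
    · simp only at h
      obtain ⟨rfl, h⟩ := h
      exact (hw.cond_iii a b x y' x' h hx hy).not_gt hab
  noncrossing i j k l hij hjk hkl h1 h2 :=
    hw.noncrossing i j k l hij hjk hkl
      ⟨(toGraph_adj_of_lt hw.labeled.2 (hij.trans hjk)).mpr h1,
        (toGraph_adj_of_lt hw.labeled.2 (hjk.trans hkl)).mpr h2⟩
  independent := edgeIndependent_of_isAcyclic hw.acyclic fun e he => by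
    have he := List.mem_toFinset.mp he
    exact ⟨hw.labeled.2 e he, (toGraph_adj_of_lt hw.labeled.2 (hw.labeled.2 e he)).mpr he⟩

/-! ### Coverings -/

/-- An increasing path in `G` between the endpoints of `e` passes through the edge `f`. -/
def Covers (G : SimpleGraph (Vertex n)) (e f : Vertex n × Vertex n) : Prop :=
  Relation.ReflTransGen (Up G) e.1 f.1 ∧ Up G f.1 f.2 ∧ Relation.ReflTransGen (Up G) f.2 e.2

theorem exists_flow_of_reflTransGen {G : SimpleGraph (Vertex n)} {a b : Vertex n}
    (h : Relation.ReflTransGen (Up G) a b) : ∃ c : Vertex n × Vertex n → ℤ,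
      (∀ f, 0 ≤ c f) ∧ flow c = Pi.single a 1 - Pi.single b 1 ∧
        ∀ f, c f ≠ 0 → Covers G (a, b) f := by
  induction h with
  | refl => exact ⟨0, by simp, by simp, by simp⟩
  | @tail b d hab hbd ih =>
    obtain ⟨c, h0, hc, hs⟩ := ih
    refine ⟨c + Pi.single (b, d) 1, fun f => add_nonneg (h0 f) ?_, ?_, fun f hf => ?_⟩
    · by_cases h : f = (b, d)
      · simp [h]
      · simp [Pi.single_eq_of_ne h]
    · rw [map_add, hc, flow_single]
      abel
    · by_cases h : f = (b, d)
      · subst h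
        exact ⟨hab, hbd, .refl⟩
      · obtain ⟨h1, h2, h3⟩ := hs f (by simpa [Pi.single_eq_of_ne h] using hf)
        exact ⟨h1, h2, h3.tail hbd⟩

/-- The path is routed through `f`, and increasing steps only ever add to a coefficient, so nothing
cancels at `f`. -/
theorem Covers.exists_flow {G : SimpleGraph (Vertex n)} {e f : Vertex n × Vertex n}
    (h : Covers G e f) : ∃ c : Vertex n × Vertex n → ℤ,
      flow c = Pi.single e.1 1 - Pi.single e.2 1 ∧ (∀ g, c g ≠ 0 → Up G g.1 g.2) ∧ 0 < c f := by
  obtain ⟨h1, h2, h3⟩ := h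
  obtain ⟨c₁, p₁, f₁, s₁⟩ := exists_flow_of_reflTransGen h1
  obtain ⟨c₃, p₃, f₃, s₃⟩ := exists_flow_of_reflTransGen h3
  refine ⟨c₁ + Pi.single f 1 + c₃, ?_, fun g hg => ?_, ?_⟩
  · rw [map_add, map_add, f₁, f₃, flow_single f.1 f.2]
    abel
  · by_cases hgf : g = f
    · exact hgf ▸ h2
    by_contra hcon
    refine hg ?_
    have e1 : c₁ g = 0 := by
      by_contra h
      exact hcon (s₁ g h).2.1
    have e3 : c₃ g = 0 := by
      by_contra h
      exact hcon (s₃ g h).2.1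
    simp [e1, e3, Pi.single_eq_of_ne hgf]
  · have := p₁ f
    have := p₃ f
    simp only [Pi.add_apply, Pi.single_eq_same]
    omega

theorem flow_eq_sum (F : Finset (Vertex n × Vertex n)) {a : Vertex n × Vertex n → ℤ}
    (ha : ∀ e ∉ F, a e = 0) :
    flow a = ∑ e ∈ F, a e • (Pi.single e.1 1 - Pi.single e.2 1 : Vertex n → ℤ) := by
  have h : a = ∑ e ∈ F, a e • Pi.single e (1 : ℤ) := by
    funext f
    by_cases hf : f ∈ F
    · rw [Finset.sum_apply, Finset.sum_eq_single f]
      · simp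
      · intro e _ he
        simp [Pi.single_eq_of_ne he.symm]
      · exact fun h => absurd hf h
    · rw [Finset.sum_apply, Finset.sum_eq_zero, ha f hf]
      intro e he
      have : f ≠ e := fun h => hf (h ▸ he)
      simp [Pi.single_eq_of_ne this]
  conv_lhs => rw [h]
  rw [map_sum]
  exact Finset.sum_congr rfl fun e _ => by rw [map_smul, flow_single]

/-! ### Open cones of graphs in the transitive closure -/

section Cone

variable {G : SimpleGraph (Vertex n)} {E F : Finset (Vertex n × Vertex n)}
  (hE : ∀ f, f ∈ E ↔ Up G f.1 f.2) (hF : ∀ e ∈ F, Relation.TransGen (Up G) e.1 e.2)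
include hE hF

theorem exists_path_flow (a : Vertex n × Vertex n → ℤ) (ha : PositiveOn F a) :
    ∃ p : Vertex n × Vertex n → Vertex n × Vertex n → ℤ,
      (∀ e ∈ F, (∀ f, 0 ≤ p e f) ∧ flow (p e) = Pi.single e.1 1 - Pi.single e.2 1 ∧
        ∀ f, p e f ≠ 0 → Covers G e f) ∧
      flow (∑ e ∈ F, a e • p e) = flow a ∧ ∀ f ∉ E, (∑ e ∈ F, a e • p e) f = 0 := by
  have := fun e (he : e ∈ F) => exists_flow_of_reflTransGen (hF e he).to_reflTransGen
  choose! p hp using this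
  refine ⟨p, hp, ?_, fun f hf => ?_⟩
  · rw [map_sum, flow_eq_sum F ha.2]
    exact Finset.sum_congr rfl fun e he => by rw [map_smul, (hp e he).2.1]
  · rw [Finset.sum_apply]
    refine Finset.sum_eq_zero fun e he => ?_
    have : p e f = 0 := by
      by_contra h
      exact hf ((hE f).mpr ((hp e he).2.2 f h).2.1)
    simp [this]

/-- The coordinates of `v` on the independent set `E` are unique. They are positive by `hvE`, and
also sums of contributions of paths for the edges of `F`; hence every `f` lies on some such path. -/
theorem covers_of_mem_openCone (hind : EdgeIndependent E) {v : Vertex n → ℤ}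
    (hvF : v ∈ openCone F) (hvE : v ∈ openCone E) : ∀ f ∈ E, ∃ e ∈ F, Covers G e f := by
  obtain ⟨a, ha, rfl⟩ := hvF
  obtain ⟨b, hb, hab⟩ := hvE
  obtain ⟨p, hp, h1, h2⟩ := exists_path_flow hE hF a ha
  have hbp := hind.eq hb.2 h2 (hab.trans h1.symm)
  intro f hf
  have hpos := hb.1 f hf
  rw [hbp, Finset.sum_apply] at hpos
  obtain ⟨e, he, hne⟩ := Finset.exists_ne_zero_of_sum_ne_zero hpos.ne'
  refine ⟨e, he, (hp e he).2.2 f fun h => hne ?_⟩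
  simp [h]

/-- Path contributions are nonnegative. By independence the path weighting chosen for `e` agrees
with the one routed through `f`, so the coefficient at `f` is positive. -/
theorem openCone_subset_of_covers (hind : EdgeIndependent E)
    (hcov : ∀ f ∈ E, ∃ e ∈ F, Covers G e f) : openCone F ⊆ openCone E := by
  rintro _ ⟨a, ha, rfl⟩
  obtain ⟨p, hp, h1, h2⟩ := exists_path_flow hE hF a ha
  refine ⟨_, ⟨fun f hf => ?_, h2⟩, h1⟩
  obtain ⟨e, he, hc⟩ := hcov f hf
  obtain ⟨c, hc1, hc2, hc3⟩ := hc.exists_flow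
  have hcp : c = p e := hind.eq
    (fun g hg => by
      by_contra h
      exact hg ((hE g).mpr (hc2 g h)))
    (fun g hg => by
      by_contra h
      exact hg ((hE g).mpr ((hp e he).2.2 g h).2.1)) (hc1.trans (hp e he).2.1.symm)
  rw [Finset.sum_apply]
  refine Finset.sum_pos' (fun g hg => ?_) ⟨e, he, ?_⟩
  · exact mul_nonneg (ha.nonneg g) ((hp g hg).1 f)
  · exact mul_pos (ha.1 e he) (hcp ▸ hc3)

end Cone

/-! ### Noncrossing trees on intervals -/

theorem exists_boundary_of_reachable {V : Type*} {G : SimpleGraph V} {u v : V}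
    (h : G.Reachable u v) (S : V → Prop) (hu : S u) (hv : ¬ S v) :
    ∃ y z, G.Reachable u y ∧ G.Adj y z ∧ S y ∧ ¬ S z := by
  obtain ⟨p⟩ := h
  obtain ⟨d, -, h1, h2⟩ := p.exists_boundary_dart {y | G.Reachable u y ∧ S y} ⟨.rfl, hu⟩
    fun h => hv h.2
  exact ⟨d.fst, d.snd, h1.1, d.adj, h1.2, fun h => h2 ⟨h1.1.trans d.adj.reachable, h⟩⟩

/-- The connected components of a noncrossing graph form a noncrossing partition. -/
theorem Noncrossing.reachable {G : SimpleGraph (Vertex n)} (hG : Noncrossing G)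
    {a b c d : Vertex n} (hab : a < b) (hbc : b < c) (hcd : c < d) (hac : G.Reachable a c)
    (hbd : G.Reachable b d) : G.Reachable a b := by
  by_contra hne
  have hne' : ∀ y, G.Reachable a y → ¬ G.Reachable b y := fun y h h' => hne (h.trans h'.symm)
  obtain ⟨u, w, hu, huw, hu', hw'⟩ := exists_boundary_of_reachable hac
    (fun y => ¬ (b < y ∧ y < d)) (fun h => h.1.not_gt hab) (fun h => h ⟨hbc, hcd⟩)
  have hw := hu.trans huw.reachable
  have hub : u ≠ b := fun h => hne' u hu (h ▸ .rfl)
  have hud : u ≠ d := fun h => hne' u hu (h ▸ hbd)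
  rw [not_not] at hw'
  have huo : u < b ∨ d < u := by
    rcases lt_or_gt_of_ne hub with h | h
    · exact .inl h
    · exact .inr (lt_of_le_of_ne (not_lt.mp fun h' => hu' ⟨h, h'⟩) hud.symm)
  rcases huo with huo | huo
  · obtain ⟨y, z, hy, hyz, hy', hz'⟩ := exists_boundary_of_reachable hbd
      (fun y => u < y ∧ y < w) ⟨huo, hw'.1⟩ (fun h => h.2.not_gt hw'.2)
    have hz := hy.trans hyz.reachable
    have hzu : z ≠ u := fun h => hne' u hu (h ▸ hz)
    have hzw : z ≠ w := fun h => hne' w hw (h ▸ hz)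
    rcases lt_or_gt_of_ne hzu with h | h
    · exact hG z u y w h hy'.1 hy'.2 ⟨hyz.symm, huw⟩
    · have : w < z := lt_of_le_of_ne (not_lt.mp fun h' => hz' ⟨h, h'⟩) hzw.symm
      exact hG u y w z hy'.1 hy'.2 this ⟨huw, hyz⟩
  · obtain ⟨y, z, hy, hyz, hy', hz'⟩ := exists_boundary_of_reachable hbd
      (fun y => ¬ (w < y ∧ y < u)) (fun h => h.1.not_gt hw'.1) (fun h => h ⟨hw'.2, huo⟩)
    rw [not_not] at hz'
    have hyu : y ≠ u := fun h => hne' u hu (h ▸ hy)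
    have hyw : y ≠ w := fun h => hne' w hw (h ▸ hy)
    rcases lt_or_gt_of_ne hyw with h | h
    · exact hG y w z u h hz'.1 hz'.2 ⟨hyz, huw.symm⟩
    · have : u < y := lt_of_le_of_ne (not_lt.mp fun h' => hy' ⟨h, h'⟩) hyu.symm
      exact hG w z u y hz'.1 hz'.2 this ⟨huw.symm, hyz.symm⟩

/-- `H` is a noncrossing tree with vertex set `{a, a + 1, …, b}`. -/
structure IntervalTree (H : SimpleGraph (Vertex n)) (a b : Vertex n) : Prop where
  lt : a < b
  noncrossing : Noncrossing H
  acyclic : H.IsAcyclic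
  support : ∀ x, x ∈ H.support ↔ a ≤ x ∧ x ≤ b
  reach : ∀ x, a ≤ x → x ≤ b → H.Reachable a x

theorem IntervalTree.eq_of_isMainPath {H P : SimpleGraph (Vertex n)} {a b i j : Vertex n}
    (hH : IntervalTree H a b) (hP : IsMainPath H P i j) : i = a ∧ j = b := by
  have ha : a ∈ H.support := (hH.support a).mpr ⟨le_rfl, hH.lt.le⟩
  have hb : b ∈ H.support := (hH.support b).mpr ⟨hH.lt.le, le_rfl⟩
  exact ⟨le_antisymm (hP.1.2 ha) ((hH.support i).mp hP.1.1).1,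
    le_antisymm ((hH.support j).mp hP.2.1.1).2 (hP.2.1.2 hb)⟩

/-! ### The main path -/

/-- A trail uses each edge once, so the parts before and after a given edge avoid it. -/
theorem reachable_of_mem_darts {V : Type*} {G : SimpleGraph V} {u v : V} (p : G.Walk u v)
    (hp : p.IsTrail) (d : G.Dart) (hd : d ∈ p.darts) :
    (G.deleteEdges {s(d.fst, d.snd)}).Reachable u d.fst ∧
      (G.deleteEdges {s(d.fst, d.snd)}).Reachable d.snd v := by
  induction p with
  | nil => simp at hd
  | @cons u w v h p ih =>
    rw [SimpleGraph.Walk.isTrail_cons] at hp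
    rw [SimpleGraph.Walk.darts_cons, List.mem_cons] at hd
    rcases hd with rfl | hd
    · refine ⟨.rfl, ?_⟩
      rw [SimpleGraph.reachable_deleteEdges_iff_exists_walk]
      exact ⟨p, hp.2⟩
    · obtain ⟨h1, h2⟩ := ih hp.1 hd
      refine ⟨SimpleGraph.Reachable.trans (SimpleGraph.Adj.reachable ?_) h1, h2⟩
      rw [SimpleGraph.deleteEdges_adj, Set.mem_singleton_iff]
      refine ⟨h, fun heq => hp.2 ?_⟩
      rw [heq]
      exact List.mem_map_of_mem hd

theorem reflTransGen_of_mem_darts {V : Type*} {G : SimpleGraph V} {r : V → V → Prop} {u v : V}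
    (p : G.Walk u v) (hp : ∀ d ∈ p.darts, r d.fst d.snd) :
    Relation.ReflTransGen r u v ∧ ∀ d ∈ p.darts,
      Relation.ReflTransGen r u d.fst ∧ Relation.ReflTransGen r d.snd v := by
  induction p with
  | nil => exact ⟨.refl, by simp⟩
  | @cons u w v h p ih =>
    rw [SimpleGraph.Walk.darts_cons, List.forall_mem_cons] at hp
    obtain ⟨h1, h2⟩ := ih hp.2
    refine ⟨.head hp.1 h1, ?_⟩
    rw [SimpleGraph.Walk.darts_cons, List.forall_mem_cons]
    exact ⟨⟨.refl, h1⟩, fun d hd => ⟨.head hp.1 (h2 d hd).1, (h2 d hd).2⟩⟩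

theorem Noncrossing.anti {G G' : SimpleGraph (Vertex n)} (h : G ≤ G') (hG : Noncrossing G') :
    Noncrossing G :=
  fun i j k l hij hjk hkl h' => hG i j k l hij hjk hkl ⟨h h'.1, h h'.2⟩

section MainPath

variable {H P : SimpleGraph (Vertex n)} {a b : Vertex n} (hH : IntervalTree H a b)
  (hP : IsMainPath H P a b)
include hH hP

/-- The main path is increasing, and without one of its edges it is separated. -/
theorem IntervalTree.mainPath_spec : Relation.ReflTransGen (Up H) a b ∧
    ∀ p q, p < q → P.Adj p q →
      (Relation.ReflTransGen (Up H) a p ∧ Relation.ReflTransGen (Up H) q b) ∧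
      (H.deleteEdges {s(p, q)}).Reachable a p ∧ (H.deleteEdges {s(p, q)}).Reachable q b ∧
      ¬ (H.deleteEdges {s(p, q)}).Reachable p q := by
  obtain ⟨ha, hb, hPH, W, hW, hWP⟩ := hP
  have hreach : ∀ d ∈ W.darts, (H.deleteEdges {s(d.fst, d.snd)}).Reachable a d.fst ∧
      (H.deleteEdges {s(d.fst, d.snd)}).Reachable d.snd b := fun d hd => by
    have h := reachable_of_mem_darts W hW.isTrail d hd
    have hle : P.deleteEdges {s(d.fst, d.snd)} ≤ H.deleteEdges {s(d.fst, d.snd)} :=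
      SimpleGraph.deleteEdges_mono hPH
    exact ⟨h.1.mono hle, h.2.mono hle⟩
  have hbridge : ∀ x y, P.Adj x y → ¬ (H.deleteEdges {s(x, y)}).Reachable x y := fun x y h =>
    SimpleGraph.isBridge_iff.mp (SimpleGraph.isAcyclic_iff_forall_adj_isBridge.mp hH.acyclic (hPH h))
  have hup : ∀ d ∈ W.darts, Up H d.fst d.snd := by
    intro d hd
    refine ⟨?_, hPH d.adj⟩
    -- For a decreasing step, the initial part joins `a` to `d.fst` and the final part joins `d.snd`
    -- to `b` without the deleted edge, with a < d.snd < d.fst < b. Noncrossing components then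
    -- merge, although the deleted edge is a bridge.
    by_contra! hle
    have hlt := lt_of_le_of_ne hle d.adj.ne'
    obtain ⟨h1, h2⟩ := hreach d hd
    have hbr := hbridge _ _ d.adj
    have hs := ((hH.support d.snd).mp ⟨_, (hPH d.adj).symm⟩).1
    have hf := ((hH.support d.fst).mp ⟨_, hPH d.adj⟩).2
    have has : a < d.snd := lt_of_le_of_ne hs fun h => hbr (h ▸ h1.symm)
    have hfb : d.fst < b := lt_of_le_of_ne hf fun h => hbr (h ▸ h2.symm)
    have hnc := hH.noncrossing.anti (SimpleGraph.deleteEdges_le {s(d.fst, d.snd)})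
    exact hbr (h1.symm.trans (hnc.reachable has hlt hfb h1 h2))
  obtain ⟨hab, hinc⟩ := reflTransGen_of_mem_darts W hup
  refine ⟨hab, fun p q hpq h => ?_⟩
  have hmem : s(p, q) ∈ W.edges := by
    rw [← SimpleGraph.Walk.adj_toSubgraph_iff_mem_edges, ← SimpleGraph.Subgraph.spanningCoe_adj,
      hWP]
    exact h
  obtain ⟨d, hd, hdpq⟩ := List.mem_map.mp hmem
  have hd' : d.fst = p ∧ d.snd = q := by
    have : s(d.fst, d.snd) = s(p, q) := hdpq
    rw [Sym2.eq_iff] at this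
    refine this.resolve_right fun h' => ?_
    have := (hup d hd).1
    rw [h'.1, h'.2] at this
    exact this.not_gt hpq
  obtain ⟨rfl, rfl⟩ := hd'
  exact ⟨hinc d hd, (hreach d hd).1, (hreach d hd).2, hbridge _ _ h⟩

omit hH in
theorem IsMainPath.exists_edge {x : Vertex n} (hx : a ≤ x) (hxb : x < b) :
    ∃ p q, P.Adj p q ∧ p ≤ x ∧ x < q := by
  obtain ⟨-, -, -, W, -⟩ := hP
  obtain ⟨p, q, -, h1, h2, h3⟩ := exists_boundary_of_reachable ⟨W⟩ (fun y => y ≤ x) hx hxb.not_ge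
  exact ⟨p, q, h1, h2, not_le.mp h3⟩

/-- Every edge `(p, q)` of the main path is the only edge over some gap `(m, m + 1)`. -/
theorem IntervalTree.exists_cut {p q : Vertex n} (hpq : p < q) (h : P.Adj p q) :
    ∃ m, p ≤ m ∧ m < q ∧ ∀ x y, x ≤ m → m < y → H.Adj x y → x = p ∧ y = q := by
  classical
  obtain ⟨-, hap, hqb, hbr⟩ := (hH.mainPath_spec hP).2 p q hpq h
  set G := H.deleteEdges {s(p, q)} with hG
  have hnc : Noncrossing G := hH.noncrossing.anti (SimpleGraph.deleteEdges_le _)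
  have hadj : ∀ x y, H.Adj x y → G.Adj x y ∨ (x = p ∧ y = q) ∨ (x = q ∧ y = p) := by
    intro x y hxy
    by_cases he : s(x, y) = s(p, q)
    · exact .inr (Sym2.eq_iff.mp he)
    · exact .inl (SimpleGraph.deleteEdges_adj.mpr ⟨hxy, he⟩)
  have hpH := (hH.support p).mp ⟨q, hP.2.2.1 h⟩
  have hqH := (hH.support q).mp ⟨p, (hP.2.2.1 h).symm⟩
  have hsplit : ∀ x, a ≤ x → x ≤ b → G.Reachable p x ∨ G.Reachable q x := by
    intro x hx hxb
    by_contra hcon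
    obtain ⟨y, z, -, hyz, h1, h2⟩ := exists_boundary_of_reachable
      ((hH.reach p hpH.1 hpH.2).symm.trans (hH.reach x hx hxb))
      (fun y => G.Reachable p y ∨ G.Reachable q y) (.inl .rfl) hcon
    rcases hadj y z hyz with h | ⟨rfl, rfl⟩ | ⟨rfl, rfl⟩
    · exact h2 (h1.imp (·.trans h.reachable) (·.trans h.reachable))
    · exact h2 (.inr .rfl)
    · exact h2 (.inl .rfl)
  -- The cut is at the greatest vertex still connected to `p` after deleting (p, q). Noncrossing
  -- components make the side of `p` the whole interval from `a` to `m`, so an edge over the gap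
  -- changes sides and must be (p, q).
  obtain ⟨m, hm, hmax⟩ := (Finset.univ.filter fun x => G.Reachable p x).exists_max_image id
    ⟨p, by simp⟩
  simp only [Finset.mem_filter, Finset.mem_univ, true_and, id] at hm hmax
  have hbm : b ≠ m := fun h => hbr (hm.trans (h ▸ hqb.symm))
  have hmq : m < q := by
    by_contra! hle
    have hqm : q < m := lt_of_le_of_ne hle fun h => hbr (h ▸ hm)
    have hmb : m < b := by
      have : m ∈ H.support := by
        refine SimpleGraph.mem_support_of_reachable (hpq.trans hqm).ne' ?_
        exact hm.symm.mono (SimpleGraph.deleteEdges_le _)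
      exact lt_of_le_of_ne ((hH.support m).mp this).2 hbm.symm
    exact hbr (hap.symm.trans (hnc.reachable (hpH.1.trans_lt hpq) hqm hmb (hap.trans hm) hqb))
  have hleft : ∀ x, a ≤ x → x ≤ m → G.Reachable p x := by
    intro x hx hxm
    refine (hsplit x hx (hxm.trans (hmq.le.trans hqH.2))).resolve_right fun hqx => ?_
    have hax : a < x := lt_of_le_of_ne hx fun h => hbr (hap.symm.trans (h ▸ hqx.symm))
    have hxm' : x < m := lt_of_le_of_ne hxm fun h => hbr (hm.trans (h ▸ hqx.symm))
    exact hbr (hap.symm.trans ((hnc.reachable hax hxm' (hmq.trans_le hqH.2) (hap.trans hm)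
      (hqx.symm.trans hqb)).trans hqx.symm))
  refine ⟨m, hmax p .rfl, hmq, fun x y hxm hmy hxy => ?_⟩
  have hpx := hleft x ((hH.support x).mp ⟨y, hxy⟩).1 hxm
  rcases hadj x y hxy with h | h | ⟨rfl, rfl⟩
  · exact absurd (hmax y (hpx.trans h.reachable)) hmy.not_ge
  · exact h
  · exact absurd hpx hbr

end MainPath

/-! ### Branches -/

/-- The subgraph of `H` with the edges whose endpoints lie in `{c, c + 1, …, d}`. -/
def within (H : SimpleGraph (Vertex n)) (c d : Vertex n) : SimpleGraph (Vertex n) where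
  Adj x y := H.Adj x y ∧ (c ≤ x ∧ x ≤ d) ∧ c ≤ y ∧ y ≤ d
  symm := ⟨fun _ _ h => ⟨h.1.symm, h.2.2, h.2.1⟩⟩
  loopless := ⟨fun _ h => h.1.ne rfl⟩

theorem within_le (H : SimpleGraph (Vertex n)) (c d : Vertex n) : within H c d ≤ H :=
  fun _ _ h => h.1

/-- The interval `{c, c + 1, …, d}` spans a branch of `H` that is attached to the main path `P`
at `v`, one of the ends of the interval. -/
structure IsBranch (H P : SimpleGraph (Vertex n)) (a b c d v : Vertex n) : Prop where
  lt : c < d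
  le_left : a ≤ c
  right_le : d ≤ b
  attached : v = c ∧ d < b ∨ v = d ∧ a < c
  mem_path : v ∈ P.support
  reach : ∀ x, c ≤ x → x ≤ d → (within H c d).Reachable x v
  closed : ∀ x y, c ≤ x → x ≤ d → x ≠ v → H.Adj x y → c ≤ y ∧ y ≤ d
  path : ∀ x y, c ≤ x → x ≤ d → P.Adj x y → x = v ∧ ¬ (c ≤ y ∧ y ≤ d)
  side : ∀ y, (H \ P).Adj v y → (v = c → v < y → y ≤ d) ∧ (v = d → y < v → c ≤ y)

section Branch

variable {H P : SimpleGraph (Vertex n)} {a b : Vertex n} (hH : IntervalTree H a b)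
  (hP : IsMainPath H P a b)
include hH

/-- A walk in `H` from `x` to `v` can leave the interval only at `v`, so it reaches `v` before
leaving. -/
theorem IntervalTree.reach_within {c d v : Vertex n} (hc : a ≤ c) (hd : d ≤ b)
    (hcv : c ≤ v) (hvd : v ≤ d)
    (closed : ∀ x y, c ≤ x → x ≤ d → x ≠ v → H.Adj x y → c ≤ y ∧ y ≤ d)
    (x : Vertex n) (hx : c ≤ x) (hxd : x ≤ d) : (within H c d).Reachable x v := by
  by_contra hcon
  have hxv : H.Reachable x v := (hH.reach x (hc.trans hx) (hxd.trans hd)).symm.trans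
    (hH.reach v (hc.trans hcv) (hvd.trans hd))
  obtain ⟨y, z, -, hyz, h1, h2⟩ := exists_boundary_of_reachable hxv
    (fun y => (c ≤ y ∧ y ≤ d) ∧ (within H c d).Reachable x y) ⟨⟨hx, hxd⟩, .rfl⟩
    (fun h => hcon h.2)
  have hyv : y ≠ v := fun h => hcon (h ▸ h1.2)
  have hz := closed y z h1.1.1 h1.1.2 hyv hyz
  have hadj : (within H c d).Adj y z := ⟨hyz, h1.1, hz⟩
  exact h2 ⟨hz, h1.2.trans hadj.reachable⟩

include hP

/-- Take the path edge (p, q) over `x` and its cut `m`. No other edge passes over the cut, so (x, y)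
lies either in [p, m], a branch attached at `p`, or in [m + 1, q], a branch attached at `q`. -/
theorem IntervalTree.exists_branch {x y : Vertex n} (hxy : x < y) (h : (H \ P).Adj x y) :
    ∃ c d v, IsBranch H P a b c d v ∧ c ≤ x ∧ y ≤ d := by
  rw [SimpleGraph.sdiff_adj] at h
  have hx := (hH.support x).mp ⟨y, h.1⟩
  have hy := (hH.support y).mp ⟨x, h.1.symm⟩
  obtain ⟨p, q, hpq, hpx, hxq⟩ := hP.exists_edge hx.1 (hxy.trans_le hy.2)
  have hlt := hpx.trans_lt hxq
  have hPH := hP.2.2.1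
  obtain ⟨m, hpm, hmq, hcut⟩ := hH.exists_cut hP hlt hpq
  have hpa := (hH.support p).mp ⟨q, hPH hpq⟩
  have hqb := (hH.support q).mp ⟨p, (hPH hpq).symm⟩
  -- Two distinct path edges do not cross, and neither passes over the cut of the other, so they are
  -- not nested either.
  have hside : ∀ s t, s < t → P.Adj s t → t ≤ p ∨ q ≤ s ∨ (s = p ∧ t = q) := by
    intro s t hst hadj
    obtain ⟨m', hsm, hmt, hcut'⟩ := hH.exists_cut hP hst hadj
    by_contra! hcon
    obtain ⟨h1, h2, h3⟩ := hcon
    by_cases h4 : s ≤ m ∧ m < t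
    · obtain ⟨rfl, rfl⟩ := hcut s t h4.1 h4.2 (hPH hadj)
      exact h3 rfl rfl
    by_cases h5 : p ≤ m' ∧ m' < q
    · obtain ⟨rfl, rfl⟩ := hcut' p q h5.1 h5.2 (hPH hpq)
      exact h3 rfl rfl
    have hnc1 : ¬ (s < p ∧ t < q) := fun h' =>
      hH.noncrossing s p t q h'.1 h1 h'.2 ⟨hPH hadj, hPH hpq⟩
    have hnc2 : ¬ (p < s ∧ q < t) := fun h' =>
      hH.noncrossing p s q t h'.1 h2 h'.2 ⟨hPH hpq, hPH hadj⟩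
    simp only [Fin.lt_def, Fin.le_def] at *
    omega
  have hno : ∀ s t, P.Adj s t → (p ≤ s ∧ s < q ∧ p ≤ t ∧ t < q) ∨
      (p < s ∧ s ≤ q ∧ p < t ∧ t ≤ q) → False := by
    intro s t hadj hst
    rcases hadj.ne.lt_or_gt with hlt' | hlt'
    · have := hside s t hlt' hadj
      simp only [Fin.lt_def, Fin.le_def, Fin.ext_iff] at *
      omega
    · have := hside t s hlt' hadj.symm
      simp only [Fin.lt_def, Fin.le_def, Fin.ext_iff] at *
      omega
  by_cases hym : y ≤ m
  · have closed : ∀ s t, p ≤ s → s ≤ m → s ≠ p → H.Adj s t → p ≤ t ∧ t ≤ m := by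
      intro s t hps hsm hne hst
      have hps' := lt_of_le_of_ne hps hne.symm
      refine ⟨not_lt.mp fun htp => ?_, not_lt.mp fun hmt => ?_⟩
      · exact hH.noncrossing t p s q htp hps' (hsm.trans_lt hmq) ⟨hst.symm, hPH hpq⟩
      · exact hne (hcut s t hsm hmt hst).1
    refine ⟨p, m, p, ⟨(hpx.trans_lt hxy).trans_le hym, hpa.1, (hmq.le.trans hqb.2),
      .inl ⟨rfl, hmq.trans_le hqb.2⟩, ⟨q, hpq⟩,
      hH.reach_within hpa.1 (hmq.le.trans hqb.2) le_rfl hpm closed, closed, ?_, ?_⟩, hpx, hym⟩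
    · intro s t hps hsm hst
      have hnot : ¬ (p ≤ t ∧ t ≤ m) := fun ht =>
        hno s t hst (.inl ⟨hps, hsm.trans_lt hmq, ht.1, ht.2.trans_lt hmq⟩)
      refine ⟨?_, hnot⟩
      by_contra hne
      exact hnot (closed s t hps hsm hne (hPH hst))
    · intro t ht
      rw [SimpleGraph.sdiff_adj] at ht
      refine ⟨fun _ hpt => not_lt.mp fun hmt => ?_, fun hp htp => ?_⟩
      · obtain ⟨-, rfl⟩ := hcut p t hpm hmt ht.1
        exact ht.2 hpq
      · exact absurd hp ((hpx.trans_lt hxy).trans_le hym).ne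
  · have hmx : m < x := by
      by_contra! hxm
      obtain ⟨rfl, rfl⟩ := hcut x y hxm (not_le.mp hym) h.1
      exact h.2 hpq
    have hyq : y ≤ q := not_lt.mp fun hqy =>
      hH.noncrossing p x q y (hpm.trans_lt hmx) hxq hqy ⟨hPH hpq, h.1⟩
    have hm1 : (m : ℕ) + 1 < n + 1 := by
      have := q.isLt
      simp only [Fin.lt_def] at hmq
      omega
    obtain ⟨c, hc⟩ : ∃ c : Vertex n, ∀ z : Vertex n, c ≤ z ↔ m < z :=
      ⟨⟨m + 1, hm1⟩, fun z => by simp only [Fin.le_def, Fin.lt_def]; omega⟩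
    have hpc : p < c := hpm.trans_lt ((hc c).mp le_rfl)
    have closed : ∀ s t, c ≤ s → s ≤ q → s ≠ q → H.Adj s t → c ≤ t ∧ t ≤ q := by
      intro s t hcs hsq hne hst
      have hsq' := lt_of_le_of_ne hsq hne
      refine ⟨(hc t).mpr (not_le.mp fun htm => ?_), not_lt.mp fun hqt => ?_⟩
      · exact hne (hcut t s htm ((hc s).mp hcs) hst.symm).2
      · exact hH.noncrossing p s q t (hpc.trans_le hcs) hsq' hqt ⟨hPH hpq, hst⟩
    have hcx := (hc x).mpr hmx
    have hcq := (hc q).mpr hmq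
    have hac := hpa.1.trans_lt hpc
    refine ⟨c, q, q, ⟨(hcx.trans_lt hxy).trans_le hyq, hac.le, hqb.2,
      .inr ⟨rfl, hac⟩, ⟨p, hpq.symm⟩,
      hH.reach_within hac.le hqb.2 hcq le_rfl closed, closed, ?_, ?_⟩, hcx, hyq⟩
    · intro s t hcs hsq hst
      have hnot : ¬ (c ≤ t ∧ t ≤ q) := fun ht =>
        hno s t hst (.inr ⟨hpc.trans_le hcs, hsq, hpc.trans_le ht.1, ht.2⟩)
      refine ⟨?_, hnot⟩
      by_contra hne
      exact hnot (closed s t hcs hsq hne (hPH hst))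
    · intro t ht
      rw [SimpleGraph.sdiff_adj] at ht
      refine ⟨fun hp htp => ?_, fun _ htq => (hc t).mpr (not_le.mp fun htm => ?_)⟩
      · exact absurd hp.symm ((hcx.trans_lt hxy).trans_le hyq).ne
      · obtain ⟨rfl, -⟩ := hcut t q htm hmq ht.1.symm
        exact ht.2 hpq.symm

omit hP in
theorem IsBranch.intervalTree {c d v : Vertex n} (hB : IsBranch H P a b c d v) :
    IntervalTree (within H c d) c d where
  lt := hB.lt
  noncrossing := hH.noncrossing.anti (within_le H c d)
  acyclic := hH.acyclic.anti (within_le H c d)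
  support x := by
    constructor
    · rintro ⟨y, h⟩
      exact h.2.1
    · intro hx
      have hc := hB.reach c le_rfl hB.lt.le
      have hd := hB.reach d hB.lt.le le_rfl
      have hxv := hB.reach x hx.1 hx.2
      by_cases hxc : x = c
      · exact SimpleGraph.mem_support_of_reachable (hxc.trans_ne hB.lt.ne) (hxv.trans hd.symm)
      · exact SimpleGraph.mem_support_of_reachable hxc (hxv.trans hc.symm)
  reach x hc hd := (hB.reach c le_rfl hB.lt.le).trans (hB.reach x hc hd).symm

end Branch

/-! ### Trees and their supports -/

theorem isTreeOnSupport_of_reachable {K : SimpleGraph (Vertex n)} (hne : K.support.Nonempty)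
    (hK : K.IsAcyclic) (hr : ∀ x ∈ K.support, ∀ y ∈ K.support, K.Reachable x y) :
    IsTreeOnSupport K := by
  have hlift : ∀ (x y : Vertex n) (p : K.Walk x y) (hx : x ∈ K.support) (hy : y ∈ K.support),
      (K.induce K.support).Reachable ⟨x, hx⟩ ⟨y, hy⟩ := by
    intro x y p
    induction p with
    | nil => exact fun _ _ => .rfl
    | @cons u v w h p ih =>
      intro hu hw
      have hv : v ∈ K.support := ⟨u, h.symm⟩
      have hadj : (K.induce K.support).Adj ⟨u, hu⟩ ⟨v, hv⟩ := h
      exact hadj.reachable.trans (ih hv hw)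
  refine ⟨?_, hK.induce _⟩
  have : Nonempty K.support := hne.to_subtype
  refine ⟨fun x y => ?_⟩
  obtain ⟨p⟩ := hr x x.2 y y.2
  exact hlift _ _ p x.2 y.2

theorem IsTreeOnSupport.reachable {K : SimpleGraph (Vertex n)} (hK : IsTreeOnSupport K)
    {x y : Vertex n} (hx : x ∈ K.support) (hy : y ∈ K.support) : K.Reachable x y :=
  (hK.connected.preconnected ⟨x, hx⟩ ⟨y, hy⟩).map
    (SimpleGraph.Embedding.induce K.support).toHom

theorem IsTreeOnSupport.exists_adj {K : SimpleGraph (Vertex n)} (hK : IsTreeOnSupport K) :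
    ∃ x y, x < y ∧ K.Adj x y := by
  obtain ⟨x, y, h⟩ := hK.connected.nonempty
  rcases h.ne.lt_or_gt with hlt | hlt
  · exact ⟨x, y, hlt, h⟩
  · exact ⟨y, x, hlt, h.symm⟩

theorem IntervalTree.isTreeOnSupport {H : SimpleGraph (Vertex n)} {a b : Vertex n}
    (hH : IntervalTree H a b) : IsTreeOnSupport H := by
  refine isTreeOnSupport_of_reachable ⟨a, (hH.support a).mpr ⟨le_rfl, hH.lt.le⟩⟩ hH.acyclic ?_
  intro x hx y hy
  rw [hH.support] at hx hy
  exact (hH.reach x hx.1 hx.2).symm.trans (hH.reach y hy.1 hy.2)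

theorem edge_adj_iff {x y s t : Vertex n} (hxy : x ≠ y) :
    (SimpleGraph.edge x y).Adj s t ↔ (s = x ∧ t = y) ∨ (s = y ∧ t = x) := by
  rw [SimpleGraph.edge_adj]
  refine ⟨fun h => ?_, fun h => ⟨?_, ?_⟩⟩
  · simpa using h.1
  · simpa using h
  · rcases h with ⟨rfl, rfl⟩ | ⟨rfl, rfl⟩
    · exact hxy
    · exact hxy.symm

theorem support_edge {x y s : Vertex n} (hxy : x ≠ y) :
    s ∈ (SimpleGraph.edge x y).support ↔ s = x ∨ s = y := by
  simp only [SimpleGraph.mem_support, edge_adj_iff hxy]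
  constructor
  · rintro ⟨t, h | h⟩
    · exact .inl h.1
    · exact .inr h.1
  · rintro (rfl | rfl)
    · exact ⟨y, .inl ⟨rfl, rfl⟩⟩
    · exact ⟨x, .inr ⟨rfl, rfl⟩⟩

/-! ### Minimal decompositions -/

theorem disjoint_edgeSet {K K' : SimpleGraph (Vertex n)} :
    Disjoint K.edgeSet K'.edgeSet ↔ ∀ x y, K.Adj x y → ¬ K'.Adj x y := by
  rw [Set.disjoint_left]
  exact ⟨fun h x y => @h s(x, y), fun h e => Sym2.ind h e⟩

/-- Single edges form a decomposition, since both ends of an edge are extremal. This is needed only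
so that a minimum exists. -/
theorem exists_isDecomposition {H P : SimpleGraph (Vertex n)} (hH : H.IsAcyclic) :
    ∃ D, IsDecomposition H P D := by
  classical
  refine ⟨(Finset.univ.filter fun e : Vertex n × Vertex n => e.1 < e.2 ∧ (H \ P).Adj e.1 e.2).image
    fun e => SimpleGraph.edge e.1 e.2, ?_, ?_, ?_, ?_⟩
  · intro K hK
    simp only [Finset.mem_image, Finset.mem_filter, Finset.mem_univ, true_and, Prod.exists] at hK
    obtain ⟨x, y, ⟨hxy, h⟩, rfl⟩ := hK
    have hle : SimpleGraph.edge x y ≤ H := by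
      intro s t hst
      rw [edge_adj_iff hxy.ne] at hst
      rcases hst with ⟨rfl, rfl⟩ | ⟨rfl, rfl⟩
      · exact h.1
      · exact h.1.symm
    have hadj : (SimpleGraph.edge x y).Adj x y := (edge_adj_iff hxy.ne).mpr (.inl ⟨rfl, rfl⟩)
    refine isTreeOnSupport_of_reachable ⟨x, y, hadj⟩ (hH.anti hle) ?_
    intro s hs t ht
    rw [support_edge hxy.ne] at hs ht
    rcases hs with rfl | rfl <;> rcases ht with rfl | rfl
    · exact .rfl
    · exact hadj.reachable
    · exact hadj.symm.reachable
    · exact .rfl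
  · intro K hK K' hK' hne
    simp only [Finset.mem_image, Finset.mem_filter, Finset.mem_univ, true_and, Prod.exists]
      at hK hK'
    obtain ⟨x, y, ⟨hxy, -⟩, rfl⟩ := hK
    obtain ⟨x', y', ⟨hxy', -⟩, rfl⟩ := hK'
    rw [disjoint_edgeSet]
    intro s t h h'
    rw [edge_adj_iff hxy.ne] at h
    rw [edge_adj_iff hxy'.ne] at h'
    rcases h with ⟨rfl, rfl⟩ | ⟨rfl, rfl⟩ <;> rcases h' with ⟨rfl, rfl⟩ | ⟨rfl, rfl⟩
    · exact hne rfl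
    · exact hxy.not_gt hxy'
    · exact hxy.not_gt hxy'
    · exact hne rfl
  · ext s t
    simp only [SimpleGraph.sSup_adj, Finset.coe_image, Finset.coe_filter, Finset.mem_univ, true_and,
      Set.mem_image, Set.mem_ofPred_eq, Prod.exists]
    constructor
    · rintro ⟨_, ⟨x, y, ⟨hxy, h⟩, rfl⟩, hst⟩
      rw [edge_adj_iff hxy.ne] at hst
      rcases hst with ⟨rfl, rfl⟩ | ⟨rfl, rfl⟩
      · exact h
      · exact h.symm
    · intro h
      rcases h.ne.lt_or_gt with hlt | hlt
      · exact ⟨_, ⟨s, t, ⟨hlt, h⟩, rfl⟩, (edge_adj_iff hlt.ne).mpr (.inl ⟨rfl, rfl⟩)⟩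
      · exact ⟨_, ⟨t, s, ⟨hlt, h.symm⟩, rfl⟩, (edge_adj_iff hlt.ne).mpr (.inr ⟨rfl, rfl⟩)⟩
  · intro K hK v _ hv
    simp only [Finset.mem_image, Finset.mem_filter, Finset.mem_univ, true_and, Prod.exists] at hK
    obtain ⟨x, y, ⟨hxy, -⟩, rfl⟩ := hK
    rw [support_edge hxy.ne] at hv
    rcases hv with rfl | rfl
    · refine .inl ⟨(support_edge hxy.ne).mpr (.inl rfl), fun z hz => ?_⟩
      rcases (support_edge hxy.ne).mp hz with rfl | rfl
      · exact le_rfl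
      · exact hxy.le
    · refine .inr ⟨(support_edge hxy.ne).mpr (.inr rfl), fun z hz => ?_⟩
      rcases (support_edge hxy.ne).mp hz with rfl | rfl
      · exact hxy.le
      · exact le_rfl

theorem exists_isMinDecomposition {H P : SimpleGraph (Vertex n)} (hH : H.IsAcyclic) :
    ∃ D, IsMinDecomposition H P D := by
  classical
  have hex : ∃ k D, IsDecomposition H P D ∧ D.card = k := by
    obtain ⟨D, hD⟩ := exists_isDecomposition (P := P) hH
    exact ⟨_, D, hD, rfl⟩
  obtain ⟨D, hD, hc⟩ := Nat.find_spec hex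
  exact ⟨D, hD, fun D' hD' => hc ▸ Nat.find_min' hex ⟨D', hD', rfl⟩⟩

section MinDecomposition

variable {H P : SimpleGraph (Vertex n)} {a b : Vertex n} (hH : IntervalTree H a b)
  {D : Finset (SimpleGraph (Vertex n))}

theorem IsDecomposition.le_sdiff (hD : IsDecomposition H P D) {K : SimpleGraph (Vertex n)}
    (hK : K ∈ D) : K ≤ H \ P := by
  rw [← hD.union]
  exact le_sSup hK

/-- A tree of a decomposition is contained in a branch or has no edge in it. -/
theorem IsBranch.le_or_disjoint {c d v : Vertex n} (hB : IsBranch H P a b c d v)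
    (hD : IsDecomposition H P D) {K : SimpleGraph (Vertex n)} (hK : K ∈ D) :
    K ≤ within H c d ∨ ∀ x y, K.Adj x y → ¬ (within H c d).Adj x y := by
  have hKHP := hD.le_sdiff hK
  have hKH : K ≤ H := hKHP.trans sdiff_le
  rw [or_iff_not_imp_right]
  intro hmeet
  push Not at hmeet
  obtain ⟨x, y, hxy, hw⟩ := hmeet
  obtain ⟨u, hu, huv, huK⟩ : ∃ u, (c ≤ u ∧ u ≤ d) ∧ u ≠ v ∧ u ∈ K.support := by
    by_cases hxv : x = v
    · exact ⟨y, hw.2.2, fun h => hxy.ne (hxv.trans h.symm), x, hxy.symm⟩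
    · exact ⟨x, hw.2.1, hxv, y, hxy⟩
  -- `K` could leave the interval only through `v`. There `v` is extremal in `K`, and the vertex `u`
  -- determines which extreme it is, so `side` keeps the next vertex in the interval.
  have hsupp : ∀ z ∈ K.support, c ≤ z ∧ z ≤ d := by
    intro z hz
    by_contra hout
    obtain ⟨s, t, -, hst, h1, h2⟩ := exists_boundary_of_reachable
      ((hD.isTree K hK).reachable huK hz) (fun z => c ≤ z ∧ z ≤ d) hu hout
    have hsv : s = v := by
      by_contra hne
      exact h2 (hB.closed s t h1.1 h1.2 hne (hKH hst))
    subst hsv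
    have hside := hB.side t (hKHP hst)
    have hKs : s ∈ K.support := ⟨t, hst⟩
    have hKt : t ∈ K.support := ⟨s, hst.symm⟩
    rcases hD.extremal K hK s hB.mem_path hKs with hext | hext <;>
      rcases hB.attached with ⟨rfl, -⟩ | ⟨rfl, -⟩
    · have := lt_of_le_of_ne (hext.2 hKt) hst.ne
      exact h2 ⟨this.le, hside.1 rfl this⟩
    · exact huv (le_antisymm hu.2 (hext.2 huK))
    · exact huv (le_antisymm (hext.2 huK) hu.1)
    · have := lt_of_le_of_ne (hext.2 hKt) hst.ne'
      exact h2 ⟨hside.2 rfl this, this.le⟩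
  exact fun s t hst => ⟨hKH hst, hsupp s ⟨t, hst⟩, hsupp t ⟨s, hst.symm⟩⟩

include hH

open Classical in
-- Trees contained in a branch may be merged into the whole branch; compared with a minimal
-- decomposition, this leaves at most one tree per branch.
theorem IsBranch.isDecomposition {c d v : Vertex n} (hB : IsBranch H P a b c d v)
    (hD : IsDecomposition H P D) :
    IsDecomposition H P (insert (within H c d) (D.filter fun K => ¬ K ≤ within H c d)) where
  isTree K hK := by
    rw [Finset.mem_insert, Finset.mem_filter] at hK
    rcases hK with rfl | hK
    · exact (hB.intervalTree hH).isTreeOnSupport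
    · exact hD.isTree K hK.1
  edgeDisjoint K hK K' hK' hne := by
    rw [Finset.mem_insert, Finset.mem_filter] at hK hK'
    rcases hK with rfl | hK <;> rcases hK' with rfl | hK'
    · exact absurd rfl hne
    · rw [disjoint_edgeSet]
      exact fun x y h h' => (hB.le_or_disjoint hD hK'.1).resolve_left hK'.2 x y h' h
    · rw [disjoint_edgeSet]
      exact (hB.le_or_disjoint hD hK.1).resolve_left hK.2
    · exact hD.edgeDisjoint K hK.1 K' hK'.1 hne
  union := by
    apply le_antisymm
    · refine sSup_le fun K hK => ?_
      rw [Finset.mem_coe, Finset.mem_insert, Finset.mem_filter] at hK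
      rcases hK with rfl | hK
      · intro x y hxy
        exact ⟨hxy.1, fun h => (hB.path x y hxy.2.1.1 hxy.2.1.2 h).2 hxy.2.2⟩
      · exact hD.le_sdiff hK.1
    · rw [← hD.union]
      refine sSup_le fun K hK => ?_
      by_cases hle : K ≤ within H c d
      · exact hle.trans (le_sSup (by simp))
      · exact le_sSup (by simpa using .inr ⟨hK, hle⟩)
  extremal K hK u hu huK := by
    rw [Finset.mem_insert, Finset.mem_filter] at hK
    rcases hK with rfl | hK
    · have hs := (hB.intervalTree hH).support
      have hu' := (hs u).mp huK
      obtain ⟨t, ht⟩ := hu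
      obtain ⟨rfl, -⟩ := hB.path u t hu'.1 hu'.2 ht
      rcases hB.attached with ⟨rfl, -⟩ | ⟨rfl, -⟩
      · exact .inl ⟨huK, fun z hz => ((hs z).mp hz).1⟩
      · exact .inr ⟨huK, fun z hz => ((hs z).mp hz).2⟩
    · exact hD.extremal K hK.1 u hu huK

/-- The trees of a minimal decomposition are the branches. -/
theorem IsMinDecomposition.exists_branch (hP : IsMainPath H P a b) (hD : IsMinDecomposition H P D)
    {K : SimpleGraph (Vertex n)} (hK : K ∈ D) :
    ∃ c d v, IsBranch H P a b c d v ∧ K = within H c d := by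
  classical
  obtain ⟨x, y, hxy, hadj⟩ := (hD.1.isTree K hK).exists_adj
  obtain ⟨c, d, v, hB, hcx, hyd⟩ := hH.exists_branch hP hxy (hD.1.le_sdiff hK hadj)
  have hmeet : ∀ K' ∈ D, ∀ s t, K'.Adj s t → (within H c d).Adj s t → K' ≤ within H c d :=
    fun K' hK' s t h h' => (hB.le_or_disjoint hD.1 hK').resolve_right fun hd => hd s t h h'
  have hKle : K ≤ within H c d := hmeet K hK x y hadj
    ⟨(hD.1.le_sdiff hK hadj).1, ⟨hcx, (hxy.trans_le hyd).le⟩, (hcx.trans_lt hxy).le, hyd⟩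
  have hcard := hD.2 _ (hB.isDecomposition hH hD.1)
  have hone : (D.filter fun K => K ≤ within H c d).card ≤ 1 := by
    have h1 := Finset.card_insert_le (within H c d) (D.filter fun K => ¬ K ≤ within H c d)
    have h2 := Finset.card_filter_add_card_filter_not (s := D) fun K => K ≤ within H c d
    omega
  refine ⟨c, d, v, hB, le_antisymm hKle fun s t hst => ?_⟩
  have hst' : (H \ P).Adj s t :=
    ⟨hst.1, fun h => (hB.path s t hst.2.1.1 hst.2.1.2 h).2 hst.2.2⟩
  rw [← hD.1.union, SimpleGraph.sSup_adj] at hst'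
  obtain ⟨K', hK', h⟩ := hst'
  have hK'le := hmeet K' hK' s t h hst
  have : K' = K := Finset.card_le_one.mp hone K' (by simpa using ⟨hK', hK'le⟩) K
    (by simpa using ⟨hK, hKle⟩)
  exact this ▸ h

end MinDecomposition

/-! ### Pseudo-components as intervals -/

/-- Edges of `T` leave the interval `{i, i + 1, …, j}` only at its left end, or only at its
right end. -/
def ClosedInterval (T : SimpleGraph (Vertex n)) (i j : Vertex n) : Prop :=
  (∀ x y, i < x → x ≤ j → T.Adj x y → i ≤ y ∧ y ≤ j) ∨
    ∀ x y, i ≤ x → x < j → T.Adj x y → i ≤ y ∧ y ≤ j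

/-- `H` is a tree that occurs in the recursive definition of the pseudo-components of `T`. -/
structure SubIntervalTree (T H : SimpleGraph (Vertex n)) (a b : Vertex n) : Prop where
  tree : IntervalTree H a b
  eq_within : H = within T a b
  closed : ClosedInterval T a b

theorem SubIntervalTree.le {T H : SimpleGraph (Vertex n)} {a b : Vertex n}
    (hH : SubIntervalTree T H a b) : H ≤ T :=
  hH.eq_within ▸ within_le T a b

theorem reflTransGen_up_mono {H T : SimpleGraph (Vertex n)} (hHT : H ≤ T) {x y : Vertex n}
    (h : Relation.ReflTransGen (Up H) x y) : Relation.ReflTransGen (Up T) x y :=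
  h.lift id fun _ _ h => ⟨h.1, hHT h.2⟩

/-- Apart from its attaching vertex, a branch lies strictly between `a` and `b`, so by closedness of
[a, b] the edges of `T` there are edges of `H`, and closedness passes to the branch. The strict
inequality at one end makes recursion on the length possible. -/
theorem SubIntervalTree.sub {T H P K : SimpleGraph (Vertex n)} {a b : Vertex n}
    (hH : SubIntervalTree T H a b) (hP : IsMainPath H P a b)
    {D : Finset (SimpleGraph (Vertex n))} (hD : IsMinDecomposition H P D) (hK : K ∈ D) :
    ∃ c d, SubIntervalTree T K c d ∧ a ≤ c ∧ d ≤ b ∧ (d < b ∨ a < c) := by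
  obtain ⟨c, d, v, hB, rfl⟩ := hD.exists_branch hH.tree hP hK
  have hac := hB.le_left
  have hdb := hB.right_le
  have key : ∀ x y, a < x → x < b → c ≤ x → x ≤ d → x ≠ v → T.Adj x y → c ≤ y ∧ y ≤ d := by
    intro x y hax hxb hcx hxd hxv hxy
    have hy : a ≤ y ∧ y ≤ b := by
      rcases hH.closed with h | h
      · exact h x y hax hxb.le hxy
      · exact h x y hax.le hxb hxy
    refine hB.closed x y hcx hxd hxv ?_
    rw [hH.eq_within]
    exact ⟨hxy, ⟨hax.le, hxb.le⟩, hy⟩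
  refine ⟨c, d, ⟨hB.intervalTree hH.tree, ?_, ?_⟩, hac, hdb,
    hB.attached.imp (fun h => h.2) (fun h => h.2)⟩
  · ext x y
    constructor
    · exact fun h => ⟨hH.le h.1, h.2⟩
    · intro h
      refine ⟨?_, h.2⟩
      rw [hH.eq_within]
      exact ⟨h.1, ⟨hac.trans h.2.1.1, h.2.1.2.trans hdb⟩, hac.trans h.2.2.1, h.2.2.2.trans hdb⟩
  · rcases hB.attached with ⟨rfl, h⟩ | ⟨rfl, h⟩
    · exact .inl fun x y hx hxd hxy =>
        key x y (hac.trans_lt hx) (hxd.trans_lt h) hx.le hxd hx.ne' hxy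
    · exact .inr fun x y hx hxd hxy =>
        key x y (h.trans_le hx) (hxd.trans_le hdb) hx hxd.le hxd.ne hxy

theorem IsPseudoComponent.spec {T H Q : SimpleGraph (Vertex n)} {i j : Vertex n}
    (hQ : IsPseudoComponent H Q i j) : ∀ {a b : Vertex n}, SubIntervalTree T H a b →
      i < j ∧ Relation.ReflTransGen (Up T) i j ∧ ClosedInterval T i j := by
  induction hQ with
  | main H P i j hP =>
    intro a b hH
    obtain ⟨rfl, rfl⟩ := hH.tree.eq_of_isMainPath hP
    exact ⟨hH.tree.lt, reflTransGen_up_mono hH.le (hH.tree.mainPath_spec hP).1, hH.closed⟩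
  | sub H P a' b' hP D hD K hK Q i j _ ih =>
    intro a b hH
    obtain ⟨rfl, rfl⟩ := hH.tree.eq_of_isMainPath hP
    obtain ⟨c, d, hKT, -⟩ := hH.sub hP hD hK
    exact ih hKT

theorem IntervalTree.exists_isMainPath {H : SimpleGraph (Vertex n)} {a b : Vertex n}
    (hH : IntervalTree H a b) : ∃ P, IsMainPath H P a b := by
  obtain ⟨p, hp⟩ := (hH.reach b hH.lt.le le_rfl).exists_isPath
  have hadj : ∀ x y, p.toSubgraph.spanningCoe.Adj x y ↔ s(x, y) ∈ p.edges := fun x y => by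
    rw [SimpleGraph.Subgraph.spanningCoe_adj, SimpleGraph.Walk.adj_toSubgraph_iff_mem_edges]
  have htr : ∀ e ∈ p.edges, e ∈ p.toSubgraph.spanningCoe.edgeSet := fun e =>
    Sym2.ind (fun x y h => (hadj x y).mpr h) e
  refine ⟨p.toSubgraph.spanningCoe, ⟨(hH.support a).mpr ⟨le_rfl, hH.lt.le⟩,
    fun x hx => ((hH.support x).mp hx).1⟩, ⟨(hH.support b).mpr ⟨hH.lt.le, le_rfl⟩,
    fun x hx => ((hH.support x).mp hx).2⟩, p.toSubgraph.spanningCoe_le,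
    p.transfer _ htr, hp.transfer htr, ?_⟩
  ext x y
  rw [SimpleGraph.Subgraph.spanningCoe_adj, SimpleGraph.Walk.adj_toSubgraph_iff_mem_edges,
    SimpleGraph.Walk.edges_transfer, hadj]

/-- Each edge lies on the main path or in a tree of a minimal decomposition, and the latter spans a
shorter interval. The main path reached in the end is increasing, hence leads up to `x` and on from
`y`. -/
theorem SubIntervalTree.exists_pseudoComponent {T H : SimpleGraph (Vertex n)} {a b : Vertex n}
    (hH : SubIntervalTree T H a b) {x y : Vertex n} (hxy : x < y) (h : H.Adj x y) :
    ∃ Q i j, IsPseudoComponent H Q i j ∧ Relation.ReflTransGen (Up T) i x ∧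
      Relation.ReflTransGen (Up T) y j := by
  induction hm : (b : ℕ) - a using Nat.strong_induction_on generalizing H a b with
  | _ m ih =>
  obtain ⟨P, hP⟩ := hH.tree.exists_isMainPath
  by_cases hxyP : P.Adj x y
  · obtain ⟨h1, h2⟩ := ((hH.tree.mainPath_spec hP).2 x y hxy hxyP).1
    exact ⟨P, a, b, .main H P a b hP, reflTransGen_up_mono hH.le h1,
      reflTransGen_up_mono hH.le h2⟩
  · obtain ⟨D, hD⟩ := exists_isMinDecomposition (P := P) hH.tree.acyclic
    have hadj : (H \ P).Adj x y := ⟨h, hxyP⟩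
    rw [← hD.1.union, SimpleGraph.sSup_adj] at hadj
    obtain ⟨K, hK, hKxy⟩ := hadj
    obtain ⟨c, d, hKT, hac, hdb, hlt⟩ := hH.sub hP hD hK
    have hcd := hKT.tree.lt
    obtain ⟨Q, i, j, hQ, h1, h2⟩ := ih ((d : ℕ) - c)
      (by simp only [Fin.lt_def, Fin.le_def] at *; omega) hKT hKxy rfl
    exact ⟨Q, i, j, .sub H P a b hP D hD K hK Q i j hQ, h1, h2⟩

/-! ### Leaf forests are coverings -/

theorem exists_step_of_reflTransGen {V : Type*} {r : V → V → Prop} {a b : V}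
    (h : Relation.ReflTransGen r a b) (S : V → Prop) (ha : ¬ S a) (hb : S b) :
    ∃ u v, Relation.ReflTransGen r a u ∧ r u v ∧ Relation.ReflTransGen r v b ∧ ¬ S u ∧ S v := by
  induction h with
  | refl => exact absurd hb ha
  | @tail c b hac hcb ih =>
    by_cases hc : S c
    · obtain ⟨u, v, h1, h2, h3, h4⟩ := ih hc
      exact ⟨u, v, h1, h2, h3.tail hcb, h4⟩
    · exact ⟨c, b, hac, hcb, .refl, hc, hb⟩

theorem reflTransGen_up_closed {T : SimpleGraph (Vertex n)} {i j u v : Vertex n}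
    (hcl : ∀ x y, i < x → x ≤ j → T.Adj x y → y ≤ j) (hu : i < u) (huj : u ≤ j)
    (h : Relation.ReflTransGen (Up T) u v) : i < v ∧ v ≤ j := by
  induction h with
  | refl => exact ⟨hu, huj⟩
  | tail _ h ih => exact ⟨ih.1.trans h.1, hcl _ _ ih.1 ih.2 h.2⟩

theorem reflTransGen_up_closed' {T : SimpleGraph (Vertex n)} {i j u v : Vertex n}
    (hcl : ∀ x y, i ≤ x → x < j → T.Adj x y → i ≤ y) (hv : i ≤ v) (hvj : v < j)
    (h : Relation.ReflTransGen (Up T) u v) : i ≤ u ∧ u < j := by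
  induction h using Relation.ReflTransGen.head_induction_on with
  | refl => exact ⟨hv, hvj⟩
  | head h _ ih => exact ⟨hcl _ _ ih.1 ih.2 h.2.symm, h.1.trans ih.2⟩

/-! ### Long edges of a covering forest at the ends of an interval -/

section Covering

variable {T F : SimpleGraph (Vertex n)} (hnc : Noncrossing F) (halt : Alternating F)
  (hcov : ∀ p q, Up T p q → ∃ e : Vertex n × Vertex n, Up F e.1 e.2 ∧ Covers T e (p, q))
include hnc halt hcov

/-- The last step of the path is covered by an edge of `F`, which must end at j because no edge
leaves (i, j] to the right. Let s be least with (s, j) in `F`. If i < s, the step of the path that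
reaches or passes s is covered by some (s', t') in `F` with s' < s ≤ t' ≤ j; alternation excludes t'
= s, noncrossing excludes s < t' < j, and minimality excludes t' = j. -/
theorem exists_right_edge {i j : Vertex n} (hij : i < j) (hpath : Relation.ReflTransGen (Up T) i j)
    (hcl : ∀ x y, i < x → x ≤ j → T.Adj x y → y ≤ j) : ∃ i₁, i₁ ≤ i ∧ F.Adj i₁ j := by
  classical
  have hex : ∃ s, s < j ∧ F.Adj s j := by
    rcases hpath.cases_tail with h | ⟨p, -, hp⟩
    · exact absurd h hij.ne'
    obtain ⟨e, he, -, -, h3⟩ := hcov p j hp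
    have := (reflTransGen_up_closed hcl hij le_rfl h3).2
    have hej : e.2 = j := le_antisymm this (le_of_reflTransGen_up h3)
    exact ⟨e.1, hej ▸ he.1, hej ▸ he.2⟩
  obtain ⟨s, hs, hmin⟩ := (Finset.univ.filter fun s => s < j ∧ F.Adj s j).exists_min_image id
    (by simpa [Finset.Nonempty] using hex)
  simp only [Finset.mem_filter, Finset.mem_univ, true_and, id] at hs hmin
  refine ⟨s, not_lt.mp fun his => ?_, hs.2⟩
  obtain ⟨u, v, h1, h2, h3, h4, h5⟩ := exists_step_of_reflTransGen hpath (fun z => s ≤ z)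
    his.not_ge hs.1.le
  obtain ⟨⟨s', t'⟩, he, c1, -, c3⟩ := hcov u v h2
  simp only at he c1 c3
  have hs' : s' < s := (le_of_reflTransGen_up c1).trans_lt (not_le.mp h4)
  have hst : s ≤ t' := h5.trans (le_of_reflTransGen_up c3)
  have htj := (reflTransGen_up_closed hcl (his.trans_le h5) (le_of_reflTransGen_up h3) c3).2
  have hne : s ≠ t' := by
    rintro rfl
    exact halt s' s j hs' hs.1 ⟨he.2, hs.2⟩
  rcases htj.lt_or_eq with htj | rfl
  · exact hnc s' s t' j hs' (lt_of_le_of_ne hst hne) htj ⟨he.2, hs.2⟩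
  · exact (hmin s' he).not_gt hs'

/-- Mirror image of `exists_right_edge`, with the greatest s such that (i, s) is an edge of `F`. -/
theorem exists_left_edge {i j : Vertex n} (hij : i < j) (hpath : Relation.ReflTransGen (Up T) i j)
    (hcl : ∀ x y, i ≤ x → x < j → T.Adj x y → i ≤ y) : ∃ j₁, j ≤ j₁ ∧ F.Adj i j₁ := by
  classical
  have hex : ∃ s, i < s ∧ F.Adj i s := by
    rcases hpath.cases_head with h | ⟨p, hp, -⟩
    · exact absurd h hij.ne
    obtain ⟨e, he, h1, -, -⟩ := hcov i p hp
    have := (reflTransGen_up_closed' hcl le_rfl hij h1).1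
    have hei : e.1 = i := le_antisymm (le_of_reflTransGen_up h1) this
    exact ⟨e.2, hei ▸ he.1, hei ▸ he.2⟩
  obtain ⟨s, hs, hmax⟩ := (Finset.univ.filter fun s => i < s ∧ F.Adj i s).exists_max_image id
    (by simpa [Finset.Nonempty] using hex)
  simp only [Finset.mem_filter, Finset.mem_univ, true_and, id] at hs hmax
  refine ⟨s, not_lt.mp fun hsj => ?_, hs.2⟩
  obtain ⟨u, v, h1, h2, h3, h4, h5⟩ := exists_step_of_reflTransGen hpath (fun z => s < z)
    hs.1.not_gt hsj
  obtain ⟨⟨s', t'⟩, he, c1, -, c3⟩ := hcov u v h2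
  simp only at he c1 c3
  have ht' : s < t' := h5.trans_le (le_of_reflTransGen_up c3)
  have hst : s' ≤ s := (le_of_reflTransGen_up c1).trans (not_lt.mp h4)
  have his' := (reflTransGen_up_closed' hcl (le_of_reflTransGen_up h1)
    ((not_lt.mp h4).trans_lt hsj) c1).1
  have hne : s' ≠ s := by
    rintro rfl
    exact halt i s' t' hs.1 ht' ⟨hs.2, he.2⟩
  rcases his'.lt_or_eq with his' | rfl
  · exact hnc i s' s t' his' (lt_of_le_of_ne hst hne) ht' ⟨hs.2, he.2⟩
  · exact (hmax t' he).not_gt ht'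

end Covering

/-- A noncrossing alternating forest in the transitive closure of `T` is a leaf forest of `T` if
and only if the increasing paths in `T` between the endpoints of its edges cover `T`. -/
theorem isLeafForest_iff_covers {T F : SimpleGraph (Vertex n)}
    (hT : IntervalTree T 0 (Fin.last n)) (hnc : Noncrossing F) (halt : Alternating F)
    (hac : F.IsAcyclic) (hle : F ≤ transClosure T) :
    IsLeafForest T F ↔
      ∀ p q, Up T p q → ∃ e : Vertex n × Vertex n, Up F e.1 e.2 ∧ Covers T e (p, q) := by
  have hTT : SubIntervalTree T T 0 (Fin.last n) := by
    refine ⟨hT, ?_, .inl fun _ y _ _ _ => ⟨Fin.zero_le y, Fin.le_last y⟩⟩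
    ext x y
    simp [within, Fin.le_last]
  constructor
  · intro hF p q hpq
    obtain ⟨Q, i, j, hQ, h1, h2⟩ := hTT.exists_pseudoComponent hpq.1 hpq.2
    obtain ⟨hij, -, hcl | hcl⟩ := hQ.spec hTT
    · have hright : IsRightPseudoComponent T Q i j :=
        ⟨hQ, fun s hs hadj => ((hcl j s hij le_rfl hadj).2).not_gt hs⟩
      obtain ⟨i₁, hi₁, hadj⟩ := hF.right_edge Q i j hright
      have hlt := hi₁.trans_lt hij
      have hpath := (le_transClosure_iff.mp hle i₁ j hlt hadj).to_reflTransGen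
      -- Edges of `T` enter (i, j] only from `i`, so the increasing path from `i₁` to `j` passes
      -- through `i`; from there it can be rerouted through (p, q).
      obtain ⟨u, v, g1, g2, -, g4, g5⟩ := exists_step_of_reflTransGen hpath
        (fun z => i < z ∧ z ≤ j) (fun h => h.1.not_ge hi₁) ⟨hij, le_rfl⟩
      have hu := hcl v u g5.1 g5.2 g2.2.symm
      have hui : u = i := by
        by_contra hne
        exact g4 ⟨lt_of_le_of_ne hu.1 (Ne.symm hne), hu.2⟩
      exact ⟨(i₁, j), ⟨hlt, hadj⟩, (hui ▸ g1).trans h1, hpq, h2⟩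
    · have hleft : IsLeftPseudoComponent T Q i j :=
        ⟨hQ, fun s hs hadj => ((hcl i s le_rfl hij hadj.symm).1).not_gt hs⟩
      obtain ⟨j₁, hj₁, hadj⟩ := hF.left_edge Q i j hleft
      have hlt := hij.trans_le hj₁
      have hpath := (le_transClosure_iff.mp hle i j₁ hlt hadj).to_reflTransGen
      obtain ⟨u, v, -, g2, g3, g4, g5⟩ := exists_step_of_reflTransGen hpath
        (fun z => ¬ (i ≤ z ∧ z < j)) (fun h => h ⟨le_rfl, hij⟩) (fun h => h.2.not_ge hj₁)
      rw [not_not] at g4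
      have hv := hcl u v g4.1 g4.2 g2.2
      have hvj : v = j := by
        by_contra hne
        exact g5 ⟨hv.1, lt_of_le_of_ne hv.2 hne⟩
      exact ⟨(i, j₁), ⟨hlt, hadj⟩, h1, hpq, h2.trans (hvj ▸ g3)⟩
  · intro hcov
    have hright : ∀ Q i j, IsRightPseudoComponent T Q i j → ∃ i₁, i₁ ≤ i ∧ F.Adj i₁ j := by
      intro Q i j hQ
      obtain ⟨hij, hpath, hcl⟩ := hQ.1.spec hTT
      refine exists_right_edge hnc halt hcov hij hpath fun x y hx hxj hxy => ?_
      -- Both kinds of closed interval confine edges at interior vertices. At `j` itself, the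
      -- definition of a right pseudo-component excludes edges to the right.
      rcases hxj.lt_or_eq with hxj | rfl
      · rcases hcl with hcl | hcl
        · exact (hcl x y hx hxj.le hxy).2
        · exact (hcl x y hx.le hxj hxy).2
      · exact not_lt.mp fun h => hQ.2 y h hxy
    have hleft : ∀ Q i j, IsLeftPseudoComponent T Q i j → ∃ j₁, j ≤ j₁ ∧ F.Adj i j₁ := by
      intro Q i j hQ
      obtain ⟨hij, hpath, hcl⟩ := hQ.1.spec hTT
      refine exists_left_edge hnc halt hcov hij hpath fun x y hx hxj hxy => ?_
      rcases hx.lt_or_eq with hx | rfl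
      · rcases hcl with hcl | hcl
        · exact (hcl x y hx hxj.le hxy).1
        · exact (hcl x y hx.le hxj hxy).1
      · exact not_lt.mp fun h => hQ.2 y h hxy.symm
    obtain ⟨P, hP⟩ := hT.exists_isMainPath
    -- The edge (1, n+1) comes from the main path of `T`, which is a right pseudo-component; `i₁ ≤
    -- 0` leaves no choice.
    obtain ⟨i₁, hi₁, hadj⟩ := hright P 0 (Fin.last n)
      ⟨.main T P _ _ hP, fun s hs => absurd (Fin.le_last s) hs.not_ge⟩
    rw [Fin.le_zero_iff] at hi₁
    exact ⟨hnc, halt, hac, hle, hi₁ ▸ hadj, hright, hleft⟩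

/-! ### Edge sets of simple graphs -/

open Classical in
/-- The edges of `F`, written `(i, j)` with `i < j`. -/
noncomputable def edgePairs (F : SimpleGraph (Vertex n)) : Finset (Vertex n × Vertex n) :=
  Finset.univ.filter fun e => Up F e.1 e.2

theorem mem_edgePairs {F : SimpleGraph (Vertex n)} {e : Vertex n × Vertex n} :
    e ∈ edgePairs F ↔ Up F e.1 e.2 := by
  simp [edgePairs]

theorem edgePairs_injective : Function.Injective (edgePairs (n := n)) := by
  intro F F' h
  have key : ∀ x y, x < y → (F.Adj x y ↔ F'.Adj x y) := fun x y hxy => by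
    have := Finset.ext_iff.mp h (x, y)
    simpa [mem_edgePairs, Up, hxy] using this
  ext x y
  rcases lt_trichotomy x y with hxy | rfl | hxy
  · exact key x y hxy
  · simp
  · rw [F.adj_comm, F'.adj_comm, key y x hxy]

theorem edgePairs_toGraph {w : EdgeWord n} (hlt : ∀ e ∈ w, e.1 < e.2) :
    edgePairs (toGraph w) = w.toFinset := by
  ext e
  rw [mem_edgePairs, List.mem_toFinset]
  exact ⟨fun h => (toGraph_adj_of_lt hlt h.1).mp h.2,
    fun h => ⟨hlt e h, (toGraph_adj_of_lt hlt (hlt e h)).mpr h⟩⟩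

theorem ncard_edgeSet (F : SimpleGraph (Vertex n)) : F.edgeSet.ncard = (edgePairs F).card := by
  have himg : F.edgeSet = (fun e : Vertex n × Vertex n => s(e.1, e.2)) '' edgePairs F := by
    ext e
    induction e using Sym2.ind with
    | _ x y =>
    simp only [SimpleGraph.mem_edgeSet, Set.mem_image, Finset.mem_coe, mem_edgePairs, Prod.exists]
    constructor
    · intro h
      rcases h.ne.lt_or_gt with hlt | hlt
      · exact ⟨x, y, ⟨hlt, h⟩, rfl⟩
      · exact ⟨y, x, ⟨hlt, h.symm⟩, Sym2.eq_swap⟩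
    · rintro ⟨a, b, h, heq⟩
      rcases Sym2.eq_iff.mp heq with ⟨rfl, rfl⟩ | ⟨rfl, rfl⟩
      · exact h.2
      · exact h.2.symm
  rw [himg, Set.InjOn.ncard_image, Set.ncard_coe_finset]
  intro e he f hf h
  rw [Finset.mem_coe, mem_edgePairs] at he hf
  rcases Sym2.eq_iff.mp h with h | h
  · exact Prod.ext h.1 h.2
  · have := he.1
    rw [h.1, h.2] at this
    exact absurd this hf.1.not_gt

theorem noncrossingAlternating_edgePairs {F : SimpleGraph (Vertex n)} (hnc : Noncrossing F)
    (halt : Alternating F) : NoncrossingAlternating (edgePairs F) where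
  lt _ he := (mem_edgePairs.mp he).1
  noncrossing i j k l hij hjk hkl h h' :=
    hnc i j k l hij hjk hkl ⟨(mem_edgePairs.mp h).2, (mem_edgePairs.mp h').2⟩
  alternating i j k h h' :=
    halt i j k (mem_edgePairs.mp h).1 (mem_edgePairs.mp h').1
      ⟨(mem_edgePairs.mp h).2, (mem_edgePairs.mp h').2⟩

theorem edgeIndependent_edgePairs {F : SimpleGraph (Vertex n)} (hF : F.IsAcyclic) :
    EdgeIndependent (edgePairs F) :=
  edgeIndependent_of_isAcyclic hF fun _ he => mem_edgePairs.mp he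

theorem openCone_nonempty (E : Finset (Vertex n × Vertex n)) : (openCone E).Nonempty := by
  classical
  exact ⟨_, fun e => if e ∈ E then 1 else 0, ⟨fun e he => by simp [he], fun e he => by simp [he]⟩,
    rfl⟩

/-! ### Good trees -/

theorem intervalTree_of_isTree {T : SimpleGraph (Vertex n)} (hn : 1 ≤ n) (hT : T.IsTree)
    (hnc : Noncrossing T) : IntervalTree T 0 (Fin.last n) where
  lt := by
    rw [Fin.lt_def]
    exact hn
  noncrossing := hnc
  acyclic := hT.isAcyclic
  support x := by
    refine ⟨fun _ => ⟨Fin.zero_le x, Fin.le_last x⟩, fun _ => ?_⟩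
    have : Nontrivial (Vertex n) := Fin.nontrivial_iff_two_le.mpr (by omega)
    obtain ⟨y, hy⟩ := exists_ne x
    exact SimpleGraph.mem_support_of_reachable hy.symm (hT.connected.preconnected x y)
  reach x _ _ := hT.connected.preconnected 0 x

section GoodTree

variable {T F : SimpleGraph (Vertex n)} (hT : IntervalTree T 0 (Fin.last n))
include hT

theorem IsLeafForest.openCone_subset (hF : IsLeafForest T F) :
    openCone (edgePairs F) ⊆ openCone (edgePairs T) := by
  have hcov := (isLeafForest_iff_covers hT hF.noncrossing hF.alternating hF.acyclic
    hF.le_transClosure).mp hF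
  refine openCone_subset_of_covers (G := T) (fun f => mem_edgePairs) (fun e he => ?_)
    (edgeIndependent_edgePairs hT.acyclic) fun f hf => ?_
  · have he := mem_edgePairs.mp he
    exact le_transClosure_iff.mp hF.le_transClosure e.1 e.2 he.1 he.2
  · obtain ⟨e, he, hc⟩ := hcov f.1 f.2 (mem_edgePairs.mp hf)
    exact ⟨e, mem_edgePairs.mpr he, hc⟩

theorem isLeafForest_of_mem_openCone (hnc : Noncrossing F) (halt : Alternating F)
    (hac : F.IsAcyclic) (hle : F ≤ transClosure T) {v : Vertex n → ℤ}
    (hvF : v ∈ openCone (edgePairs F)) (hvT : v ∈ openCone (edgePairs T)) : IsLeafForest T F := by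
  rw [isLeafForest_iff_covers hT hnc halt hac hle]
  intro p q hpq
  obtain ⟨e, he, hc⟩ := covers_of_mem_openCone (G := T) (fun f => mem_edgePairs)
    (fun e he => le_transClosure_iff.mp hle e.1 e.2 (mem_edgePairs.mp he).1 (mem_edgePairs.mp he).2)
    (edgeIndependent_edgePairs hT.acyclic) hvF hvT (p, q) (mem_edgePairs.mpr hpq)
  exact ⟨e, mem_edgePairs.mp he, hc⟩

end GoodTree

theorem GoodWord.noncrossing_toGraph {w : EdgeWord n} (hw : GoodWord w) :
    Noncrossing (toGraph w) := fun i j k l hij hjk hkl h =>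
  hw.noncrossing i j k l hij hjk hkl ((toGraph_adj_of_lt hw.lt (hij.trans hjk)).mp h.1)
    ((toGraph_adj_of_lt hw.lt (hjk.trans hkl)).mp h.2)

theorem alternating_toGraph {w : EdgeWord n} (hlt : ∀ e ∈ w, e.1 < e.2)
    (h : ∀ i j k : Vertex n, (i, j) ∈ w → (j, k) ∉ w) : Alternating (toGraph w) :=
  fun i j k hij hjk h' => h i j k ((toGraph_adj_of_lt hlt hij).mp h'.1)
    ((toGraph_adj_of_lt hlt hjk).mp h'.2)

theorem GoodWord.isAcyclic_toGraph {w : EdgeWord n} (hw : GoodWord w) : (toGraph w).IsAcyclic :=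
  isAcyclic_of_edgeIndependent hw.independent fun _ _ hab h =>
    List.mem_toFinset.mpr ((toGraph_adj_of_lt hw.lt hab).mp h)

theorem toGraph_perm {w w' : EdgeWord n} (h : w.Perm w') : toGraph w = toGraph w' := by
  simp only [toGraph, h.mem_iff]

/-! ### Lexicographic labels -/

theorem lexLess_irrefl (e : Vertex n × Vertex n) : ¬ LexLess e e := by
  simp [LexLess]

theorem lexLess_trichotomy {e f : Vertex n × Vertex n} (h : e ≠ f) : LexLess e f ∨ LexLess f e := by
  obtain ⟨a, b⟩ := e
  obtain ⟨c, d⟩ := f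
  simp only [LexLess, ne_eq, Prod.mk.injEq, Fin.ext_iff, gt_iff_lt, Fin.lt_def] at *
  omega

theorem lexLess_asymm {e f : Vertex n × Vertex n} (h : LexLess e f) : ¬ LexLess f e := by
  simp only [LexLess, Fin.ext_iff, gt_iff_lt, Fin.lt_def] at *
  omega

theorem HasLexLabels.pairwise {w : EdgeWord n} (h : HasLexLabels w) :
    w.Pairwise fun e f => ¬ LexLess f e :=
  pairwise_of_getElem? fun a b x y hab hx hy hlt => (h b a y x hy hx hlt).not_gt hab

theorem hasLexLabels_of_pairwise {w : EdgeWord n} (h : w.Pairwise fun e f => ¬ LexLess f e) :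
    HasLexLabels w := by
  intro a b e f he hf hlt
  by_contra! hle
  rcases hle.lt_or_eq with hba | rfl
  · obtain ⟨ha, rfl⟩ := List.getElem?_eq_some_iff.mp he
    obtain ⟨hb, rfl⟩ := List.getElem?_eq_some_iff.mp hf
    exact List.pairwise_iff_getElem.mp h b a hb ha hba hlt
  · rw [he, Option.some_inj] at hf
    exact lexLess_irrefl e (hf ▸ hlt)

/-- For an alternating graph the condition on edges (i, j), (j, k) is vacuous, and the other two
order conditions are instances of the lexicographic order. -/
theorem HasLexLabels.mustPrecede {w : EdgeWord n} (h : HasLexLabels w)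
    (halt : ∀ i j k : Vertex n, (i, j) ∈ w → (j, k) ∉ w) :
    w.Pairwise fun e f => ¬ MustPrecede f e := by
  refine h.pairwise.imp_of_mem fun {e f} he hf hlex hmust => ?_
  rcases hmust with h | h | h
  · exact halt f.1 f.2 e.2 hf (by rw [h]; exact he)
  · exact hlex (.inl h.2)
  · exact hlex (.inr h)

theorem HasLexLabels.eq_of_perm {w w' : EdgeWord n} (h : HasLexLabels w) (h' : HasLexLabels w')
    (hp : w.Perm w') : w = w' :=
  hp.eq_of_pairwise (fun e f _ _ hef hfe => by
    by_contra hne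
    exact (lexLess_trichotomy hne).elim hfe hef) h.pairwise h'.pairwise

theorem exists_perm_hasLexLabels (w : EdgeWord n) : ∃ w', w.Perm w' ∧ HasLexLabels w' := by
  classical
  have : Std.Total fun e f : Vertex n × Vertex n => ¬ LexLess f e :=
    ⟨fun e f => by
      by_cases h : LexLess f e
      · exact .inr (lexLess_asymm h)
      · exact .inl h⟩
  have : IsTrans (Vertex n × Vertex n) fun e f => ¬ LexLess f e :=
    ⟨fun e f g => by
      simp only [LexLess, Fin.ext_iff, gt_iff_lt, Fin.lt_def]
      omega⟩
  exact ⟨_, (List.perm_insertionSort (fun e f => ¬ LexLess f e) w).symm,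
    hasLexLabels_of_pairwise (List.pairwise_insertionSort _ w)⟩

theorem alternating_of_mem_lexLeafForests {T : SimpleGraph (Vertex n)} {w : EdgeWord n}
    (hw : w ∈ lexLeafForests T) (i j k : Vertex n) (h : (i, j) ∈ w) : (j, k) ∉ w := by
  intro h'
  have hlt := hw.1.2
  exact hw.2.2.alternating i j k (hlt _ h) (hlt _ h')
    ⟨(toGraph_adj_of_lt hlt (hlt _ h)).mpr h, (toGraph_adj_of_lt hlt (hlt _ h')).mpr h'⟩

/-! ### Leaves of reduction trees -/

theorem existsUnique_of_countP {α : Type*} (p : α → Prop) [DecidablePred p] (l : List α)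
    (h : l.countP (fun a => p a) = 1) : ∃! a : Fin l.length, p (l.get a) := by
  induction l with
  | nil => simp at h
  | cons x l ih =>
    rw [List.countP_cons] at h
    by_cases hx : p x
    · have h0 : ∀ a ∈ l, ¬ p a := by
        simpa [hx, List.countP_eq_zero] using h
      refine ⟨⟨0, by simp⟩, hx, fun a ha => ?_⟩
      rcases a with ⟨_ | a, ha'⟩
      · rfl
      · exact absurd ha (h0 _ (List.getElem_mem (by simpa using ha')))
    · obtain ⟨⟨a, ha⟩, hpa, huniq⟩ := ih (by simpa [hx] using h)
      refine ⟨⟨a + 1, by simpa using ha⟩, hpa, fun b hb => ?_⟩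
      rcases b with ⟨_ | b, hb'⟩
      · exact absurd hb hx
      · have := huniq ⟨b, by simpa using hb'⟩ hb
        simpa using this

section Leaves

variable {T : EdgeWord n} (hT : IsGoodTree T) (hn : 1 ≤ n)
include hT hn

theorem IsGoodTree.intervalTree : IntervalTree (toGraph T) 0 (Fin.last n) :=
  intervalTree_of_isTree hn hT.2 hT.1.noncrossing

/-- The open cone of a leaf is nonempty and lies in that of the root, and one common vector suffices
to make the leaf a leaf forest. -/
theorem IsGoodTree.leaf_spec (t : BReductionTree T) {L : EdgeWord n} (hL : L ∈ t.leaves) :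
    GoodWord L ∧ (∀ i j k : Vertex n, (i, j) ∈ L → (j, k) ∉ L) ∧
      IsLeafForest (toGraph T) (toGraph L) := by
  classical
  have hw := hT.1.goodWord
  obtain ⟨hLw, hirr⟩ := goodWord_reductionInvariant.leaves t hw L hL
  have halt := hLw.alternating_of_irreducible hirr
  have htrans := ((transGen_reductionInvariant (Up (toGraph T))).leaves t (fun e he =>
    .single ⟨hw.lt e he, (toGraph_adj_of_lt hw.lt (hw.lt e he)).mpr he⟩) L hL).1
  have hle : toGraph L ≤ transClosure (toGraph T) := le_transClosure_iff.mpr fun a b hab h =>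
    htrans (a, b) ((toGraph_adj_of_lt hLw.lt hab).mp h)
  obtain ⟨v, hv⟩ := openCone_nonempty L.toFinset
  have hvT : v ∈ openCone T.toFinset := by
    by_contra hvT
    have := countP_openCone_leaves t hw v
    rw [if_neg hvT, List.countP_eq_zero] at this
    exact this L hL (by simpa using hv)
  refine ⟨hLw, halt, isLeafForest_of_mem_openCone (hT.intervalTree hn) hLw.noncrossing_toGraph
    (alternating_toGraph hLw.lt halt) hLw.isAcyclic_toGraph hle (v := v) ?_ ?_⟩
  · rwa [edgePairs_toGraph hLw.lt]
  · rwa [edgePairs_toGraph hw.lt]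

theorem IsGoodTree.exists_lexLeafForest (t : BReductionTree T) {L : EdgeWord n}
    (hL : L ∈ t.leaves) : ∃ F ∈ lexLeafForests (toGraph T), CommEquiv L F := by
  obtain ⟨hLw, halt, hLF⟩ := hT.leaf_spec hn t hL
  obtain ⟨F, hp, hlex⟩ := exists_perm_hasLexLabels L
  have hF : F ∈ lexLeafForests (toGraph T) :=
    ⟨⟨hp.nodup_iff.mp hLw.nodup, fun e he => hLw.lt e (hp.mem_iff.mpr he)⟩, hlex,
      toGraph_perm hp ▸ hLF⟩
  exact ⟨F, hF, commEquiv_of_perm hLw.lt hLw.nodup hLw.pairwise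
    (hlex.mustPrecede (alternating_of_mem_lexLeafForests hF)) hp⟩

/-- Fix any vector in the open cone of `F`. Exactly one leaf has it in its open cone, and a leaf has
it there precisely when its edges are those of `F`. -/
theorem IsGoodTree.existsUnique_leaf (t : BReductionTree T) {F : EdgeWord n}
    (hF : F ∈ lexLeafForests (toGraph T)) :
    ∃! a : Fin t.leaves.length, CommEquiv (t.leaves.get a) F := by
  classical
  have hw := hT.1.goodWord
  have hFalt := alternating_of_mem_lexLeafForests hF
  obtain ⟨hFl, hlex, hFF⟩ := hF
  obtain ⟨v, hv⟩ := openCone_nonempty F.toFinset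
  have hNF := noncrossingAlternating_edgePairs hFF.noncrossing hFF.alternating
  have hvT := hFF.openCone_subset (hT.intervalTree hn) (by rwa [edgePairs_toGraph hFl.2])
  rw [edgePairs_toGraph hw.lt] at hvT
  have hcount := countP_openCone_leaves t hw v
  rw [if_pos hvT] at hcount
  have huniq := existsUnique_of_countP (fun L : EdgeWord n => v ∈ openCone L.toFinset) t.leaves
    hcount
  refine (existsUnique_congr fun a => ?_).mp huniq
  obtain ⟨hLw, halt, hLF⟩ := hT.leaf_spec hn t (List.get_mem t.leaves a)
  have hNL := noncrossingAlternating_edgePairs hLF.noncrossing hLF.alternating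
  rw [edgePairs_toGraph hLw.lt] at hNL
  rw [edgePairs_toGraph hFl.2] at hNF
  constructor
  · intro hvL
    exact commEquiv_of_perm hLw.lt hLw.nodup hLw.pairwise (hlex.mustPrecede hFalt)
      (List.perm_of_nodup_nodup_toFinset_eq hLw.nodup hFl.1 (hNL.eq hNF hvL hv))
  · intro hc
    rwa [List.toFinset_eq_of_perm _ _ hc.perm]

theorem IsGoodTree.exists_tree_leaves_eq :
    ∃ t : BReductionTree T, {w | w ∈ t.leaves} = lexLeafForests (toGraph T) := by
  obtain ⟨t⟩ := nonempty_bReductionTree T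
  have h := fun L (hL : L ∈ t.leaves) => hT.exists_lexLeafForest hn t hL
  choose! φ hφ hc using h
  obtain ⟨t', ht'⟩ := exists_tree_map_leaves t φ hc
  refine ⟨t', ?_⟩
  ext F
  change F ∈ t'.leaves ↔ _
  rw [ht', List.mem_map]
  constructor
  · rintro ⟨L, hL, rfl⟩
    exact hφ L hL
  · intro hF
    obtain ⟨a, ha, -⟩ := hT.existsUnique_leaf hn t hF
    have hL := List.get_mem t.leaves a
    exact ⟨_, hL, (hφ _ hL).2.1.eq_of_perm hF.2.1 ((hc _ hL).symm.trans ha).perm⟩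

open Classical in
-- The open cones of the leaf forests partition that of `T`: a forest containing a given vector is
-- found among the leaves of any `𝓑`-reduction tree, and it is unique because noncrossing
-- alternating graphs are determined by one vector.
theorem IsGoodTree.card_leafForests_openCone (v : Vertex n → ℤ) :
    (Finset.univ.filter fun F => IsLeafForest (toGraph T) F ∧ v ∈ openCone (edgePairs F)).card =
      if v ∈ openCone T.toFinset then 1 else 0 := by
  have hw := hT.1.goodWord
  have hTT := hT.intervalTree hn
  split_ifs with hv
  · obtain ⟨t⟩ := nonempty_bReductionTree T
    have hcount := countP_openCone_leaves t hw v
    rw [if_pos hv] at hcount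
    obtain ⟨L, hL, hvL⟩ := List.countP_pos_iff.mp (hcount ▸ Nat.one_pos)
    obtain ⟨hLw, -, hLF⟩ := hT.leaf_spec hn t hL
    have hvL : v ∈ openCone (edgePairs (toGraph L)) := by
      simpa [edgePairs_toGraph hLw.lt] using hvL
    rw [Finset.card_eq_one]
    refine ⟨toGraph L, ?_⟩
    ext F
    simp only [Finset.mem_filter, Finset.mem_univ, true_and, Finset.mem_singleton]
    constructor
    · rintro ⟨hF, hvF⟩
      exact edgePairs_injective
        ((noncrossingAlternating_edgePairs hF.noncrossing hF.alternating).eq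
          (noncrossingAlternating_edgePairs hLF.noncrossing hLF.alternating) hvF hvL)
    · rintro rfl
      exact ⟨hLF, hvL⟩
  · rw [Finset.card_eq_zero, Finset.filter_eq_empty_iff]
    rintro F - ⟨hF, hvF⟩
    have := hF.openCone_subset hTT hvF
    rw [edgePairs_toGraph hw.lt] at this
    exact hv this

/-- Leaves here may cross and cannot be matched with leaf forests one by one. Both families consist
of alternating forests whose open cones partition that of `T`, so counting vectors by height gives
equal numbers. -/
theorem IsGoodTree.countP_sReductionTree (t : SReductionTree (T : EdgeMultiset n)) (k : ℕ) :
    t.leaves.countP (fun m => m.card = k) =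
      {F : SimpleGraph (Vertex n) |
        IsLeafForest (toGraph T) F ∧ F.edgeSet.ncard = k}.ncard := by
  classical
  have hw := hT.1.goodWord
  have hm : ForestMultiset (T : EdgeMultiset n) := ⟨by simpa using hw.lt, by simpa using hw.nodup,
    by simpa using hw.independent⟩
  have htoList : ∀ (s : Finset (SimpleGraph (Vertex n))) (p : SimpleGraph (Vertex n) → Prop)
      [DecidablePred p], s.toList.countP (fun F => p F) = (s.filter p).card := fun s p _ => by
    rw [← Multiset.coe_countP, Finset.coe_toList, Multiset.countP_eq_card_filter,
      Finset.card_def, Finset.filter_val]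
  have hleaves := hm.leaves t
  have key := countP_card_eq (t.leaves.map Multiset.toFinset)
    ((Finset.univ.filter fun F => IsLeafForest (toGraph T) F).toList.map edgePairs) ?_ ?_ ?_ k
  · rw [List.countP_map, List.countP_map] at key
    calc t.leaves.countP (fun m => m.card = k)
        = t.leaves.countP ((fun E : Finset (Vertex n × Vertex n) => decide (E.card = k)) ∘
            Multiset.toFinset) := by
          refine List.countP_congr fun L hL => ?_
          simp [Multiset.toFinset_card_of_nodup (hleaves L hL).1.nodup]
      _ = _ := key
      _ = ((Finset.univ.filter fun F => IsLeafForest (toGraph T) F).filter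
            fun F => (edgePairs F).card = k).card :=
          htoList _ fun F => (edgePairs F).card = k
      _ = _ := by
          rw [← Set.ncard_coe_finset]
          congr 1
          ext F
          simp [ncard_edgeSet]
  · intro E hE
    obtain ⟨L, hL, rfl⟩ := List.mem_map.mp hE
    obtain ⟨h1, h2⟩ := hleaves L hL
    exact ⟨h1.independent, by simpa using h2⟩
  · intro E hE
    obtain ⟨F, hF, rfl⟩ := List.mem_map.mp hE
    have hF : IsLeafForest (toGraph T) F := by simpa using hF
    exact ⟨edgeIndependent_edgePairs hF.acyclic,
      (noncrossingAlternating_edgePairs hF.noncrossing hF.alternating).alternating⟩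
  · intro v
    rw [List.countP_map, List.countP_map]
    have h1 := hm.countP_openCone_leaves t v
    have h2 := hT.card_leafForests_openCone hn v
    have h3 := htoList (Finset.univ.filter fun F => IsLeafForest (toGraph T) F)
      fun F => v ∈ openCone (edgePairs F)
    rw [Finset.filter_filter, h2] at h3
    exact h1.trans h3.symm

end Leaves

end RootPoly

theorem mainTheorem8 (n : ℕ) (hn : 1 ≤ n) (T : RootPoly.EdgeWord n)
    (hT : RootPoly.IsGoodTree T) :
    -- every reduction tree in the noncommutative case
    (∀ t : RootPoly.BReductionTree T,
      (∀ w ∈ t.leaves, ∃ F ∈ RootPoly.lexLeafForests (RootPoly.toGraph T),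
        RootPoly.CommEquiv w F) ∧
      (∀ F ∈ RootPoly.lexLeafForests (RootPoly.toGraph T),
        ∃! a : Fin t.leaves.length, RootPoly.CommEquiv (t.leaves.get a) F)) ∧
    -- a suitable reduction tree in the noncommutative case
    (∃ t : RootPoly.BReductionTree T,
      {w | w ∈ t.leaves} = RootPoly.lexLeafForests (RootPoly.toGraph T)) ∧
    -- every reduction tree in the commutative case, of which there is at least one
    Nonempty (RootPoly.SReductionTree (T : RootPoly.EdgeMultiset n)) ∧
    (∀ (t : RootPoly.SReductionTree (T : RootPoly.EdgeMultiset n)) (k : ℕ),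
      t.leaves.countP (fun m => m.card = k) =
        {F : SimpleGraph (RootPoly.Vertex n) |
          RootPoly.IsLeafForest (RootPoly.toGraph T) F ∧ F.edgeSet.ncard = k}.ncard) :=
  ⟨fun t => ⟨fun _ hL => hT.exists_lexLeafForest hn t hL, fun _ hF => hT.existsUnique_leaf hn t hF⟩,
    hT.exists_tree_leaves_eq hn, RootPoly.nonempty_sReductionTree _, hT.countP_sReductionTree hn⟩
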